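/- **Setting.** Let $n\ge 2$, let $\gamma_n$ be the Gaussian measure on $\mathbb R^n$ with density $(2\pi)^{-n/2}e^{-\|x\|^2/2}$, and for $|\rho|<1$ let $$T_\rho f(x)=\int_{\mathbb R^n} f\big(\rho x+\sqrt{1-\rho^2}\,y\big)\,d\gamma_n(y),\qquad F_\rho(A)=\int_{\mathbb R^n}1_A\,T_\rho 1_A\,d\gamma_n .$$ Let $r>0$, $B=\{x\in\mathbb R^n:\|x\|<r\}$, and let $A$ be $B$ or $B^c$, with unit exterior normal $N$ on $\partial A$. A *symmetric variation* of $A$ is a family $A^{(t)}=\Psi(A,t)$, $-1<t<1$, where $X$ is a smooth vector field on $\mathbb R^n$ and $\Psi:\mathbb R^n\times(-1,1)\to\mathbb R^n$ is its smooth flow ($\Psi(x,0)=x$, $\partial_t\Psi(x,t)=X(\Psi(x,t))$), such that $A^{(t)}=-A^{(t)}$ for all $t\in(-1,1)$, $\int_{\partial A}\langle X,N\rangle^2\,dx=1$ for the surface measure $dx$ on $\partial A$, and $$\tfrac{d}{dt}\big|_{t=0}\gamma_n(A^{(t)})=0,\qquad \tfrac{d^2}{dt^2}\big|_{t=0}\gamma_n(A^{(t)})=0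 .$$ **Theorem.** (1) If $r^2<n+2$, there is $\rho_0>0$, depending only on $n$ and $r$, such that for all $\rho$ with $0<|\rho|<\rho_0$, for $A=B$ and for $A=B^c$, and for every symmetric variation $A^{(t)}$ of $A$: the second derivative of $t\mapsto F_\rho(A^{(t)})$ at $t=0$ exists, $$\tfrac{d}{dt}\big|_{t=0}F_\rho(A^{(t)})=0,\qquad \tfrac{d^2}{dt^2}\big|_{t=0}F_\rho(A^{(t)})<0,$$ and consequently $F_\rho(A^{(t)})<F_\rho(A)$ for all sufficiently small $t\neq0$. That is, $A$ strictly locally maximizes noise stability along such variations. (2) If $r^2>n+2$, there is $\rho_0>0$, depending only on $n$ and $r$, such that for all $\rho$ with $0<|\rho|<\rho_0$, and for $A=B$ as well as for $A=B^c$, there is a symmetric variation $A^{(t)}$ of $A$, with $\gamma_n(A^{(t)})=\gamma_n(A)$ for all $t$ sufficiently near $0$, such that the second derivative of $t\mapsto F_\rho(A^{(t)})$ at $t=0$ exists, $$\tfrac{d}{dt}\big|_{t=0}F_\rho(A^{(t)})=0,\qquad \tfrac{d^2}{dt^2}\big|_{t=0}F_\rho(A^{(t)})>0,$$ and consequently $F_\rho(A^{(t)})>F_\rho(A)$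 for all sufficiently small $t\neq0$. That is, $A$ does not locally maximize noise stability among symmetric sets of the same Gaussian measure. -/

import Mathlib

open MeasureTheory Set Filter Topology
open scoped ContDiff

noncomputable section

/-- The Gaussian measure on `ℝⁿ`, with density `(2π)^(-n/2) exp(-‖x‖²/2)`. -/
def gaussianMeasure (n : ℕ) : Measure (EuclideanSpace ℝ (Fin n)) :=
  volume.withDensity fun x =>
    ENNReal.ofReal ((2 * Real.pi) ^ (-(n : ℝ) / 2) * Real.exp (-‖x‖ ^ 2 / 2))

/-- The Ornstein-Uhlenbeck operator with correlation `ρ`,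
`T_ρ f (x) = ∫ f (ρ x + √(1 - ρ²) y) dγ(y)`. -/
def ornsteinUhlenbeck (n : ℕ) (ρ : ℝ) (f : EuclideanSpace ℝ (Fin n) → ℝ)
    (x : EuclideanSpace ℝ (Fin n)) : ℝ :=
  ∫ y, f (ρ • x + Real.sqrt (1 - ρ ^ 2) • y) ∂gaussianMeasure n

/-- The noise stability `F_ρ(A) = ∫ 1_A T_ρ 1_A dγ`. -/
def noiseStability (n : ℕ) (ρ : ℝ) (A : Set (EuclideanSpace ℝ (Fin n))) : ℝ :=
  ∫ x, A.indicator (fun _ => (1 : ℝ)) x *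
    ornsteinUhlenbeck n ρ (A.indicator (fun _ => (1 : ℝ))) x ∂gaussianMeasure n

/-- The surface measure on the sphere of radius `r` centred at the origin of `ℝⁿ`, as a measure
on `ℝⁿ`: `r^(n-1)` times the image, under `u ↦ r u`, of the surface measure of the unit sphere. -/
def sphereSurfaceMeasure (n : ℕ) (r : ℝ) : Measure (EuclideanSpace ℝ (Fin n)) :=
  ENNReal.ofReal (r ^ (n - 1)) •
    Measure.map
      (fun u : Metric.sphere (0 : EuclideanSpace ℝ (Fin n)) 1 => r • (u : EuclideanSpace ℝ (Fin n)))
      (volume : Measure (EuclideanSpace ℝ (Fin n))).toSphere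

/-- `f` is differentiable near `t` and its derivative function has derivative `d` at `t`. -/
def HasSecondDerivAt (f : ℝ → ℝ) (d t : ℝ) : Prop :=
  ∃ f' : ℝ → ℝ, (∀ᶠ s in 𝓝 t, HasDerivAt f (f' s) s) ∧ HasDerivAt f' d t

/-- `Ψ : ℝⁿ × (-1, 1) → ℝⁿ` is the (smooth) flow of the smooth vector field `X`. -/
structure IsSmoothFlow {n : ℕ} (X : EuclideanSpace ℝ (Fin n) → EuclideanSpace ℝ (Fin n))
    (Ψ : EuclideanSpace ℝ (Fin n) → ℝ → EuclideanSpace ℝ (Fin n)) : Prop where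
  smooth_field : ContDiff ℝ ∞ X
  smooth_flow : ContDiffOn ℝ ∞ (fun p : EuclideanSpace ℝ (Fin n) × ℝ => Ψ p.1 p.2)
    (univ ×ˢ Ioo (-1 : ℝ) 1)
  initial : ∀ x, Ψ x 0 = x
  ode : ∀ x, ∀ t ∈ Ioo (-1 : ℝ) 1, HasDerivAt (Ψ x) (X (Ψ x t)) t

/-- The set `A^(t) = Ψ(A, t)`. -/
def flowSet {n : ℕ} (Ψ : EuclideanSpace ℝ (Fin n) → ℝ → EuclideanSpace ℝ (Fin n))
    (A : Set (EuclideanSpace ℝ (Fin n))) (t : ℝ) : Set (EuclideanSpace ℝ (Fin n)) :=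
  (fun x => Ψ x t) '' A

/-- The variation `A^(t) = Ψ(A, t)`, `-1 < t < 1`, generated by `X`, of a set `A` bounded by the
sphere of radius `r` about the origin: all the sets `A^(t)` are symmetric, the normal component
of `X` on the boundary has `L²` norm one with respect to surface measure, and the Gaussian measure
of `A^(t)` is preserved to second order at `t = 0`.  The unit exterior normal at `x` is `x / ‖x‖`
for the ball and `-x / ‖x‖` for its complement; the sign does not affect the square. -/
structure IsSymmetricVariation {n : ℕ} (r : ℝ) (A : Set (EuclideanSpace ℝ (Fin n)))
    (X : EuclideanSpace ℝ (Fin n) → EuclideanSpace ℝ (Fin n))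
    (Ψ : EuclideanSpace ℝ (Fin n) → ℝ → EuclideanSpace ℝ (Fin n)) : Prop where
  flow : IsSmoothFlow X Ψ
  symmetric : ∀ t ∈ Ioo (-1 : ℝ) 1, ∀ x, x ∈ flowSet Ψ A t ↔ -x ∈ flowSet Ψ A t
  normalized : ∫ x, (inner ℝ (X x) (‖x‖⁻¹ • x)) ^ 2 ∂sphereSurfaceMeasure n r = 1
  first_order : HasDerivAt (fun t => (gaussianMeasure n).real (flowSet Ψ A t)) 0 0
  second_order : HasSecondDerivAt (fun t => (gaussianMeasure n).real (flowSet Ψ A t)) 0 0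

end

/-! Noise stability is the integral over `A × A` of the Mehler kernel `k`, the joint density of two
`ρ`-correlated Gaussian vectors (`noiseStability_eq_setIntegral`). Along a flow, the integral of a
weight `w` over the moving set has derivative `∫ div (w X)`. Applied on the product space to the
field `(X, X)`, this gives the first two derivatives, and on the ball `B` the divergence theorem
moves them to the sphere `S` of radius `r`.

Let `f` be the normal component of `X` on `S`. The first variation is `2 ∫_S f(x) ∫_B k(x, y) dy
dx`. The inner integral is constant on `S` by rotation invariance, and `∫_S f = 0` by preservation
of measure, so it vanishes. In the second variation, the identity `∇ₓk = -ρ ∇_y k - k x`,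
preservation of measure to second order and rotation invariance leave, up to a positive factor, `∬
exp(τ⟨x, y⟩) f(x) f(y) - (ρ/r²) ∫ ⟨x₀, y⟩ exp(τ⟨x₀, y⟩) dy` with `τ = ρ/(1 - ρ²)` and any `x₀` in
`S` (`second_variation_ball`).

For small `ρ`, expand in `τ`. Besides having mean zero, `f` is orthogonal to linear functions,
because symmetric sets have vanishing first moments. The double integral therefore begins with
`(τ²/2) ‖M‖²`, the Hilbert-Schmidt norm of the operator `M = ∫ f(y) y ⊗ y dy`, and the subtracted
term begins with `τ² r V`, where `V` is the volume of `B`. Among `f` of mean zero and norm one,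
`‖M‖²` is at most `2 r³ V/(n + 2)`, with equality for traceless quadratic forms
(`hilbertSchmidtSq_momentOperator_le` and `hilbertSchmidtSq_momentOperator_ge`). The extremal
coefficient of `τ²` is thus `r V (r²/(n + 2) - 1)`, whose sign is the dichotomy; the error is `O(|ρ|
τ²)` uniformly in `f` (`abs_sphereForm_sub_le`).

When `r² > n + 2`, a variation whose normal component is a traceless quadratic form is needed.
Dividing a traceless symmetric linear field by a multiple of `exp(-‖x‖²/2)` near the ball makes
density times field divergence free, so the measure is preserved. A cutoff away from the ball keeps
the divisor bounded below, and the flow is a time change of the linear one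
(`exists_symmetricVariation_saddle`). The complement of the ball reduces to the ball, since the two
noise stabilities differ by an affine function of the measure (`noiseStability_compl`). -/

/-! ### Smooth local flows and their Jacobians -/

section FlowVariation

variable {E : Type*} [NormedAddCommGroup E] [NormedSpace ℝ E]

/-- The divergence of a vector field, as the trace of its derivative. -/
noncomputable def vdiv (Y : E → E) (x : E) : ℝ :=
  LinearMap.trace ℝ E (fderiv ℝ Y x : E →ₗ[ℝ] E)

/-- The divergence of `w • X`, in expanded form: the derivative of a density `w` transported by
the flow of `X`. -/
noncomputable def transportDeriv (X : E → E) (w : E → ℝ) (x : E) : ℝ :=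
  fderiv ℝ w x (X x) + w x * vdiv X x

/-- A smooth flow, defined for times in `(-1, 1)`, on a normed space. -/
structure IsSmoothLocalFlow (X : E → E) (Ψ : E → ℝ → E) : Prop where
  contDiff_field : ContDiff ℝ ∞ X
  contDiffOn_flow : ContDiffOn ℝ ∞ (fun p : E × ℝ => Ψ p.1 p.2) (univ ×ˢ Ioo (-1 : ℝ) 1)
  initial : ∀ x, Ψ x 0 = x
  ode : ∀ x, ∀ t ∈ Ioo (-1 : ℝ) 1, HasDerivAt (Ψ x) (X (Ψ x t)) t

/-- A smooth field is only locally Lipschitz, so uniqueness is local at first. The set of agreement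
is open by local uniqueness and relatively closed by continuity, and the interval is connected. -/
theorem IsIntegralCurve.eqOn_Ioo_of_contDiff {X : E → E} (hX : ContDiff ℝ ∞ X) {f g : ℝ → E}
    {a b t₀ : ℝ} (ht₀ : t₀ ∈ Ioo a b) (hf : ∀ t ∈ Ioo a b, HasDerivAt f (X (f t)) t)
    (hg : ∀ t ∈ Ioo a b, HasDerivAt g (X (g t)) t) (h0 : f t₀ = g t₀) :
    EqOn f g (Ioo a b) := by
  set s := {t | f t = g t} ∩ Ioo a b with hs
  suffices hsub : Ioo a b ⊆ s from fun t ht => (hsub ht).1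
  have hcf : ContinuousOn f (Ioo a b) := fun t ht => (hf t ht).continuousAt.continuousWithinAt
  have hcg : ContinuousOn g (Ioo a b) := fun t ht => (hg t ht).continuousAt.continuousWithinAt
  apply isPreconnected_Ioo.subset_of_closure_inter_subset (s := Ioo a b) (u := s) _
    ⟨t₀, ⟨ht₀, ⟨h0, ht₀⟩⟩⟩
  · rintro t ⟨htc, ht⟩
    refine ⟨?_, ht⟩
    have hne : (𝓝[s] t).NeBot := mem_closure_iff_nhdsWithin_neBot.1 htc
    have h1 : Tendsto f (𝓝[s] t) (𝓝 (f t)) := (hf t ht).continuousAt.continuousWithinAt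
    have h2 : Tendsto g (𝓝[s] t) (𝓝 (g t)) := (hg t ht).continuousAt.continuousWithinAt
    refine tendsto_nhds_unique (h1.congr' ?_) h2
    filter_upwards [self_mem_nhdsWithin] with u hu using hu.1
  · rw [isOpen_iff_mem_nhds]
    rintro t ⟨hfg, ht⟩
    have hmem : Ioo a b ∈ 𝓝 t := Ioo_mem_nhds ht.1 ht.2
    obtain ⟨K, U, hU, hK⟩ := ((hX.of_le (by exact_mod_cast le_top) :
      ContDiff ℝ 1 X).contDiffAt (x := f t)).exists_lipschitzOnWith
    have heq : f =ᶠ[𝓝 t] g := by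
      refine ODE_solution_unique_of_eventually (v := fun _ => X) (s := fun _ => U) (K := K)
        (Eventually.of_forall fun _ => hK) ?_ ?_ hfg
      · filter_upwards [hmem, (hf t ht).continuousAt.preimage_mem_nhds hU] with u hu hu'
        exact ⟨hf u hu, hu'⟩
      · have hU' : U ∈ 𝓝 (g t) := by rw [← show f t = g t from hfg]; exact hU
        filter_upwards [hmem, (hg t ht).continuousAt.preimage_mem_nhds hU'] with u hu hu'
        exact ⟨hg u hu, hu'⟩
    filter_upwards [heq, hmem] with u hu hu' using ⟨hu, hu'⟩

namespace IsSmoothLocalFlow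

variable {X : E → E} {Ψ : E → ℝ → E}

theorem add_time (h : IsSmoothLocalFlow X Ψ) (x : E) {s t : ℝ} (hs : s ∈ Ioo (-1 : ℝ) 1)
    (ht : t ∈ Ioo (-1 : ℝ) 1) (hst : t + s ∈ Ioo (-1 : ℝ) 1) :
    Ψ (Ψ x t) s = Ψ x (t + s) := by
  -- On this interval both `u` and `t + u` stay in `(-1, 1)`, so both curves solve the same
  -- autonomous equation; they agree at `u = 0`.
  have key : EqOn (fun u => Ψ (Ψ x t) u) (fun u => Ψ x (t + u))
      (Ioo (max (-1) (-1 - t)) (min 1 (1 - t))) := by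
    refine IsIntegralCurve.eqOn_Ioo_of_contDiff h.contDiff_field (t₀ := 0) ?_ ?_ ?_ ?_
    · simp only [mem_Ioo, max_lt_iff, lt_min_iff] at *
      constructor <;> constructor <;> linarith [ht.1, ht.2]
    · intro u hu
      simp only [mem_Ioo, max_lt_iff, lt_min_iff] at hu
      exact h.ode _ u ⟨hu.1.1, hu.2.1⟩
    · intro u hu
      simp only [mem_Ioo, max_lt_iff, lt_min_iff] at hu
      have := h.ode x (t + u) ⟨by linarith [hu.1.2], by linarith [hu.2.2]⟩
      exact HasDerivAt.comp_const_add t u this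
    · simp [h.initial]
  refine key ?_
  simp only [mem_Ioo, max_lt_iff, lt_min_iff] at *
  exact ⟨⟨hs.1, by linarith [hst.1]⟩, hs.2, by linarith [hst.2]⟩

theorem neg_time (h : IsSmoothLocalFlow X Ψ) (x : E) {t : ℝ} (ht : t ∈ Ioo (-1 : ℝ) 1) :
    Ψ (Ψ x t) (-t) = x := by
  have ht' : -t ∈ Ioo (-1 : ℝ) 1 := ⟨by linarith [ht.2], by linarith [ht.1]⟩
  rw [h.add_time x ht' ht (by simp), add_neg_cancel, h.initial]

theorem neg_time' (h : IsSmoothLocalFlow X Ψ) (x : E) {t : ℝ} (ht : t ∈ Ioo (-1 : ℝ) 1) :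
    Ψ (Ψ x (-t)) t = x := by
  have ht' : -t ∈ Ioo (-1 : ℝ) 1 := ⟨by linarith [ht.2], by linarith [ht.1]⟩
  simpa using h.neg_time x ht'

theorem bijective (h : IsSmoothLocalFlow X Ψ) {t : ℝ} (ht : t ∈ Ioo (-1 : ℝ) 1) :
    Function.Bijective fun x => Ψ x t :=
  ⟨Function.LeftInverse.injective (g := fun x => Ψ x (-t)) fun x => h.neg_time x ht,
    Function.RightInverse.surjective (g := fun x => Ψ x (-t)) fun x => h.neg_time' x ht⟩

theorem image_eq_preimage (h : IsSmoothLocalFlow X Ψ) {t : ℝ} (ht : t ∈ Ioo (-1 : ℝ) 1)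
    (A : Set E) : (fun x => Ψ x t) '' A = (fun x => Ψ x (-t)) ⁻¹' A :=
  congrFun (image_eq_preimage_of_inverse (fun x => h.neg_time x ht) fun x => h.neg_time' x ht) A

theorem isOpen_domain {E : Type*} [TopologicalSpace E] : IsOpen ((univ : Set E) ×ˢ Ioo (-1 : ℝ) 1) := isOpen_univ.prod isOpen_Ioo

theorem contDiff_time (h : IsSmoothLocalFlow X Ψ) {t : ℝ} (ht : t ∈ Ioo (-1 : ℝ) 1) :
    ContDiff ℝ ∞ fun x => Ψ x t := by
  rw [← contDiffOn_univ]
  exact h.contDiffOn_flow.comp (f := fun x : E => (x, t)) (by fun_prop)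
    (fun x _ => ⟨mem_univ _, ht⟩)

theorem image_add_time (h : IsSmoothLocalFlow X Ψ) {s t : ℝ} (hs : s ∈ Ioo (-1 : ℝ) 1)
    (ht : t ∈ Ioo (-1 : ℝ) 1) (hst : t + s ∈ Ioo (-1 : ℝ) 1) (A : Set E) :
    (fun x => Ψ x (t + s)) '' A = (fun x => Ψ x s) '' ((fun x => Ψ x t) '' A) := by
  rw [image_image]
  exact image_congr fun x _ => (h.add_time x hs ht hst).symm

theorem isBounded_image [ProperSpace E] (h : IsSmoothLocalFlow X Ψ) {t : ℝ}
    (ht : t ∈ Ioo (-1 : ℝ) 1) {A : Set E} (hA : Bornology.IsBounded A) :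
    Bornology.IsBounded ((fun x => Ψ x t) '' A) :=
  ((hA.isCompact_closure.image (h.contDiff_time ht).continuous).isBounded).subset
    (image_mono subset_closure)

theorem measurableSet_image [MeasurableSpace E] [BorelSpace E] (h : IsSmoothLocalFlow X Ψ) {t : ℝ}
    (ht : t ∈ Ioo (-1 : ℝ) 1) {A : Set E} (hA : MeasurableSet A) :
    MeasurableSet ((fun x => Ψ x t) '' A) := by
  have ht' : -t ∈ Ioo (-1 : ℝ) 1 := ⟨by linarith [ht.2], by linarith [ht.1]⟩
  rw [h.image_eq_preimage ht]
  exact (h.contDiff_time ht').continuous.measurable hA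

theorem fderiv_space_eq (h : IsSmoothLocalFlow X Ψ) (x : E) {t : ℝ} (ht : t ∈ Ioo (-1 : ℝ) 1) :
    fderiv ℝ (fun y => Ψ y t) x =
      (fderiv ℝ (fun p : E × ℝ => Ψ p.1 p.2) (x, t)).comp (ContinuousLinearMap.inl ℝ E ℝ) := by
  have h1 : DifferentiableAt ℝ (fun p : E × ℝ => Ψ p.1 p.2) (x, t) :=
    (h.contDiffOn_flow.contDiffAt (isOpen_domain.mem_nhds ⟨mem_univ _, ht⟩)).differentiableAt
      (by simp)
  have h2 : HasFDerivAt (fun y : E => (y, t)) (ContinuousLinearMap.inl ℝ E ℝ) x :=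
    hasFDerivAt_prodMk_left x t
  exact (h1.hasFDerivAt.comp x h2).fderiv

theorem fderiv_initial (h : IsSmoothLocalFlow X Ψ) (x : E) :
    fderiv ℝ (fun y => Ψ y 0) x = ContinuousLinearMap.id ℝ E := by
  have : (fun y => Ψ y 0) = id := funext h.initial
  rw [this, fderiv_id]

theorem fderiv_time_eq (h : IsSmoothLocalFlow X Ψ) (x : E) {t : ℝ} (ht : t ∈ Ioo (-1 : ℝ) 1) :
    fderiv ℝ (fun p : E × ℝ => Ψ p.1 p.2) (x, t) (0, 1) = X (Ψ x t) := by
  have h1 : DifferentiableAt ℝ (fun p : E × ℝ => Ψ p.1 p.2) (x, t) :=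
    (h.contDiffOn_flow.contDiffAt (isOpen_domain.mem_nhds ⟨mem_univ _, ht⟩)).differentiableAt
      (by simp)
  have h2 : HasDerivAt (fun s : ℝ => (x, s)) ((0 : E), (1 : ℝ)) t :=
    (hasDerivAt_const t x).prodMk (hasDerivAt_id t)
  exact (h1.hasFDerivAt.comp_hasDerivAt t h2).unique (h.ode x t ht)

/-- Symmetry of the second derivative of the joint map exchanges the time and space derivatives, and
the time derivative at `t = 0` is `X` itself. -/
theorem hasDerivAt_fderiv_zero (h : IsSmoothLocalFlow X Ψ) (x : E) :
    HasDerivAt (fun t => fderiv ℝ (fun y => Ψ y t) x) (fderiv ℝ X x) 0 := by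
  set Φ : E × ℝ → E := fun p => Ψ p.1 p.2 with hΦ
  have h0 : (0 : ℝ) ∈ Ioo (-1 : ℝ) 1 := by simp
  have hmem : (univ : Set E) ×ˢ Ioo (-1 : ℝ) 1 ∈ 𝓝 (x, (0 : ℝ)) :=
    isOpen_domain.mem_nhds ⟨mem_univ _, h0⟩
  have hC : ContDiffAt ℝ ∞ Φ (x, 0) := h.contDiffOn_flow.contDiffAt hmem
  have h2top : (2 : WithTop ℕ∞) ≤ ∞ :=
    WithTop.coe_le_coe.2 (le_top : (2 : ℕ∞) ≤ ⊤)
  have hD : DifferentiableAt ℝ (fderiv ℝ Φ) (x, 0) :=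
    (hC.fderiv_right (m := 1) (by rw [one_add_one_eq_two]; exact h2top)).differentiableAt
      (by simp)
  have hsym : IsSymmSndFDerivAt ℝ Φ (x, 0) := hC.isSymmSndFDerivAt (by simpa using h2top)
  have h2 : HasDerivAt (fun s : ℝ => (x, s)) ((0 : E), (1 : ℝ)) 0 :=
    (hasDerivAt_const 0 x).prodMk (hasDerivAt_id 0)
  have h3 : HasDerivAt (fun t : ℝ => (fderiv ℝ Φ (x, t)).comp (ContinuousLinearMap.inl ℝ E ℝ))
      ((fderiv ℝ (fderiv ℝ Φ) (x, 0) (0, 1)).comp (ContinuousLinearMap.inl ℝ E ℝ)) 0 :=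
    ((ContinuousLinearMap.compL ℝ E (E × ℝ) E).flip
      (ContinuousLinearMap.inl ℝ E ℝ)).hasFDerivAt.comp_hasDerivAt 0
        (hD.hasFDerivAt.comp_hasDerivAt (0 : ℝ) h2)
  have h4 : (fderiv ℝ (fderiv ℝ Φ) (x, 0) (0, 1)).comp (ContinuousLinearMap.inl ℝ E ℝ)
      = fderiv ℝ X x := by
    ext v
    have hsv := hsym (0, 1) (v, 0)
    have h5 : HasFDerivAt (fun y : E => (y, (0 : ℝ))) (ContinuousLinearMap.inl ℝ E ℝ) x :=
      hasFDerivAt_prodMk_left x 0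
    have h6 : HasFDerivAt (fun y : E => fderiv ℝ Φ (y, 0) (0, 1))
        (((ContinuousLinearMap.apply ℝ E ((0 : E), (1 : ℝ))).comp
          (fderiv ℝ (fderiv ℝ Φ) (x, 0))).comp (ContinuousLinearMap.inl ℝ E ℝ)) x :=
      HasFDerivAt.comp (f := fun y : E => (y, (0 : ℝ))) x
        (((ContinuousLinearMap.apply ℝ E ((0 : E), (1 : ℝ))).hasFDerivAt).comp (x, (0 : ℝ))
          hD.hasFDerivAt) h5
    have h7 : (fun y : E => fderiv ℝ Φ (y, 0) (0, 1)) = X := by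
      funext y
      rw [h.fderiv_time_eq y h0, h.initial]
    rw [h7] at h6
    rw [h6.fderiv]
    simpa using hsv
  rw [← h4]
  refine h3.congr_of_eventuallyEq ?_
  filter_upwards [Ioo_mem_nhds h0.1 h0.2] with t ht
  exact h.fderiv_space_eq x ht

/-- The time `-t` map inverts the time `t` map, so by the chain rule the two Jacobians multiply to
one. Nonvanishing keeps the absolute value in the change of variables differentiable. -/
theorem det_fderiv_ne_zero (h : IsSmoothLocalFlow X Ψ) (x : E) {t : ℝ}
    (ht : t ∈ Ioo (-1 : ℝ) 1) : (fderiv ℝ (fun y => Ψ y t) x).det ≠ 0 := by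
  have ht' : -t ∈ Ioo (-1 : ℝ) 1 := ⟨by linarith [ht.2], by linarith [ht.1]⟩
  have h1 : fderiv ℝ ((fun y => Ψ y (-t)) ∘ fun y => Ψ y t) x =
      (fderiv ℝ (fun y => Ψ y (-t)) (Ψ x t)).comp (fderiv ℝ (fun y => Ψ y t) x) :=
    fderiv_comp x ((h.contDiff_time ht').contDiffAt.differentiableAt (by simp))
      ((h.contDiff_time ht).contDiffAt.differentiableAt (by simp))
  have h2 : ((fun y => Ψ y (-t)) ∘ fun y => Ψ y t) = id := funext fun y => h.neg_time y ht
  rw [h2, fderiv_id] at h1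
  have h3 := congrArg ContinuousLinearMap.det h1
  have h4 : ((fderiv ℝ (fun y => Ψ y (-t)) (Ψ x t)).comp (fderiv ℝ (fun y => Ψ y t) x)).det =
      (fderiv ℝ (fun y => Ψ y (-t)) (Ψ x t)).det * (fderiv ℝ (fun y => Ψ y t) x).det :=
    LinearMap.det_comp _ _
  rw [h4] at h3
  intro h0
  rw [h0, mul_zero] at h3
  simp [ContinuousLinearMap.det] at h3

end IsSmoothLocalFlow

theorem ContinuousLinearMap.contDiff_det [FiniteDimensional ℝ E] {m : WithTop ℕ∞} :
    ContDiff ℝ m fun L : E →L[ℝ] E => L.det := by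
  classical
  let b := Module.finBasis ℝ E
  have h1 : (fun L : E →L[ℝ] E => L.det) = fun L : E →L[ℝ] E =>
      ∑ σ : Equiv.Perm (Fin (Module.finrank ℝ E)), (Equiv.Perm.sign σ : ℝ) *
        ∏ i, LinearMap.toMatrix b b (L : E →ₗ[ℝ] E) (σ i) i := by
    funext L
    rw [← Matrix.det_apply', LinearMap.det_toMatrix]
  rw [h1]
  refine ContDiff.sum fun σ _ => contDiff_const.mul (contDiff_prod fun i _ => ?_)
  have : (fun L : E →L[ℝ] E => LinearMap.toMatrix b b (L : E →ₗ[ℝ] E) (σ i) i) =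
      fun L : E →L[ℝ] E => (b.coord (σ i)).toContinuousLinearMap (L (b i)) := by
    funext L
    simp [LinearMap.toMatrix_apply]
  rw [this]
  fun_prop

/-- Jacobi's formula at the identity: the linear coefficient of the polynomial `det (1 + t A)` is
the trace. -/
theorem ContinuousLinearMap.fderiv_det_one [FiniteDimensional ℝ E] (M : E →L[ℝ] E) :
    fderiv ℝ (fun L : E →L[ℝ] E => L.det) (ContinuousLinearMap.id ℝ E) M =
      LinearMap.trace ℝ E (M : E →ₗ[ℝ] E) := by
  classical
  let b := Module.finBasis ℝ E
  have h1 : HasDerivAt (fun t : ℝ => ContinuousLinearMap.id ℝ E + t • M) M 0 := by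
    simpa using ((hasDerivAt_id (0 : ℝ)).smul_const M).const_add (ContinuousLinearMap.id ℝ E)
  have h2 : HasFDerivAt (fun L : E →L[ℝ] E => L.det)
      (fderiv ℝ (fun L : E →L[ℝ] E => L.det) (ContinuousLinearMap.id ℝ E))
      (ContinuousLinearMap.id ℝ E + (0 : ℝ) • M) := by
    rw [zero_smul, add_zero]
    exact ((ContinuousLinearMap.contDiff_det (m := 1)).differentiable
      (by simp)).differentiableAt.hasFDerivAt
  have h3 := h2.comp_hasDerivAt (0 : ℝ) h1
  set A := LinearMap.toMatrix b b (M : E →ₗ[ℝ] E) with hA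
  have h4 : (fun t : ℝ => (ContinuousLinearMap.id ℝ E + t • M).det) = fun t : ℝ =>
      1 + A.trace * t + (Matrix.det (1 + (Polynomial.X : Polynomial ℝ) •
        A.map Polynomial.C)).divX.divX.eval t * t ^ 2 := by
    funext t
    rw [← Matrix.det_one_add_smul]
    have : (ContinuousLinearMap.id ℝ E + t • M).det =
      LinearMap.det ((ContinuousLinearMap.id ℝ E + t • M : E →L[ℝ] E) : E →ₗ[ℝ] E) := rfl
    rw [this, ← LinearMap.det_toMatrix b]
    congr 1
    have h5 : ((ContinuousLinearMap.id ℝ E + t • M : E →L[ℝ] E) : E →ₗ[ℝ] E) =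
      LinearMap.id + t • (M : E →ₗ[ℝ] E) := by ext; simp
    rw [h5, map_add, map_smul, LinearMap.toMatrix_id]
  have h6 : HasDerivAt (fun t : ℝ => (ContinuousLinearMap.id ℝ E + t • M).det) A.trace 0 := by
    rw [h4]
    have h7 := (Matrix.det (1 + (Polynomial.X : Polynomial ℝ) •
        A.map Polynomial.C)).divX.divX.hasDerivAt (0 : ℝ)
    have h8 := (((hasDerivAt_id (0 : ℝ)).const_mul A.trace).const_add 1).add
      (h7.mul (hasDerivAt_pow 2 (0 : ℝ)))
    convert! h8 using 1
    simp
  have h9 := h3.unique h6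
  rw [h9, LinearMap.trace_eq_matrix_trace ℝ b]

end FlowVariation

/-! ### Differentiating integrals over moving sets -/

section TransportFormula

variable {E : Type*} [NormedAddCommGroup E] [NormedSpace ℝ E] [FiniteDimensional ℝ E]
  [MeasurableSpace E] [BorelSpace E]

theorem hasDerivAt_setIntegral_of_contDiffOn (μ : Measure E) [IsFiniteMeasureOnCompacts μ]
    {g : E × ℝ → ℝ} (hg : ContDiffOn ℝ 1 g (univ ×ˢ Ioo (-1 : ℝ) 1)) {A : Set E}
    (hA : Bornology.IsBounded A) (hAm : MeasurableSet A) :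
    HasDerivAt (fun s => ∫ x in A, g (x, s) ∂μ) (∫ x in A, fderiv ℝ g (x, 0) (0, 1) ∂μ) 0 := by
  have : ProperSpace E := FiniteDimensional.proper ℝ E
  have hO : IsOpen ((univ : Set E) ×ˢ Ioo (-1 : ℝ) 1) := isOpen_univ.prod isOpen_Ioo
  have hcl : IsCompact (closure A) := hA.isCompact_closure
  have hfin : IsFiniteMeasure (μ.restrict A) :=
    ⟨by rw [Measure.restrict_apply_univ]; exact hA.measure_lt_top⟩
  have hfd : ContinuousOn (fun p => fderiv ℝ g p (0, 1)) (univ ×ˢ Ioo (-1 : ℝ) 1) :=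
    (hg.continuousOn_fderiv_of_isOpen hO le_rfl).clm_apply continuousOn_const
  have hcont : ∀ s ∈ Ioo (-1 : ℝ) 1, Continuous fun x => g (x, s) := fun s hs => by
    rw [← continuousOn_univ]
    exact hg.continuousOn.comp (f := fun x : E => (x, s)) (by fun_prop)
      fun x _ => ⟨mem_univ _, hs⟩
  have hcont' : ∀ s ∈ Ioo (-1 : ℝ) 1, Continuous fun x => fderiv ℝ g (x, s) (0, 1) :=
    fun s hs => by
    rw [← continuousOn_univ]
    exact hfd.comp (f := fun x : E => (x, s)) (by fun_prop) fun x _ => ⟨mem_univ _, hs⟩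
  -- Halving the time interval gives a compact set, on which the time derivative has a constant
  -- dominating bound.
  have hsub : closure A ×ˢ Icc (-(1 / 2) : ℝ) (1 / 2) ⊆ univ ×ˢ Ioo (-1 : ℝ) 1 := by
    rintro ⟨x, s⟩ ⟨-, h1, h2⟩
    exact ⟨mem_univ _, by simp only at *; constructor <;> linarith⟩
  obtain ⟨C, hC⟩ := (hcl.prod isCompact_Icc).exists_bound_of_continuousOn (hfd.mono hsub)
  have h0 : (0 : ℝ) ∈ Ioo (-1 : ℝ) 1 := by simp
  obtain ⟨C', hC'⟩ := hcl.exists_bound_of_continuousOn (hcont 0 h0).continuousOn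
  refine (hasDerivAt_integral_of_dominated_loc_of_deriv_le (bound := fun _ => C)
    (F := fun s x => g (x, s)) (F' := fun s x => fderiv ℝ g (x, s) (0, 1))
    (s := Ioo (-(1 / 2)) (1 / 2)) (Ioo_mem_nhds (by norm_num) (by norm_num)) ?_ ?_ ?_ ?_ ?_ ?_).2
  · filter_upwards [Ioo_mem_nhds h0.1 h0.2] with s hs
    exact (hcont s hs).aestronglyMeasurable
  · refine Integrable.of_bound (hcont 0 h0).aestronglyMeasurable C' ?_
    exact ae_restrict_of_forall_mem hAm fun x hx => hC' x (subset_closure hx)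
  · exact (hcont' 0 h0).aestronglyMeasurable
  · refine ae_restrict_of_forall_mem hAm fun x hx s hs => ?_
    exact hC (x, s) ⟨subset_closure hx, Ioo_subset_Icc_self hs⟩
  · exact integrable_const C
  · refine Eventually.of_forall fun x s hs => ?_
    have hs' : s ∈ Ioo (-1 : ℝ) 1 := ⟨by linarith [hs.1], by linarith [hs.2]⟩
    have h1 : DifferentiableAt ℝ g (x, s) :=
      (hg.contDiffAt (hO.mem_nhds ⟨mem_univ _, hs'⟩)).differentiableAt (by simp)
    exact h1.hasFDerivAt.comp_hasDerivAt s ((hasDerivAt_const s x).prodMk (hasDerivAt_id s))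

/-- A change of variables pulls the integral back to the fixed set `A`, with integrand `|det DΨ_s|
w(Ψ_s)`. At `s = 0` the determinant equals one and has derivative `div X`, so the product rule
yields `div (w X)`. -/
theorem IsSmoothLocalFlow.hasDerivAt_integral_image_zero (μ : Measure E) [μ.IsAddHaarMeasure]
    {X : E → E} {Ψ : E → ℝ → E} (h : IsSmoothLocalFlow X Ψ) {w : E → ℝ} (hw : ContDiff ℝ ∞ w)
    {A : Set E} (hA : Bornology.IsBounded A) (hAm : MeasurableSet A) :
    HasDerivAt (fun s => ∫ x in (fun x => Ψ x s) '' A, w x ∂μ)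
      (∫ x in A, transportDeriv X w x ∂μ) 0 := by
  have h0 : (0 : ℝ) ∈ Ioo (-1 : ℝ) 1 := by simp
  set g : E × ℝ → ℝ := fun p => |(fderiv ℝ (fun y => Ψ y p.2) p.1).det| * w (Ψ p.1 p.2) with hgdef
  have hfd : ContDiffOn ℝ 1 (fun p : E × ℝ => fderiv ℝ (fun y => Ψ y p.2) p.1)
      (univ ×ˢ Ioo (-1 : ℝ) 1) := by
    have h1 : ContDiffOn ℝ 1 (fderiv ℝ fun p : E × ℝ => Ψ p.1 p.2) (univ ×ˢ Ioo (-1 : ℝ) 1) :=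
      h.contDiffOn_flow.fderiv_of_isOpen IsSmoothLocalFlow.isOpen_domain (by
        rw [one_add_one_eq_two]; exact WithTop.coe_le_coe.2 (le_top : (2 : ℕ∞) ≤ ⊤))
    refine (h1.clm_comp (contDiffOn_const (c := ContinuousLinearMap.inl ℝ E ℝ))).congr ?_
    rintro ⟨x, t⟩ ⟨-, ht⟩
    exact h.fderiv_space_eq x ht
  have hdet : ContDiffOn ℝ 1 (fun p : E × ℝ => (fderiv ℝ (fun y => Ψ y p.2) p.1).det)
      (univ ×ˢ Ioo (-1 : ℝ) 1) :=
    ContinuousLinearMap.contDiff_det.comp_contDiffOn hfd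
  have hw1 : ContDiff ℝ 1 w := hw.of_le (WithTop.coe_le_coe.2 (le_top : (1 : ℕ∞) ≤ ⊤))
  have hΨ1 : ContDiffOn ℝ 1 (fun p : E × ℝ => Ψ p.1 p.2) (univ ×ˢ Ioo (-1 : ℝ) 1) :=
    h.contDiffOn_flow.of_le (WithTop.coe_le_coe.2 (le_top : (1 : ℕ∞) ≤ ⊤))
  have hg : ContDiffOn ℝ 1 g (univ ×ˢ Ioo (-1 : ℝ) 1) := by
    refine ContDiffOn.mul ?_ (hw1.comp_contDiffOn hΨ1)
    rintro ⟨x, t⟩ ⟨hx, ht⟩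
    exact (contDiffAt_abs (h.det_fderiv_ne_zero x ht)).comp_contDiffWithinAt (x, t)
      (hdet (x, t) ⟨hx, ht⟩)
  have key := hasDerivAt_setIntegral_of_contDiffOn μ hg hA hAm
  have hderiv : ∀ x, fderiv ℝ g (x, 0) (0, 1) = transportDeriv X w x := by
    intro x
    have h1 : DifferentiableAt ℝ g (x, 0) :=
      (hg.contDiffAt (IsSmoothLocalFlow.isOpen_domain.mem_nhds ⟨mem_univ _, h0⟩)).differentiableAt
        (by simp)
    have h2 : HasDerivAt (fun s => g (x, s)) (fderiv ℝ g (x, 0) (0, 1)) 0 :=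
      h1.hasFDerivAt.comp_hasDerivAt 0 ((hasDerivAt_const (0 : ℝ) x).prodMk (hasDerivAt_id 0))
    have h3 : HasDerivAt (fun s => (fderiv ℝ (fun y => Ψ y s) x).det) (vdiv X x) 0 := by
      have h4 : HasFDerivAt (fun L : E →L[ℝ] E => L.det)
          (fderiv ℝ (fun L : E →L[ℝ] E => L.det) (ContinuousLinearMap.id ℝ E))
          (fderiv ℝ (fun y => Ψ y 0) x) := by
        rw [h.fderiv_initial]
        exact ((ContinuousLinearMap.contDiff_det (m := 1)).differentiable
          (by simp)).differentiableAt.hasFDerivAt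
      have := h4.comp_hasDerivAt (0 : ℝ) (h.hasDerivAt_fderiv_zero x)
      rwa [ContinuousLinearMap.fderiv_det_one] at this
    have hdet0 : (fderiv ℝ (fun y => Ψ y 0) x).det = 1 := by
      rw [h.fderiv_initial]; simp [ContinuousLinearMap.det]
    have h5 : HasDerivAt (fun s => w (Ψ x s)) (fderiv ℝ w x (X x)) 0 := by
      have h6 : HasFDerivAt w (fderiv ℝ w x) (Ψ x 0) := by
        rw [h.initial]; exact (hw1.differentiable (by simp)).differentiableAt.hasFDerivAt
      have h7 := h.ode x 0 h0
      rw [h.initial] at h7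
      exact h6.comp_hasDerivAt (0 : ℝ) h7
    have h8 : HasDerivAt (fun s => g (x, s))
        (vdiv X x * w (Ψ x 0) + (fderiv ℝ (fun y => Ψ y 0) x).det * fderiv ℝ w x (X x)) 0 := by
      refine (h3.mul h5).congr_of_eventuallyEq ?_
      have hpos : ∀ᶠ s in 𝓝 (0 : ℝ), 0 < (fderiv ℝ (fun y => Ψ y s) x).det :=
        h3.continuousAt.eventually (lt_mem_nhds (by simp only [hdet0]; exact one_pos))
      filter_upwards [hpos] with s hs
      simp [hgdef, abs_of_pos hs]
    rw [h2.unique h8, hdet0, h.initial, transportDeriv]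
    ring
  simp only [hderiv] at key
  refine key.congr_of_eventuallyEq ?_
  filter_upwards [Ioo_mem_nhds h0.1 h0.2] with s hs
  rw [integral_image_eq_integral_abs_det_fderiv_smul μ hAm
    (f' := fderiv ℝ fun y => Ψ y s) (fun x _ =>
    ((h.contDiff_time hs).differentiable (by simp)).differentiableAt.hasFDerivAt.hasFDerivWithinAt)
    (h.bijective hs).injective.injOn]
  rfl

/-- The transport formula: the integral of `w` over the image of `A` under a smooth flow has
derivative the integral of `div (w X)`. -/
theorem IsSmoothLocalFlow.hasDerivAt_integral_image (μ : Measure E) [μ.IsAddHaarMeasure]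
    {X : E → E} {Ψ : E → ℝ → E} (h : IsSmoothLocalFlow X Ψ) {w : E → ℝ} (hw : ContDiff ℝ ∞ w)
    {A : Set E} (hA : Bornology.IsBounded A) (hAm : MeasurableSet A) {t : ℝ}
    (ht : t ∈ Ioo (-1 : ℝ) 1) :
    HasDerivAt (fun s => ∫ x in (fun x => Ψ x s) '' A, w x ∂μ)
      (∫ x in (fun x => Ψ x t) '' A, transportDeriv X w x ∂μ) t := by
  have : ProperSpace E := FiniteDimensional.proper ℝ E
  -- The group law reduces time `t` to time zero, with the image of `A` at time `t` as the new
  -- initial set.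
  have h1 := h.hasDerivAt_integral_image_zero μ hw (h.isBounded_image ht hA)
    (h.measurableSet_image ht hAm)
  have h2 := HasDerivAt.comp_sub_const (f := fun s =>
    ∫ x in (fun x => Ψ x s) '' ((fun x => Ψ x t) '' A), w x ∂μ) t t (by rwa [sub_self])
  refine h2.congr_of_eventuallyEq ?_
  have hc : Tendsto (fun s : ℝ => s - t) (𝓝 t) (𝓝 0) := by
    have : ContinuousAt (fun s : ℝ => s - t) t := by fun_prop
    simpa [ContinuousAt] using this
  filter_upwards [Ioo_mem_nhds ht.1 ht.2,
    hc (Ioo_mem_nhds (show (-1 : ℝ) < 0 by norm_num) (zero_lt_one))] with s hs hs'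
  rw [← h.image_add_time hs' ht (by simpa using hs)]
  simp

omit [MeasurableSpace E] [BorelSpace E] in
theorem contDiff_vdiv {X : E → E} (hX : ContDiff ℝ ∞ X) : ContDiff ℝ ∞ (vdiv X) := by
  have h1 : ContDiff ℝ ∞ (fderiv ℝ X) := hX.fderiv_right (by simp)
  have h2 : vdiv X = fun x => LinearMap.toContinuousLinearMap
      ((LinearMap.trace ℝ E).comp (ContinuousLinearMap.coeLM ℝ : (E →L[ℝ] E) →ₗ[ℝ] E →ₗ[ℝ] E))
        (fderiv ℝ X x) := by
    funext x; rfl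
  rw [h2]
  exact (ContinuousLinearMap.contDiff _).comp h1

omit [MeasurableSpace E] [BorelSpace E] in
theorem contDiff_transportDeriv {X : E → E} (hX : ContDiff ℝ ∞ X) {w : E → ℝ}
    (hw : ContDiff ℝ ∞ w) : ContDiff ℝ ∞ (transportDeriv X w) :=
  ((hw.fderiv_right (by simp)).clm_apply hX).add (hw.mul (contDiff_vdiv hX))

/-- The first derivative is again the integral of a smooth weight over the moving set, so the
transport formula applies to it once more. -/
theorem IsSmoothLocalFlow.hasSecondDerivAt_integral_image (μ : Measure E) [μ.IsAddHaarMeasure]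
    {X : E → E} {Ψ : E → ℝ → E} (h : IsSmoothLocalFlow X Ψ) {w : E → ℝ} (hw : ContDiff ℝ ∞ w)
    {A : Set E} (hA : Bornology.IsBounded A) (hAm : MeasurableSet A) :
    HasSecondDerivAt (fun s => ∫ x in (fun x => Ψ x s) '' A, w x ∂μ)
      (∫ x in A, transportDeriv X (transportDeriv X w) x ∂μ) 0 := by
  refine ⟨fun t => ∫ x in (fun x => Ψ x t) '' A, transportDeriv X w x ∂μ, ?_,
    h.hasDerivAt_integral_image_zero μ (contDiff_transportDeriv h.contDiff_field hw) hA hAm⟩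
  filter_upwards [Ioo_mem_nhds (show (-1 : ℝ) < 0 by norm_num) zero_lt_one] with t ht
  exact h.hasDerivAt_integral_image μ hw hA hAm ht

omit [MeasurableSpace E] [BorelSpace E] in
theorem vdiv_smul {X : E → E} {w : E → ℝ} {x : E} (hw : DifferentiableAt ℝ w x)
    (hX : DifferentiableAt ℝ X x) : vdiv (fun y => w y • X y) x = transportDeriv X w x := by
  rw [vdiv, transportDeriv, vdiv, fderiv_fun_smul hw hX]
  have : ((w x • fderiv ℝ X x + (fderiv ℝ w x).smulRight (X x) : E →L[ℝ] E) : E →ₗ[ℝ] E) =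
    w x • (fderiv ℝ X x : E →ₗ[ℝ] E) + (fderiv ℝ w x : E →ₗ[ℝ] ℝ).smulRight (X x) := by
    ext; simp
  rw [this, map_add, map_smul, LinearMap.trace_smulRight]
  simp [add_comm]

end TransportFormula

/-! ### Polar coordinates and differentiation in the radius -/

section PolarCoordinates

variable {E : Type*} [NormedAddCommGroup E] [NormedSpace ℝ E] [FiniteDimensional ℝ E]
  [MeasurableSpace E] [BorelSpace E]

/-- The integral of `g` over the sphere of radius `s` in polar coordinates. -/
noncomputable def polarIntegral (μ : Measure E) (g : E → ℝ) (s : ℝ) : ℝ :=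
  s ^ (Module.finrank ℝ E - 1) *
    ∫ u : Metric.sphere (0 : E) 1, g (s • (u : E)) ∂μ.toSphere

theorem integral_eq_integral_polarIntegral [Nontrivial E] (μ : Measure E) [μ.IsAddHaarMeasure]
    {g : E → ℝ} (hg : Integrable g μ) :
    ∫ x, g x ∂μ = ∫ s in Ioi (0 : ℝ), polarIntegral μ g s := by
  have hmp := μ.measurePreserving_homeomorphUnitSphereProd
  have hemb := (homeomorphUnitSphereProd E).measurableEmbedding
  set h : Metric.sphere (0 : E) 1 × Ioi (0 : ℝ) → ℝ := fun p => g (p.2.1 • p.1.1) with hh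
  have h1 : ∀ x : ({(0 : E)}ᶜ : Set E), h (homeomorphUnitSphereProd E x) = g x := by
    intro x
    have := homeomorphUnitSphereProd_symm_apply_coe E (homeomorphUnitSphereProd E x)
    rw [Homeomorph.symm_apply_apply] at this
    simp only [hh]
    rw [← this]
  have hint : Integrable h (μ.toSphere.prod (.volumeIoiPow (Module.finrank ℝ E - 1))) := by
    rw [← hmp.integrable_comp_emb hemb]
    have h2 : (h ∘ homeomorphUnitSphereProd E) = g ∘ (Subtype.val : ({(0 : E)}ᶜ : Set E) → E) :=
      funext h1
    rw [h2, ← integrableOn_iff_comap_subtypeVal (measurableSet_singleton _).compl]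
    exact hg.integrableOn
  calc ∫ x, g x ∂μ = ∫ x : ({(0)}ᶜ : Set E), g x.1 ∂(μ.comap (↑)) := by
        rw [integral_subtype_comap (measurableSet_singleton _).compl fun x => g x,
          restrict_compl_singleton]
    _ = ∫ p, h p ∂μ.toSphere.prod (.volumeIoiPow (Module.finrank ℝ E - 1)) := by
        rw [← hmp.integral_comp hemb]
        exact integral_congr_ae (Eventually.of_forall fun x => (h1 x).symm)
    _ = ∫ s : Ioi (0 : ℝ), ∫ u, h (u, s) ∂μ.toSphere
          ∂(.volumeIoiPow (Module.finrank ℝ E - 1)) := integral_prod_symm _ hint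
    _ = _ := by
        simp only [Measure.volumeIoiPow, ENNReal.ofReal]
        rw [integral_withDensity_eq_integral_smul
            ((measurable_subtype_coe.pow_const _).real_toNNReal),
          ← integral_subtype_comap measurableSet_Ioi]
        refine integral_congr_ae (Eventually.of_forall fun s => ?_)
        simp only [polarIntegral, NNReal.smul_def, smul_eq_mul, hh]
        rw [Real.coe_toNNReal _ (pow_nonneg s.2.out.le _)]

theorem continuous_polarIntegral (μ : Measure E) [μ.IsAddHaarMeasure] {g : E → ℝ}
    (hg : Continuous g) : Continuous (polarIntegral μ g) := by
  have : ProperSpace E := FiniteDimensional.proper ℝ E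
  have h1 := continuous_parametric_integral_of_continuous (μ := μ.toSphere)
    (f := fun (s : ℝ) (u : Metric.sphere (0 : E) 1) => g (s • (u : E)))
    (by simp only [Function.uncurry_def]; fun_prop) (isCompact_univ)
  simp only [Measure.restrict_univ] at h1
  exact (continuous_pow _).mul h1

theorem setIntegral_ball_eq_integral_polarIntegral [Nontrivial E] (μ : Measure E)
    [μ.IsAddHaarMeasure] {g : E → ℝ} (hg : Continuous g) {r : ℝ} (hr : 0 ≤ r) :
    ∫ x in Metric.ball 0 r, g x ∂μ = ∫ s in (0 : ℝ)..r, polarIntegral μ g s := by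
  have : ProperSpace E := FiniteDimensional.proper ℝ E
  have hint : Integrable ((Metric.ball (0 : E) r).indicator g) μ := by
    rw [integrable_indicator_iff measurableSet_ball]
    exact (hg.continuousOn.integrableOn_compact (isCompact_closedBall (0 : E) r)).mono_set
      Metric.ball_subset_closedBall
  rw [← integral_indicator measurableSet_ball, integral_eq_integral_polarIntegral μ hint,
    intervalIntegral.integral_of_le hr]
  have h1 : ∀ s ∈ Ioi (0 : ℝ), polarIntegral μ ((Metric.ball (0 : E) r).indicator g) s =
      (Ioo 0 r).indicator (polarIntegral μ g) s := by
    intro s hs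
    have hn : ∀ u : Metric.sphere (0 : E) 1, ‖s • (u : E)‖ = s := fun u => by
      rw [norm_smul, Real.norm_of_nonneg (le_of_lt hs), norm_eq_of_mem_sphere, mul_one]
    by_cases hsr : s < r
    · rw [indicator_of_mem (show s ∈ Ioo 0 r from ⟨hs, hsr⟩), polarIntegral, polarIntegral]
      congr 2
      funext u
      rw [indicator_of_mem]
      simpa [hn u] using hsr
    · rw [indicator_of_notMem (fun h => hsr h.2), polarIntegral]
      have : (fun u : Metric.sphere (0 : E) 1 =>
          (Metric.ball (0 : E) r).indicator g (s • (u : E))) = fun _ => 0 := by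
        funext u
        rw [indicator_of_notMem]
        simpa [hn u] using hsr
      simp [this]
  rw [setIntegral_congr_fun measurableSet_Ioi h1, setIntegral_indicator measurableSet_Ioo,
    inter_eq_self_of_subset_right Ioo_subset_Ioi_self, integral_Ioc_eq_integral_Ioo]

theorem hasDerivAt_intervalIntegral_of_continuous {k : ℝ → ℝ} (hk : Continuous k) (a r : ℝ) :
    HasDerivAt (fun r => ∫ s in a..r, k s) (k r) r :=
  intervalIntegral.integral_hasDerivAt_right (hk.intervalIntegrable _ _)
    (hk.stronglyMeasurableAtFilter _ _) hk.continuousAt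

/-- If the moments of `k` and `j` on every interval `[0, r]` against `(r² - s²)²` and
`4 (r² - s²)` agree, then `r ∫ k = j` after differentiating twice. -/
theorem mul_integral_eq_of_weighted_integral_eq {k j : ℝ → ℝ} (hk : Continuous k)
    (hj : Continuous j)
    (h : ∀ r : ℝ, 0 < r → ∫ s in (0 : ℝ)..r, (r ^ 2 - s ^ 2) ^ 2 * k s =
      4 * ∫ s in (0 : ℝ)..r, (r ^ 2 - s ^ 2) * j s) {r : ℝ} (hr : 0 < r) :
    r * ∫ s in (0 : ℝ)..r, k s = j r := by
  have hii : ∀ {f : ℝ → ℝ}, Continuous f → ∀ a b : ℝ, IntervalIntegrable f volume a b :=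
    fun hf a b => hf.intervalIntegrable a b
  -- Expanding the weight takes `r` out of the integrand, so the fundamental theorem of calculus
  -- suffices for the derivatives.
  have e1 : ∀ r : ℝ, ∫ s in (0 : ℝ)..r, (r ^ 2 - s ^ 2) ^ 2 * k s =
      r ^ 4 * (∫ s in (0 : ℝ)..r, k s) - 2 * r ^ 2 * (∫ s in (0 : ℝ)..r, s ^ 2 * k s) +
        ∫ s in (0 : ℝ)..r, s ^ 4 * k s := by
    intro r
    rw [← intervalIntegral.integral_const_mul, ← intervalIntegral.integral_const_mul,
      ← intervalIntegral.integral_sub (hii (by fun_prop) _ _) (hii (by fun_prop) _ _),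
      ← intervalIntegral.integral_add (hii (by fun_prop) _ _) (hii (by fun_prop) _ _)]
    congr 1
    funext s
    ring
  have e2 : ∀ {l : ℝ → ℝ}, Continuous l → ∀ r : ℝ, ∫ s in (0 : ℝ)..r, (r ^ 2 - s ^ 2) * l s =
      r ^ 2 * (∫ s in (0 : ℝ)..r, l s) - ∫ s in (0 : ℝ)..r, s ^ 2 * l s := by
    intro l hl r
    rw [← intervalIntegral.integral_const_mul,
      ← intervalIntegral.integral_sub (hii (by fun_prop) _ _) (hii (by fun_prop) _ _)]
    congr 1
    funext s
    ring
  have d2 : ∀ {l : ℝ → ℝ}, Continuous l → ∀ r : ℝ,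
      HasDerivAt (fun r => ∫ s in (0 : ℝ)..r, (r ^ 2 - s ^ 2) * l s)
        (2 * r * ∫ s in (0 : ℝ)..r, l s) r := by
    intro l hl r
    have h1 := hasDerivAt_intervalIntegral_of_continuous hl 0 r
    have h2 := hasDerivAt_intervalIntegral_of_continuous
      (show Continuous fun s => s ^ 2 * l s by fun_prop) 0 r
    simp only [e2 hl]
    convert! ((hasDerivAt_pow 2 r).mul h1).sub h2 using 1
    simp
  have d1 : ∀ r : ℝ, HasDerivAt (fun r => ∫ s in (0 : ℝ)..r, (r ^ 2 - s ^ 2) ^ 2 * k s)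
      (4 * r * ∫ s in (0 : ℝ)..r, (r ^ 2 - s ^ 2) * k s) r := by
    intro r
    have h1 := hasDerivAt_intervalIntegral_of_continuous hk 0 r
    have h2 := hasDerivAt_intervalIntegral_of_continuous
      (show Continuous fun s => s ^ 2 * k s by fun_prop) 0 r
    have h3 := hasDerivAt_intervalIntegral_of_continuous
      (show Continuous fun s => s ^ 4 * k s by fun_prop) 0 r
    simp only [e1, e2 hk]
    convert! (((hasDerivAt_pow 4 r).mul h1).sub
      (((hasDerivAt_pow 2 r).const_mul 2).mul h2)).add h3 using 1
    simp
    ring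
  -- The weights vanish at `s = r`, so each differentiation only lowers their power: after
  -- cancelling `4 r`, the weights `(r² - s²)²` and `r² - s²` become `r² - s²` and `1`.
  have s1 : ∀ r : ℝ, 0 < r → ∫ s in (0 : ℝ)..r, (r ^ 2 - s ^ 2) * k s =
      2 * ∫ s in (0 : ℝ)..r, j s := by
    intro r hr
    have h1 : HasDerivAt (fun r => ∫ s in (0 : ℝ)..r, (r ^ 2 - s ^ 2) ^ 2 * k s)
        (4 * (2 * r * ∫ s in (0 : ℝ)..r, j s)) r := by
      refine ((d2 hj r).const_mul 4).congr_of_eventuallyEq ?_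
      filter_upwards [lt_mem_nhds hr] with u hu using h u hu
    have h2 := (d1 r).unique h1
    have h3 : (4 * r) * (∫ s in (0 : ℝ)..r, (r ^ 2 - s ^ 2) * k s) =
      (4 * r) * (2 * ∫ s in (0 : ℝ)..r, j s) := by rw [h2]; ring
    exact mul_left_cancel₀ (by positivity) h3
  have h1 : HasDerivAt (fun r => ∫ s in (0 : ℝ)..r, (r ^ 2 - s ^ 2) * k s) (2 * j r) r := by
    refine ((hasDerivAt_intervalIntegral_of_continuous hj 0 r).const_mul 2).congr_of_eventuallyEq ?_
    filter_upwards [lt_mem_nhds hr] with u hu using s1 u hu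
  have h2 := (d2 hk r).unique h1
  linarith

theorem hasDerivAt_max_zero_sq (t : ℝ) :
    HasDerivAt (fun t : ℝ => max t 0 ^ 2) (2 * max t 0) t := by
  rcases lt_trichotomy t 0 with ht | rfl | ht
  · rw [max_eq_right ht.le, mul_zero]
    refine (hasDerivAt_const t (0 : ℝ)).congr_of_eventuallyEq ?_
    filter_upwards [gt_mem_nhds ht] with s hs
    rw [max_eq_right (le_of_lt hs)]; simp
  · rw [max_self, mul_zero, hasDerivAt_iff_isLittleO_nhds_zero]
    have h1 : (fun h : ℝ => h ^ 2) =o[𝓝 0] fun h : ℝ => h := by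
      simpa using Asymptotics.isLittleO_pow_id (𝕜 := ℝ) one_lt_two
    refine (Asymptotics.IsBigO.of_bound 1 (Eventually.of_forall fun h => ?_)).trans_isLittleO h1
    simp only [zero_add, max_self, smul_zero, sub_zero, norm_pow, one_mul, Real.norm_eq_abs]
    simp only [ne_eq, OfNat.ofNat_ne_zero, not_false_eq_true, zero_pow, sub_zero, abs_pow]
    refine pow_le_pow_left₀ (abs_nonneg _) ?_ 2
    rw [abs_of_nonneg (le_max_right _ _)]
    exact max_le (le_abs_self h) (abs_nonneg h)
  · rw [max_eq_left ht.le]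
    refine ((hasDerivAt_pow 2 t).congr_of_eventuallyEq ?_).congr_deriv (by simp)
    filter_upwards [lt_mem_nhds ht] with s hs
    rw [max_eq_left (le_of_lt hs)]

end PolarCoordinates

/-! ### The divergence theorem on a ball -/

section DivergenceTheorem

variable {n : ℕ}

local notation "𝔼" => EuclideanSpace ℝ (Fin n)

theorem integral_sphereSurfaceMeasure {r : ℝ} (hr : 0 ≤ r) {g : 𝔼 → ℝ} (hg : Continuous g) :
    ∫ x, g x ∂sphereSurfaceMeasure n r = polarIntegral volume g r := by
  rw [sphereSurfaceMeasure, integral_smul_measure, integral_map (by fun_prop)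
    hg.aestronglyMeasurable, ENNReal.toReal_ofReal (by positivity), polarIntegral,
    finrank_euclideanSpace_fin, smul_eq_mul]

/-- Integration by parts over the whole space against the square of the positive part of `r² -
‖x‖²`. This replacement for the indicator of the ball is differentiable with compact support, so no
boundary term arises. -/
theorem integral_ball_weighted_fderiv {w : 𝔼 → ℝ} (hw : ContDiff ℝ 1 w) (v : 𝔼) (r : ℝ) :
    ∫ x in Metric.ball 0 r, (r ^ 2 - ‖x‖ ^ 2) ^ 2 * fderiv ℝ w x v =
      4 * ∫ x in Metric.ball 0 r, (r ^ 2 - ‖x‖ ^ 2) * (inner ℝ v x * w x) := by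
  rcases le_or_gt r 0 with hr | hr
  · simp [Metric.ball_eq_empty.2 hr]
  set φ : 𝔼 → ℝ := fun x => max (r ^ 2 - ‖x‖ ^ 2) 0 ^ 2 with hφ
  have hφd : ∀ x, HasFDerivAt φ
      ((2 * max (r ^ 2 - ‖x‖ ^ 2) 0) • (-((2 : ℝ) • innerSL ℝ x) : 𝔼 →L[ℝ] ℝ)) x := by
    intro x
    have h1 : HasFDerivAt (fun x : 𝔼 => ‖x‖ ^ 2) ((2 : ℝ) • innerSL ℝ x) x := by
      simpa [ofNat_smul_eq_nsmul] using (hasStrictFDerivAt_norm_sq x).hasFDerivAt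
    exact (hasDerivAt_max_zero_sq (r ^ 2 - ‖x‖ ^ 2)).comp_hasFDerivAt x (h1.const_sub (r ^ 2))
  have hmax : ∀ x : 𝔼, x ∉ Metric.closedBall (0 : 𝔼) r → max (r ^ 2 - ‖x‖ ^ 2) 0 = 0 := by
    intro x hx
    rw [mem_closedBall_zero_iff, not_le] at hx
    refine max_eq_right ?_
    nlinarith
  have hcs : ∀ g : 𝔼 → ℝ, Continuous g →
      HasCompactSupport fun x => max (r ^ 2 - ‖x‖ ^ 2) 0 * g x := fun g hg =>
    HasCompactSupport.intro (isCompact_closedBall (0 : 𝔼) r) fun x hx => by rw [hmax x hx, zero_mul]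
  have hint : ∀ g : 𝔼 → ℝ, Continuous g →
      Integrable fun x => max (r ^ 2 - ‖x‖ ^ 2) 0 * g x := fun g hg =>
    Continuous.integrable_of_hasCompactSupport (by fun_prop) (hcs g hg)
  have hw' : Continuous fun x => fderiv ℝ w x v :=
    (hw.continuous_fderiv (by simp)).clm_apply continuous_const
  have hwc := hw.continuous
  have hf : ∀ x, fderiv ℝ φ x v = max (r ^ 2 - ‖x‖ ^ 2) 0 * (-4 * inner ℝ v x) := by
    intro x
    rw [(hφd x).fderiv]
    simp [real_inner_comm]
    ring
  have key := integral_mul_fderiv_eq_neg_fderiv_mul_of_integrable (μ := (volume : Measure 𝔼))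
    (f := φ) (g := w) (v := v) ?_ ?_ ?_ (fun x _ => (hφd x).differentiableAt)
    (fun x _ => (hw.differentiable (by simp)).differentiableAt)
  · have h1 : ∀ x, φ x * fderiv ℝ w x v = (Metric.ball (0 : 𝔼) r).indicator
        (fun x => (r ^ 2 - ‖x‖ ^ 2) ^ 2 * fderiv ℝ w x v) x := by
      intro x
      by_cases hx : x ∈ Metric.ball (0 : 𝔼) r
      · rw [indicator_of_mem hx, hφ]
        rw [mem_ball_zero_iff] at hx
        simp only
        rw [max_eq_left (by nlinarith [norm_nonneg x])]
      · rw [indicator_of_notMem hx, hφ]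
        rw [mem_ball_zero_iff, not_lt] at hx
        simp only
        rw [max_eq_right (by nlinarith [norm_nonneg x])]
        simp
    have h2 : ∀ x, -(fderiv ℝ φ x v * w x) = (Metric.ball (0 : 𝔼) r).indicator
        (fun x => 4 * ((r ^ 2 - ‖x‖ ^ 2) * (inner ℝ v x * w x))) x := by
      intro x
      rw [hf]
      by_cases hx : x ∈ Metric.ball (0 : 𝔼) r
      · rw [indicator_of_mem hx]
        rw [mem_ball_zero_iff] at hx
        rw [max_eq_left (by nlinarith [norm_nonneg x])]
        ring
      · rw [indicator_of_notMem hx]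
        rw [mem_ball_zero_iff, not_lt] at hx
        rw [max_eq_right (by nlinarith [norm_nonneg x])]
        simp
    rw [← integral_neg] at key
    simp only [h1, h2] at key
    rwa [integral_indicator measurableSet_ball, integral_indicator measurableSet_ball,
      integral_const_mul] at key
  · have := hint (fun x => (-4 * inner ℝ v x) * w x) (by fun_prop)
    simpa only [hf, mul_assoc] using this
  · have := hint (fun x => max (r ^ 2 - ‖x‖ ^ 2) 0 * fderiv ℝ w x v) (by fun_prop)
    simpa only [hφ, mul_assoc, sq (max _ _)] using this
  · have := hint (fun x => max (r ^ 2 - ‖x‖ ^ 2) 0 * w x) (by fun_prop)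
    simpa only [hφ, mul_assoc, sq (max _ _)] using this

theorem polarIntegral_radial_mul (a : ℝ → ℝ) (g : 𝔼 → ℝ) {s : ℝ} (hs : 0 ≤ s) :
    polarIntegral volume (fun x => a ‖x‖ * g x) s = a s * polarIntegral volume g s := by
  have hn : ∀ u : Metric.sphere (0 : 𝔼) 1, ‖s • (u : 𝔼)‖ = s := fun u => by
    rw [norm_smul, Real.norm_of_nonneg hs, norm_eq_of_mem_sphere, mul_one]
  simp only [polarIntegral, hn, integral_const_mul]
  ring

/-- The weighted identity holds for every radius; in polar coordinates, two differentiations in the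
radius remove the weight and produce the surface term. The factor `r` comes from the normal `x / r`.
-/
theorem integral_ball_fderiv [NeZero n] {w : 𝔼 → ℝ} (hw : ContDiff ℝ 1 w) (v : 𝔼) {r : ℝ}
    (hr : 0 < r) :
    r * ∫ x in Metric.ball 0 r, fderiv ℝ w x v =
      ∫ x, inner ℝ v x * w x ∂sphereSurfaceMeasure n r := by
  have hw' : Continuous fun x => fderiv ℝ w x v :=
    (hw.continuous_fderiv (by simp)).clm_apply continuous_const
  have hwc := hw.continuous
  have hj : Continuous fun x => inner ℝ v x * w x := by fun_prop
  rw [setIntegral_ball_eq_integral_polarIntegral volume hw' hr.le,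
    integral_sphereSurfaceMeasure hr.le hj]
  refine mul_integral_eq_of_weighted_integral_eq (continuous_polarIntegral _ hw')
    (continuous_polarIntegral _ hj) (fun R hR => ?_) hr
  have h1 := integral_ball_weighted_fderiv hw v R
  rw [setIntegral_ball_eq_integral_polarIntegral volume (by fun_prop) hR.le,
    setIntegral_ball_eq_integral_polarIntegral volume (by fun_prop) hR.le] at h1
  have h2 : ∀ (a : ℝ → ℝ) (g : 𝔼 → ℝ),
      ∫ s in (0 : ℝ)..R, polarIntegral volume (fun x => a ‖x‖ * g x) s =
      ∫ s in (0 : ℝ)..R, a s * polarIntegral volume g s := by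
    intro a g
    refine intervalIntegral.integral_congr fun s hs => ?_
    rw [uIcc_of_le hR.le] at hs
    exact polarIntegral_radial_mul a g hs.1
  rw [h2 (fun s => (R ^ 2 - s ^ 2) ^ 2), h2 (fun s => R ^ 2 - s ^ 2)] at h1
  exact h1

theorem vdiv_eq_sum (Y : 𝔼 → 𝔼) {x : 𝔼} (hY : DifferentiableAt ℝ Y x) :
    vdiv Y x = ∑ i, fderiv ℝ (fun y => Y y i) x (EuclideanSpace.single i 1) := by
  rw [vdiv, LinearMap.trace_eq_sum_inner _ (EuclideanSpace.basisFun (Fin n) ℝ)]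
  refine Finset.sum_congr rfl fun i _ => ?_
  have h1 : HasFDerivAt (fun y => Y y i) ((EuclideanSpace.proj i).comp (fderiv ℝ Y x)) x :=
    (EuclideanSpace.proj i : 𝔼 →L[ℝ] ℝ).hasFDerivAt.comp x hY.hasFDerivAt
  rw [h1.fderiv]
  simp [EuclideanSpace.inner_single_left]

instance isFiniteMeasure_sphereSurfaceMeasure (r : ℝ) :
    IsFiniteMeasure (sphereSurfaceMeasure n r) := by
  rw [sphereSurfaceMeasure]
  have := Measure.isFiniteMeasure_map (volume : Measure 𝔼).toSphere
    (fun u : Metric.sphere (0 : 𝔼) 1 => r • (u : 𝔼))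
  exact Measure.smul_finite _ ENNReal.ofReal_ne_top

theorem ae_norm_eq_sphereSurfaceMeasure {r : ℝ} (hr : 0 ≤ r) :
    ∀ᵐ x ∂sphereSurfaceMeasure n r, ‖x‖ = r := by
  rw [sphereSurfaceMeasure]
  refine Measure.ae_smul_measure ?_ _
  rw [ae_map_iff (by fun_prop) (measurableSet_eq_fun (by fun_prop) (by fun_prop))]
  refine Eventually.of_forall fun u => ?_
  rw [norm_smul, Real.norm_of_nonneg hr, norm_eq_of_mem_sphere, mul_one]

theorem integrable_sphereSurfaceMeasure {F : Type*} [NormedAddCommGroup F]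
    [SecondCountableTopologyEither 𝔼 F] {r : ℝ} (hr : 0 ≤ r)
    {g : 𝔼 → F} (hg : Continuous g) : Integrable g (sphereSurfaceMeasure n r) := by
  obtain ⟨C, hC⟩ := (isCompact_closedBall (0 : 𝔼) r).exists_bound_of_continuousOn hg.continuousOn
  refine Integrable.of_bound hg.aestronglyMeasurable C ?_
  filter_upwards [ae_norm_eq_sphereSurfaceMeasure hr] with x hx
  exact hC x (by simp [hx])

/-- The divergence theorem on a ball. -/
theorem integral_ball_vdiv [NeZero n] {Y : 𝔼 → 𝔼} (hY : ContDiff ℝ 1 Y) {r : ℝ} (hr : 0 < r) :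
    ∫ x in Metric.ball 0 r, vdiv Y x =
      ∫ x, inner ℝ (Y x) (‖x‖⁻¹ • x) ∂sphereSurfaceMeasure n r := by
  have hYi : ∀ i, ContDiff ℝ 1 fun y => Y y i := fun i =>
    (EuclideanSpace.proj i : 𝔼 →L[ℝ] ℝ).contDiff.comp hY
  have hYc := hY.continuous
  have h1 : ∀ x, vdiv Y x = ∑ i, fderiv ℝ (fun y => Y y i) x (EuclideanSpace.single i 1) :=
    fun x => vdiv_eq_sum Y (hY.differentiable (by simp)).differentiableAt
  have h2 : ∫ x in Metric.ball 0 r, vdiv Y x = ∑ i, ∫ x in Metric.ball 0 r,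
      fderiv ℝ (fun y => Y y i) x (EuclideanSpace.single i 1) := by
    simp only [h1]
    refine integral_finsetSum _ fun i _ => ?_
    have hc : Continuous fun x => fderiv ℝ (fun y => Y y i) x (EuclideanSpace.single i 1) :=
      ((hYi i).continuous_fderiv (by simp)).clm_apply continuous_const
    exact (hc.continuousOn.integrableOn_compact (isCompact_closedBall (0 : 𝔼) r)).mono_set
      Metric.ball_subset_closedBall
  refine mul_left_cancel₀ hr.ne' ?_
  rw [h2, Finset.mul_sum, Finset.sum_congr rfl fun i _ => integral_ball_fderiv (hYi i) _ hr,
    ← integral_finsetSum _ fun i _ => integrable_sphereSurfaceMeasure hr.le (by fun_prop),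
    ← integral_const_mul]
  refine integral_congr_ae ?_
  filter_upwards [ae_norm_eq_sphereSurfaceMeasure hr.le] with x hx
  rw [hx, real_inner_smul_right, ← mul_assoc, mul_inv_cancel₀ hr.ne', one_mul, PiLp.inner_apply]
  refine Finset.sum_congr rfl fun i _ => ?_
  simp [EuclideanSpace.inner_single_left]

end DivergenceTheorem

/-! ### Rotation invariance and second and fourth moments of the sphere -/

section SphereMoments

variable {n : ℕ}

local notation "𝔼" => EuclideanSpace ℝ (Fin n)

theorem setIntegral_ball_comp_isometry (U : 𝔼 ≃ₗᵢ[ℝ] 𝔼) (g : 𝔼 → ℝ) (r : ℝ) :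
    ∫ x in Metric.ball 0 r, g (U x) = ∫ x in Metric.ball 0 r, g x := by
  have h1 := U.measurePreserving.setIntegral_preimage_emb
    U.toHomeomorph.measurableEmbedding g (Metric.ball 0 r)
  have h2 : U ⁻¹' Metric.ball 0 r = Metric.ball 0 r := by
    ext x; simp
  rwa [h2] at h1

/-- The sphere integral is the radial derivative of the ball integral, so invariance is inherited
from Lebesgue measure. -/
theorem integral_sphere_comp_isometry [NeZero n] (U : 𝔼 ≃ₗᵢ[ℝ] 𝔼) {g : 𝔼 → ℝ}
    (hg : Continuous g) {r : ℝ} (hr : 0 < r) :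
    ∫ x, g (U x) ∂sphereSurfaceMeasure n r = ∫ x, g x ∂sphereSurfaceMeasure n r := by
  have hgU : Continuous fun x => g (U x) := hg.comp U.continuous
  rw [integral_sphereSurfaceMeasure hr.le hgU, integral_sphereSurfaceMeasure hr.le hg]
  refine (hasDerivAt_intervalIntegral_of_continuous (continuous_polarIntegral volume hgU) 0
    r).unique ?_
  refine (hasDerivAt_intervalIntegral_of_continuous (continuous_polarIntegral volume hg) 0
    r).congr_of_eventuallyEq ?_
  filter_upwards [lt_mem_nhds hr] with s hs
  rw [← setIntegral_ball_eq_integral_polarIntegral volume hgU (le_of_lt hs),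
    ← setIntegral_ball_eq_integral_polarIntegral volume hg (le_of_lt hs),
    setIntegral_ball_comp_isometry]

theorem integral_sphere_inner_mul_inner [NeZero n] (u v : 𝔼) {r : ℝ} (hr : 0 < r) :
    ∫ x, inner ℝ v x * inner ℝ u x ∂sphereSurfaceMeasure n r =
      r * volume.real (Metric.ball (0 : 𝔼) r) * inner ℝ u v := by
  rw [← integral_ball_fderiv (w := fun x => inner ℝ u x)
    (innerSL ℝ u).contDiff v hr]
  have h1 : ∀ x : 𝔼, fderiv ℝ (fun x => inner ℝ u x) x v = inner ℝ u v := by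
    intro x
    have := (innerSL ℝ u).hasFDerivAt (x := x)
    exact congrArg (fun L => L v) this.fderiv
  simp only [h1]
  rw [setIntegral_const, smul_eq_mul]
  ring

/-- By Euler's relation `hc`, the field `g(x) x` has divergence `(n + c) g`; its normal component on
the sphere is `r g`. -/
theorem setIntegral_mul_card_add_of_homogeneous [NeZero n] {g : 𝔼 → ℝ} (hg : ContDiff ℝ 1 g)
    {c : ℝ} (hc : ∀ x, fderiv ℝ g x x = c * g x) {r : ℝ} (hr : 0 < r) :
    (n + c) * ∫ x in Metric.ball 0 r, g x = r * ∫ x, g x ∂sphereSurfaceMeasure n r := by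
  have h1 := integral_ball_vdiv (Y := fun x : 𝔼 => g x • x) (by fun_prop) hr
  have h2 : ∀ x : 𝔼, vdiv (fun x : 𝔼 => g x • x) x = (n + c) * g x := by
    intro x
    rw [vdiv_smul (X := fun x : 𝔼 => x) (hg.differentiable (by simp)).differentiableAt
      differentiableAt_id, transportDeriv, hc, vdiv, fderiv_fun_id, ContinuousLinearMap.coe_id,
      LinearMap.trace_id, finrank_euclideanSpace_fin]
    ring
  simp only [h2] at h1
  rw [integral_const_mul] at h1
  rw [h1, ← integral_const_mul]
  refine integral_congr_ae ?_
  filter_upwards [ae_norm_eq_sphereSurfaceMeasure hr.le] with x hx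
  rw [real_inner_smul_left, real_inner_smul_right, real_inner_self_eq_norm_sq, hx]
  field_simp

/-- The squared Hilbert-Schmidt norm of an operator. -/
noncomputable def hilbertSchmidtSq (M : 𝔼 →L[ℝ] 𝔼) : ℝ :=
  ∑ i, ‖M (EuclideanSpace.single i 1)‖ ^ 2

theorem integral_sphere_norm_sq [NeZero n] {M : 𝔼 →L[ℝ] 𝔼}
    (hM : (M : 𝔼 →ₗ[ℝ] 𝔼).IsSymmetric) {r : ℝ} (hr : 0 < r) :
    ∫ x, ‖M x‖ ^ 2 ∂sphereSurfaceMeasure n r =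
      r * volume.real (Metric.ball (0 : 𝔼) r) * hilbertSchmidtSq M := by
  have h1 : ∀ x : 𝔼, ‖M x‖ ^ 2 = ∑ i, inner ℝ (M (EuclideanSpace.single i 1)) x *
      inner ℝ (M (EuclideanSpace.single i 1)) x := by
    intro x
    rw [EuclideanSpace.norm_sq_eq]
    refine Finset.sum_congr rfl fun i _ => ?_
    have h2 : inner ℝ (M (EuclideanSpace.single i 1)) x = (M x) i := by
      have := hM (EuclideanSpace.single i 1) x
      simp only [ContinuousLinearMap.coe_coe] at this
      rw [this, EuclideanSpace.inner_single_left]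
      simp
    rw [h2, Real.norm_eq_abs, sq_abs, sq]
  simp only [h1]
  rw [integral_finsetSum _ fun i _ => integrable_sphereSurfaceMeasure hr.le (by fun_prop),
    hilbertSchmidtSq, Finset.mul_sum]
  refine Finset.sum_congr rfl fun i _ => ?_
  rw [integral_sphere_inner_mul_inner _ _ hr, real_inner_self_eq_norm_sq]

/-- The fourth moments of the sphere: the `L²` norm of a traceless quadratic form. -/
theorem integral_sphere_quadratic_sq [NeZero n] {M : 𝔼 →L[ℝ] 𝔼}
    (hM : (M : 𝔼 →ₗ[ℝ] 𝔼).IsSymmetric) (htr : LinearMap.trace ℝ 𝔼 (M : 𝔼 →ₗ[ℝ] 𝔼) = 0)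
    {r : ℝ} (hr : 0 < r) :
    ∫ x, inner ℝ (M x) x ^ 2 ∂sphereSurfaceMeasure n r =
      2 * (r ^ 3 * volume.real (Metric.ball (0 : 𝔼) r) / (n + 2)) * hilbertSchmidtSq M := by
  have hQ : ∀ x : 𝔼, HasFDerivAt (fun x => inner ℝ (M x) x) ((2 : ℝ) • innerSL ℝ (M x)) x := by
    intro x
    have h1 := (M.hasFDerivAt (x := x)).inner ℝ (hasFDerivAt_id x)
    convert! h1 using 1
    ext v
    have := hM v x
    simp only [ContinuousLinearMap.coe_coe] at this
    simp [this, two_mul, real_inner_comm]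
  have hN : ∀ x : 𝔼, HasFDerivAt (fun x => ‖M x‖ ^ 2) ((2 : ℝ) • (innerSL ℝ (M x)).comp M) x := by
    intro x
    have h1 := (M.hasFDerivAt (x := x)).norm_sq
    convert! h1 using 1
    simp [ofNat_smul_eq_nsmul]
  -- With `Q(x) = ⟨M x, x⟩`, the field `Q(x) M x` has divergence `2 ‖M x‖²`, since the trace of `M`
  -- vanishes, and normal component `Q² / r`. This turns the fourth moment into a second moment.
  have h1 := integral_ball_vdiv (Y := fun x : 𝔼 => (inner ℝ (M x) x : ℝ) • M x)
    ((M.contDiff.inner ℝ contDiff_id).smul M.contDiff) hr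
  have h2 : ∀ x : 𝔼, vdiv (fun x : 𝔼 => (inner ℝ (M x) x : ℝ) • M x) x = 2 * ‖M x‖ ^ 2 := by
    intro x
    rw [vdiv_smul (X := fun x : 𝔼 => M x) (hQ x).differentiableAt M.differentiableAt,
      transportDeriv, (hQ x).fderiv, vdiv, ContinuousLinearMap.fderiv, htr]
    simp
  have h3 := setIntegral_mul_card_add_of_homogeneous (g := fun x : 𝔼 => ‖M x‖ ^ 2) (c := 2)
    (M.contDiff.norm_sq ℝ) (fun x => by rw [(hN x).fderiv]; simp) hr
  rw [integral_sphere_norm_sq hM hr] at h3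
  simp only [h2] at h1
  rw [integral_const_mul] at h1
  have h4 : ∫ x, inner ℝ (M x) x ^ 2 ∂sphereSurfaceMeasure n r =
      r * ∫ x, inner ℝ ((inner ℝ (M x) x : ℝ) • M x) (‖x‖⁻¹ • x) ∂sphereSurfaceMeasure n r := by
    rw [← integral_const_mul]
    refine integral_congr_ae ?_
    filter_upwards [ae_norm_eq_sphereSurfaceMeasure hr.le] with x hx
    rw [real_inner_smul_left, real_inner_smul_right, hx]
    field_simp
  rw [h4, ← h1]
  have hn : (n : ℝ) + 2 ≠ 0 := by positivity
  have h5 : ∫ x in Metric.ball (0 : 𝔼) r, ‖M x‖ ^ 2 =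
      r * (r * volume.real (Metric.ball (0 : 𝔼) r) * hilbertSchmidtSq M) / (n + 2) := by
    rw [eq_div_iff hn, ← h3]; ring
  rw [h5]
  field_simp

end SphereMoments

/-! ### The second moment operator and its extremal norm -/

section SecondMomentOperator

variable {n : ℕ}

local notation "𝔼" => EuclideanSpace ℝ (Fin n)

/-- The operator `x ↦ ∫ ⟪y, x⟫ f(y) y dy` over the sphere. -/
noncomputable def momentOperator (r : ℝ) (f : 𝔼 → ℝ) : 𝔼 →L[ℝ] 𝔼 :=
  ∑ i, ∑ j, (∫ y, y i * y j * f y ∂sphereSurfaceMeasure n r) •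
    (EuclideanSpace.proj i : 𝔼 →L[ℝ] ℝ).smulRight (EuclideanSpace.single j (1 : ℝ))

theorem momentOperator_apply (r : ℝ) (f : 𝔼 → ℝ) (x : 𝔼) (j : Fin n) :
    momentOperator r f x j = ∑ i, (∫ y, y i * y j * f y ∂sphereSurfaceMeasure n r) * x i := by
  simp [momentOperator, Finset.sum_apply, Pi.single_apply]

theorem inner_momentOperator {r : ℝ} (hr : 0 ≤ r) {f : 𝔼 → ℝ} (hf : Continuous f) (x z : 𝔼) :
    inner ℝ (momentOperator r f x) z =
      ∫ y, inner ℝ x y * inner ℝ z y * f y ∂sphereSurfaceMeasure n r := by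
  have h1 : ∀ y : 𝔼, inner ℝ x y * inner ℝ z y * f y =
      ∑ j, ∑ i, y i * y j * f y * (x i * z j) := by
    intro y
    rw [PiLp.inner_apply, PiLp.inner_apply, Finset.sum_mul_sum, Finset.sum_mul, Finset.sum_comm]
    refine Finset.sum_congr rfl fun j _ => ?_
    rw [Finset.sum_mul]
    refine Finset.sum_congr rfl fun i _ => ?_
    simp
    ring
  simp only [h1]
  rw [integral_finsetSum _ fun j _ => integrable_sphereSurfaceMeasure hr (by fun_prop),
    PiLp.inner_apply]
  refine Finset.sum_congr rfl fun j _ => ?_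
  rw [integral_finsetSum _ fun j _ => integrable_sphereSurfaceMeasure hr (by fun_prop),
    momentOperator_apply]
  simp only [RCLike.inner_apply, conj_trivial, Finset.mul_sum, integral_mul_const]
  refine Finset.sum_congr rfl fun i _ => ?_
  ring

theorem isSymmetric_momentOperator {r : ℝ} (hr : 0 ≤ r) {f : 𝔼 → ℝ} (hf : Continuous f) :
    (momentOperator r f : 𝔼 →ₗ[ℝ] 𝔼).IsSymmetric := by
  intro x z
  simp only [ContinuousLinearMap.coe_coe]
  rw [inner_momentOperator hr hf, real_inner_comm, inner_momentOperator hr hf]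
  simp only [mul_comm (inner ℝ x _)]

/-- The map from `f` to its moment operator is adjoint to the map from `T` to its quadratic form.
Taking `T` to be the identity gives the trace, and `T` the moment operator itself gives the
Hilbert-Schmidt norm. -/
theorem sum_inner_momentOperator {r : ℝ} (hr : 0 ≤ r) {f : 𝔼 → ℝ} (hf : Continuous f)
    (T : 𝔼 →L[ℝ] 𝔼) :
    ∑ i, inner ℝ (momentOperator r f (EuclideanSpace.single i 1))
      (T (EuclideanSpace.single i 1)) =
      ∫ y, inner ℝ (T y) y * f y ∂sphereSurfaceMeasure n r := by
  have h1 : ∀ y : 𝔼, inner ℝ (T y) y * f y = ∑ i, inner ℝ (EuclideanSpace.single i (1 : ℝ)) y *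
      inner ℝ (T (EuclideanSpace.single i (1 : ℝ))) y * f y := by
    intro y
    rw [← Finset.sum_mul]
    congr 1
    have h2 : y = ∑ i, y i • EuclideanSpace.single i (1 : ℝ) := by
      have := (EuclideanSpace.basisFun (Fin n) ℝ).sum_repr y
      simpa using this.symm
    have h3 : T y = ∑ i, y i • T (EuclideanSpace.single i (1 : ℝ)) := by
      conv_lhs => rw [h2]
      rw [map_sum]
      simp only [map_smul]
    rw [h3, sum_inner]
    refine Finset.sum_congr rfl fun i _ => ?_
    rw [real_inner_smul_left, EuclideanSpace.inner_single_left]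
    simp
  simp only [h1]
  rw [integral_finsetSum _ fun j _ => integrable_sphereSurfaceMeasure hr (by fun_prop)]
  exact Finset.sum_congr rfl fun i _ => inner_momentOperator hr hf _ _

theorem trace_momentOperator {r : ℝ} (hr : 0 ≤ r) {f : 𝔼 → ℝ} (hf : Continuous f) :
    LinearMap.trace ℝ 𝔼 (momentOperator r f : 𝔼 →ₗ[ℝ] 𝔼) =
      r ^ 2 * ∫ y, f y ∂sphereSurfaceMeasure n r := by
  rw [LinearMap.trace_eq_sum_inner _ (EuclideanSpace.basisFun (Fin n) ℝ)]
  have := sum_inner_momentOperator hr hf (ContinuousLinearMap.id ℝ 𝔼)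
  simp only [ContinuousLinearMap.id_apply] at this
  simp only [EuclideanSpace.basisFun_apply, ContinuousLinearMap.coe_coe]
  rw [Finset.sum_congr rfl fun i _ => real_inner_comm _ _, this, ← integral_const_mul]
  refine integral_congr_ae ?_
  filter_upwards [ae_norm_eq_sphereSurfaceMeasure hr] with x hx
  rw [real_inner_self_eq_norm_sq, hx]

theorem hilbertSchmidtSq_momentOperator {r : ℝ} (hr : 0 ≤ r) {f : 𝔼 → ℝ} (hf : Continuous f) :
    hilbertSchmidtSq (momentOperator r f) =
      ∫ x, inner ℝ (momentOperator r f x) x * f x ∂sphereSurfaceMeasure n r := by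
  rw [← sum_inner_momentOperator hr hf, hilbertSchmidtSq]
  simp only [real_inner_self_eq_norm_sq]

/-- Cauchy-Schwarz, from the discriminant of the nonnegative quadratic `t ↦ ∫ (t f + g)²`. -/
theorem sq_integral_mul_le {r : ℝ} (hr : 0 ≤ r) {f g : 𝔼 → ℝ} (hf : Continuous f)
    (hg : Continuous g) :
    (∫ x, f x * g x ∂sphereSurfaceMeasure n r) ^ 2 ≤
      (∫ x, f x ^ 2 ∂sphereSurfaceMeasure n r) * ∫ x, g x ^ 2 ∂sphereSurfaceMeasure n r := by
  have h : ∀ t : ℝ, 0 ≤ (∫ x, f x ^ 2 ∂sphereSurfaceMeasure n r) * (t * t) +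
      (2 * ∫ x, f x * g x ∂sphereSurfaceMeasure n r) * t +
        ∫ x, g x ^ 2 ∂sphereSurfaceMeasure n r := by
    intro t
    have h1 : 0 ≤ ∫ x, (t * f x + g x) ^ 2 ∂sphereSurfaceMeasure n r :=
      integral_nonneg fun x => sq_nonneg _
    have h2 : ∀ x, (t * f x + g x) ^ 2 = (t * t) * f x ^ 2 + (2 * t) * (f x * g x) + g x ^ 2 :=
      fun x => by ring
    simp only [h2] at h1
    rw [integral_add (integrable_sphereSurfaceMeasure hr (by fun_prop))
      (integrable_sphereSurfaceMeasure hr (by fun_prop)),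
      integral_add (integrable_sphereSurfaceMeasure hr (by fun_prop))
      (integrable_sphereSurfaceMeasure hr (by fun_prop)), integral_const_mul,
      integral_const_mul] at h1
    linarith
  have := discrim_le_zero h
  rw [discrim] at this
  linarith

/-- The sharp bound for the degree two part of the kernel `⟪x, y⟫²` on functions of mean zero. -/
theorem hilbertSchmidtSq_momentOperator_le [NeZero n] {r : ℝ} (hr : 0 < r) {f : 𝔼 → ℝ}
    (hf : Continuous f) (h0 : ∫ x, f x ∂sphereSurfaceMeasure n r = 0)
    (h1 : ∫ x, f x ^ 2 ∂sphereSurfaceMeasure n r = 1) :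
    hilbertSchmidtSq (momentOperator r f) ≤
      2 * (r ^ 3 * volume.real (Metric.ball (0 : 𝔼) r) / (n + 2)) := by
  -- Mean zero makes the moment operator `M` traceless. Then `‖M‖² = ∫ ⟨M x, x⟩ f` and
  -- Cauchy-Schwarz give `‖M‖⁴ ≤ 2κ ‖M‖²` with `κ = r³ V/(n + 2)`, and one factor cancels unless `M
  -- = 0`.
  have h2 := integral_sphere_quadratic_sq (isSymmetric_momentOperator hr.le hf)
    (by rw [trace_momentOperator hr.le hf, h0, mul_zero]) hr
  have h3 := sq_integral_mul_le hr.le (show Continuous fun x =>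
    (inner ℝ (momentOperator r f x) x : ℝ) by fun_prop) hf
  rw [← hilbertSchmidtSq_momentOperator hr.le hf, h2, h1, mul_one, sq] at h3
  rcases (show 0 ≤ hilbertSchmidtSq (momentOperator r f) from
    Finset.sum_nonneg fun i _ => sq_nonneg _).eq_or_lt with h4 | h4
  · rw [← h4]; positivity
  · exact le_of_mul_le_mul_right h3 h4

/-- The equality case of the preceding bound. As `f` is the form of `T`, the pairing of the moment
operator with `T` is `∫ f² = 1`, so the product of their squared norms is at least one, while the
fourth moment formula gives `1 = 2κ ‖T‖²` with `κ = r³ V/(n + 2)`. -/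
theorem hilbertSchmidtSq_momentOperator_ge [NeZero n] {r : ℝ} (hr : 0 < r) {f : 𝔼 → ℝ}
    (hf : Continuous f) {T : 𝔼 →L[ℝ] 𝔼} (hT : (T : 𝔼 →ₗ[ℝ] 𝔼).IsSymmetric)
    (htr : LinearMap.trace ℝ 𝔼 (T : 𝔼 →ₗ[ℝ] 𝔼) = 0)
    (hfT : ∀ x : 𝔼, ‖x‖ = r → f x = inner ℝ (T x) x)
    (h1 : ∫ x, f x ^ 2 ∂sphereSurfaceMeasure n r = 1) :
    2 * (r ^ 3 * volume.real (Metric.ball (0 : 𝔼) r) / (n + 2)) ≤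
      hilbertSchmidtSq (momentOperator r f) := by
  have h2 := integral_sphere_quadratic_sq hT htr hr
  have h3 : ∫ x, inner ℝ (T x) x * f x ∂sphereSurfaceMeasure n r = 1 := by
    rw [← h1]
    refine integral_congr_ae ?_
    filter_upwards [ae_norm_eq_sphereSurfaceMeasure hr.le] with x hx
    rw [hfT x hx, sq]
  have h4 : ∫ x, inner ℝ (T x) x ^ 2 ∂sphereSurfaceMeasure n r = 1 := by
    rw [← h1]
    refine integral_congr_ae ?_
    filter_upwards [ae_norm_eq_sphereSurfaceMeasure hr.le] with x hx
    rw [hfT x hx]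
  have h5 : (1 : ℝ) ≤ hilbertSchmidtSq (momentOperator r f) * hilbertSchmidtSq T := by
    rw [← sum_inner_momentOperator hr.le hf T] at h3
    rw [← one_pow 2, ← h3]
    calc (∑ i, inner ℝ (momentOperator r f (EuclideanSpace.single i 1))
          (T (EuclideanSpace.single i 1))) ^ 2
        ≤ (∑ i, ‖momentOperator r f (EuclideanSpace.single i 1)‖ *
          ‖T (EuclideanSpace.single i 1)‖) ^ 2 := by
          rw [sq_le_sq]
          refine (Finset.abs_sum_le_sum_abs _ _).trans ((Finset.sum_le_sum fun i _ =>
            abs_real_inner_le_norm _ _).trans (le_abs_self _))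
      _ ≤ _ := Finset.sum_mul_sq_le_sq_mul_sq _ _ _
  rw [h4] at h2
  have h6 : 0 ≤ hilbertSchmidtSq T := Finset.sum_nonneg fun i _ => sq_nonneg _
  have h7 : 0 < hilbertSchmidtSq T := h6.lt_of_ne fun h => by rw [← h, mul_zero] at h2; simp at h2
  refine le_of_mul_le_mul_right ?_ h7
  rw [← h2]
  exact h5

end SecondMomentOperator

/-! ### The Mehler kernel and noise stability as a double integral -/

section Mehler

variable {n : ℕ}

local notation "𝔼" => EuclideanSpace ℝ (Fin n)

/-- The density of the Gaussian measure. -/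
noncomputable def gaussianDensity (n : ℕ) (x : EuclideanSpace ℝ (Fin n)) : ℝ :=
  (2 * Real.pi) ^ (-(n : ℝ) / 2) * Real.exp (-‖x‖ ^ 2 / 2)

/-- The joint density of two `ρ`-correlated standard Gaussian vectors. -/
noncomputable def mehlerKernel (n : ℕ) (ρ : ℝ)
    (p : EuclideanSpace ℝ (Fin n) × EuclideanSpace ℝ (Fin n)) : ℝ :=
  ((2 * Real.pi) ^ (-(n : ℝ) / 2)) ^ 2 * (Real.sqrt (1 - ρ ^ 2) ^ n)⁻¹ *
    Real.exp (-(‖p.1‖ ^ 2 + ‖p.2‖ ^ 2 - 2 * ρ * inner ℝ p.1 p.2) / (2 * (1 - ρ ^ 2)))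

theorem gaussianDensity_pos (x : 𝔼) : 0 < gaussianDensity n x := by
  unfold gaussianDensity; positivity

theorem contDiff_gaussianDensity : ContDiff ℝ ∞ (gaussianDensity n) :=
  contDiff_const.mul (((contDiff_norm_sq ℝ).neg.div_const 2).exp)

theorem contDiff_mehlerKernel (ρ : ℝ) : ContDiff ℝ ∞ (mehlerKernel n ρ) := by
  refine contDiff_const.mul (ContDiff.exp (ContDiff.div_const (ContDiff.neg ?_) _))
  exact ((contDiff_fst.norm_sq ℝ).add (contDiff_snd.norm_sq ℝ)).sub
    (contDiff_const.mul (contDiff_fst.inner ℝ contDiff_snd))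

theorem integral_gaussianMeasure (f : 𝔼 → ℝ) :
    ∫ x, f x ∂gaussianMeasure n = ∫ x, gaussianDensity n x * f x := by
  have h := integral_withDensity_eq_integral_toReal_smul (μ := (volume : Measure 𝔼))
    (f := fun x => ENNReal.ofReal (gaussianDensity n x))
    (contDiff_gaussianDensity.continuous.measurable.ennreal_ofReal)
    (Eventually.of_forall fun _ => ENNReal.ofReal_lt_top) f
  simp only [ENNReal.toReal_ofReal (gaussianDensity_pos _).le, smul_eq_mul] at h
  exact h

theorem integral_gaussianDensity : ∫ x : 𝔼, gaussianDensity n x = 1 := by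
  simp only [gaussianDensity]
  rw [integral_const_mul]
  have h := GaussianFourier.integral_rexp_neg_mul_sq_norm (V := 𝔼) (b := 1 / 2) (by norm_num)
  have h2 : ∀ x : 𝔼, -‖x‖ ^ 2 / 2 = -(1 / 2) * ‖x‖ ^ 2 := fun x => by ring
  simp only [h2, h, finrank_euclideanSpace_fin]
  rw [show Real.pi / (1 / 2) = 2 * Real.pi by ring, ← Real.rpow_add (by positivity)]
  rw [neg_div, neg_add_cancel, Real.rpow_zero]

theorem integrable_gaussianDensity : Integrable (gaussianDensity n) := by
  -- A non-integrable function has integral `0` by convention, whereas this integral is `1`.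
  by_contra h
  have := integral_gaussianDensity (n := n)
  rw [integral_undef h] at this
  exact zero_ne_one this

instance isProbabilityMeasure_gaussianMeasure : IsProbabilityMeasure (gaussianMeasure n) := by
  refine ⟨?_⟩
  rw [gaussianMeasure, withDensity_apply _ MeasurableSet.univ, setLIntegral_univ]
  change ∫⁻ x : 𝔼, ENNReal.ofReal (gaussianDensity n x) = 1
  rw [← ofReal_integral_eq_lintegral_ofReal integrable_gaussianDensity
    (Eventually.of_forall fun x => (gaussianDensity_pos x).le)]
  rw [integral_gaussianDensity, ENNReal.ofReal_one]

theorem gaussianMeasure_real_eq {A : Set 𝔼} (hA : MeasurableSet A) :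
    (gaussianMeasure n).real A = ∫ x in A, gaussianDensity n x := by
  rw [← integral_indicator_one hA, integral_gaussianMeasure, ← integral_indicator hA]
  congr 1
  funext x
  by_cases hx : x ∈ A <;> simp [hx]

/-- Put `σ² = 1 - ρ²` and take `ρ x + σ y` as the new variable, with Jacobian factor `σ⁻ⁿ`. The
exponents combine because `‖x‖² + ‖y - ρ x‖²/σ² = (‖x‖² + ‖y‖² - 2ρ⟨x, y⟩)/σ²`. -/
theorem gaussianDensity_mul_ornsteinUhlenbeck {ρ : ℝ} (hρ : |ρ| < 1) (f : 𝔼 → ℝ) (x : 𝔼) :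
    gaussianDensity n x * ornsteinUhlenbeck n ρ f x = ∫ y, mehlerKernel n ρ (x, y) * f y := by
  have hσ2 : 0 < 1 - ρ ^ 2 := by
    have := (sq_lt_one_iff_abs_lt_one ρ).2 hρ
    linarith
  set σ := Real.sqrt (1 - ρ ^ 2) with hσ
  have hσ0 : 0 < σ := Real.sqrt_pos.2 hσ2
  have hσs : σ ^ 2 = 1 - ρ ^ 2 := Real.sq_sqrt hσ2.le
  rw [ornsteinUhlenbeck, integral_gaussianMeasure]
  set h : 𝔼 → ℝ := fun z => gaussianDensity n (σ⁻¹ • z) * f (ρ • x + z) with hh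
  have h1 : ∀ y, gaussianDensity n y * f (ρ • x + σ • y) = h (σ • y) := by
    intro y
    simp only [hh, smul_smul, inv_mul_cancel₀ hσ0.ne', one_smul]
  simp only [← hσ, h1]
  rw [Measure.integral_comp_smul, finrank_euclideanSpace_fin,
    ← integral_add_left_eq_self _ (-(ρ • x)), smul_eq_mul, ← mul_assoc, ← integral_const_mul]
  congr 1
  funext y
  simp only [hh, add_neg_cancel_left, mehlerKernel, gaussianDensity]
  rw [abs_of_pos (by positivity)]
  have h2 : -(‖x‖ ^ 2 + ‖y‖ ^ 2 - 2 * ρ * inner ℝ x y) / (2 * (1 - ρ ^ 2)) =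
      -‖x‖ ^ 2 / 2 + -‖σ⁻¹ • (-(ρ • x) + y)‖ ^ 2 / 2 := by
    rw [norm_smul, mul_pow, neg_add_eq_sub, norm_sub_sq_real, norm_smul, real_inner_smul_right,
      real_inner_comm, Real.norm_of_nonneg (inv_nonneg.2 hσ0.le), ← hσs, inv_pow, mul_pow,
      Real.norm_eq_abs, sq_abs]
    have : σ ^ 2 ≠ 0 := by positivity
    field_simp
    rw [hσs]
    ring
  rw [h2, Real.exp_add]
  ring

theorem mehlerKernel_pos {ρ : ℝ} (hρ : |ρ| < 1) (p : 𝔼 × 𝔼) : 0 < mehlerKernel n ρ p := by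
  have hσ2 : 0 < 1 - ρ ^ 2 := by
    have := (sq_lt_one_iff_abs_lt_one ρ).2 hρ
    linarith
  have := Real.sqrt_pos.2 hσ2
  unfold mehlerKernel
  positivity

theorem mehlerKernel_swap (ρ : ℝ) (x y : 𝔼) : mehlerKernel n ρ (x, y) = mehlerKernel n ρ (y, x) := by
  simp only [mehlerKernel, real_inner_comm, add_comm]

theorem integral_mehlerKernel {ρ : ℝ} (hρ : |ρ| < 1) (x : 𝔼) :
    ∫ y, mehlerKernel n ρ (x, y) = gaussianDensity n x := by
  have h := gaussianDensity_mul_ornsteinUhlenbeck hρ (fun _ => 1) x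
  simpa [ornsteinUhlenbeck] using h.symm

theorem integrable_mehlerKernel_right {ρ : ℝ} (hρ : |ρ| < 1) (x : 𝔼) :
    Integrable fun y => mehlerKernel n ρ (x, y) := by
  by_contra h
  have := integral_mehlerKernel hρ x
  rw [integral_undef h] at this
  exact (gaussianDensity_pos x).ne this

theorem integrable_mehlerKernel {ρ : ℝ} (hρ : |ρ| < 1) :
    Integrable (mehlerKernel n ρ) ((volume : Measure 𝔼).prod volume) := by
  rw [integrable_prod_iff (contDiff_mehlerKernel ρ).continuous.aestronglyMeasurable]
  refine ⟨Eventually.of_forall fun x => integrable_mehlerKernel_right hρ x, ?_⟩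
  simp only [Real.norm_of_nonneg (mehlerKernel_pos hρ _).le, integral_mehlerKernel hρ]
  exact integrable_gaussianDensity

theorem noiseStability_eq_setIntegral {ρ : ℝ} (hρ : |ρ| < 1) {A : Set 𝔼} (hA : MeasurableSet A) :
    noiseStability n ρ A =
      ∫ p in A ×ˢ A, mehlerKernel n ρ p ∂((volume : Measure 𝔼).prod volume) := by
  rw [noiseStability, integral_gaussianMeasure, setIntegral_prod _
    (integrable_mehlerKernel hρ).integrableOn, ← integral_indicator hA]
  congr 1
  funext x
  rw [mul_left_comm, gaussianDensity_mul_ornsteinUhlenbeck hρ]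
  by_cases hx : x ∈ A
  · rw [indicator_of_mem hx, indicator_of_mem hx, one_mul, ← integral_indicator hA]
    congr 1
    funext y
    by_cases hy : y ∈ A <;> simp [hy]
  · simp [hx]

/-- The kernel is symmetric with Gaussian marginals, so the masses of `A × A` and `Aᶜ × Aᶜ` both
come from the marginals by removing the same off-diagonal mass. Hence both noise stabilities have
the same first two derivatives when the measure is stationary to second order. -/
theorem noiseStability_compl {ρ : ℝ} (hρ : |ρ| < 1) {A : Set 𝔼} (hA : MeasurableSet A) :
    noiseStability n ρ Aᶜ =
      noiseStability n ρ A + (1 - 2 * (gaussianMeasure n).real A) := by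
  have hint := integrable_mehlerKernel (n := n) hρ
  have hrow : ∀ C : Set 𝔼, MeasurableSet C →
      ∫ p in C ×ˢ univ, mehlerKernel n ρ p ∂((volume : Measure 𝔼).prod volume) =
        (gaussianMeasure n).real C := by
    intro C hC
    rw [setIntegral_prod _ hint.integrableOn, gaussianMeasure_real_eq hC]
    simp only [Measure.restrict_univ, integral_mehlerKernel hρ]
  have hcol : ∫ p in A ×ˢ Aᶜ, mehlerKernel n ρ p ∂((volume : Measure 𝔼).prod volume) =
      ∫ p in Aᶜ ×ˢ A, mehlerKernel n ρ p ∂((volume : Measure 𝔼).prod volume) := by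
    rw [← setIntegral_prod_swap]
    simp only [Prod.swap, mehlerKernel_swap ρ]
  have hsplit : ∀ C : Set 𝔼, MeasurableSet C →
      ∫ p in C ×ˢ univ, mehlerKernel n ρ p ∂((volume : Measure 𝔼).prod volume) =
      ∫ p in C ×ˢ A, mehlerKernel n ρ p ∂((volume : Measure 𝔼).prod volume) +
      ∫ p in C ×ˢ Aᶜ, mehlerKernel n ρ p ∂((volume : Measure 𝔼).prod volume) := by
    intro C hC
    rw [← setIntegral_union ?_ (hC.prod hA.compl) hint.integrableOn hint.integrableOn,
      ← prod_union, union_compl_self]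
    rw [Set.disjoint_prod]
    exact Or.inr disjoint_compl_right
  have h1 := hsplit A hA
  have h2 := hsplit Aᶜ hA.compl
  rw [hrow _ hA] at h1
  rw [hrow _ hA.compl, probReal_compl_eq_one_sub hA] at h2
  rw [noiseStability_eq_setIntegral hρ hA, noiseStability_eq_setIntegral hρ hA.compl]
  linarith

end Mehler

/-! ### The doubled flow on the product space -/

section ProductFlow

variable {E : Type*} [NormedAddCommGroup E] [NormedSpace ℝ E]

/-- The vector field on `E × E` acting as `X` on each factor. -/
def doubleField (X : E → E) (p : E × E) : E × E := (X p.1, X p.2)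

/-- The flow on `E × E` acting as `Ψ` on each factor. -/
def doubleFlow (Ψ : E → ℝ → E) (p : E × E) (t : ℝ) : E × E := (Ψ p.1 t, Ψ p.2 t)

/-- The square of the moving set is the image of `A × A` under this flow, which brings noise
stability under the transport formula. -/
theorem IsSmoothLocalFlow.double {X : E → E} {Ψ : E → ℝ → E} (h : IsSmoothLocalFlow X Ψ) :
    IsSmoothLocalFlow (doubleField X) (doubleFlow Ψ) where
  contDiff_field := (h.contDiff_field.comp contDiff_fst).prodMk (h.contDiff_field.comp contDiff_snd)
  contDiffOn_flow := by
    refine ContDiffOn.prodMk ?_ ?_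
    · exact h.contDiffOn_flow.comp (f := fun p : (E × E) × ℝ => (p.1.1, p.2)) (by fun_prop)
        fun p hp => ⟨mem_univ _, hp.2⟩
    · exact h.contDiffOn_flow.comp (f := fun p : (E × E) × ℝ => (p.1.2, p.2)) (by fun_prop)
        fun p hp => ⟨mem_univ _, hp.2⟩
  initial p := by simp [doubleFlow, h.initial]
  ode p t ht := (h.ode p.1 t ht).prodMk (h.ode p.2 t ht)

theorem image_doubleFlow {E : Type*} (Ψ : E → ℝ → E) (A : Set E) (t : ℝ) :
    (fun p => doubleFlow Ψ p t) '' (A ×ˢ A) =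
      ((fun x => Ψ x t) '' A) ×ˢ ((fun x => Ψ x t) '' A) := by
  ext ⟨y, z⟩
  simp only [mem_image, mem_prod, doubleFlow, Prod.mk.injEq, Prod.exists]
  grind

theorem vdiv_doubleField [FiniteDimensional ℝ E] {X : E → E} (hX : Differentiable ℝ X) (p : E × E) :
    vdiv (doubleField X) p = vdiv X p.1 + vdiv X p.2 := by
  have h1 : HasFDerivAt (doubleField X)
      ((fderiv ℝ X p.1).prodMap (fderiv ℝ X p.2)) p :=
    HasFDerivAt.prodMap p (hX p.1).hasFDerivAt (hX p.2).hasFDerivAt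
  rw [vdiv, h1.fderiv, vdiv, vdiv]
  exact LinearMap.trace_prodMap' _ _

theorem transportDeriv_doubleField [FiniteDimensional ℝ E] {X : E → E} (hX : Differentiable ℝ X)
    {k : E × E → ℝ} (hk : Differentiable ℝ k) (x y : E) :
    transportDeriv (doubleField X) k (x, y) =
      transportDeriv X (fun x => k (x, y)) x + transportDeriv X (fun y => k (x, y)) y := by
  have h1 : HasFDerivAt (fun x => k (x, y))
      ((fderiv ℝ k (x, y)).comp (ContinuousLinearMap.inl ℝ E E)) x :=
    HasFDerivAt.comp (f := fun x : E => (x, y)) x (hk (x, y)).hasFDerivAt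
      (hasFDerivAt_prodMk_left x y)
  have h2 : HasFDerivAt (fun y => k (x, y))
      ((fderiv ℝ k (x, y)).comp (ContinuousLinearMap.inr ℝ E E)) y :=
    HasFDerivAt.comp (f := fun y : E => (x, y)) y (hk (x, y)).hasFDerivAt
      (hasFDerivAt_prodMk_right x y)
  rw [transportDeriv, transportDeriv, transportDeriv, h1.fderiv, h2.fderiv, vdiv_doubleField hX]
  have h3 : doubleField X (x, y) = (X x, 0) + (0, X y) := by simp [doubleField]
  rw [h3, map_add]
  simp
  ring

/-- Symmetry passes to the transported weight, so the boundary formula for symmetric kernels can be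
used for the second variation as well as the first. -/
theorem transportDeriv_doubleField_swap [FiniteDimensional ℝ E] {X : E → E}
    (hX : Differentiable ℝ X) {k : E × E → ℝ} (hk : Differentiable ℝ k)
    (hsymm : ∀ x y, k (x, y) = k (y, x)) (x y : E) :
    transportDeriv (doubleField X) k (x, y) = transportDeriv (doubleField X) k (y, x) := by
  rw [transportDeriv_doubleField hX hk, transportDeriv_doubleField hX hk, add_comm]
  have e : ∀ z, (fun y => k (z, y)) = fun y => k (y, z) := fun z => funext (hsymm z)
  rw [e x, ← e y]

end ProductFlow

/-! ### Reduction of variations of the ball to the sphere -/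

section BallVariation

variable {n : ℕ}

local notation "𝔼" => EuclideanSpace ℝ (Fin n)

/-- The component of `X` along the exterior normal `x / r` of the sphere of radius `r`. -/
noncomputable def normalComponent (r : ℝ) (X : 𝔼 → 𝔼) (x : 𝔼) : ℝ := r⁻¹ * inner ℝ (X x) x

theorem continuous_normalComponent {X : 𝔼 → 𝔼} (hX : Continuous X) (r : ℝ) :
    Continuous (normalComponent r X) := by
  unfold normalComponent
  fun_prop

theorem integral_ball_transportDeriv [NeZero n] {X : 𝔼 → 𝔼} (hX : ContDiff ℝ ∞ X) {w : 𝔼 → ℝ}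
    (hw : ContDiff ℝ ∞ w) {r : ℝ} (hr : 0 < r) :
    ∫ x in Metric.ball 0 r, transportDeriv X w x =
      ∫ x, w x * normalComponent r X x ∂sphereSurfaceMeasure n r := by
  have h1 := integral_ball_vdiv (Y := fun x => w x • X x)
    ((hw.smul hX).of_le (WithTop.coe_le_coe.2 (le_top : (1 : ℕ∞) ≤ ⊤))) hr
  have h2 : ∀ x, vdiv (fun x => w x • X x) x = transportDeriv X w x := fun x =>
    vdiv_smul (hw.differentiable (by simp)).differentiableAt
      (hX.differentiable (by simp)).differentiableAt
  simp only [h2] at h1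
  rw [h1]
  refine integral_congr_ae ?_
  filter_upwards [ae_norm_eq_sphereSurfaceMeasure hr.le] with x hx
  rw [hx, real_inner_smul_left, real_inner_smul_right, normalComponent]

theorem integrable_prod_of_continuous {ν₁ ν₂ : Measure 𝔼} [IsFiniteMeasure ν₁]
    [IsFiniteMeasure ν₂] {r : ℝ} (h₁ : ∀ᵐ x ∂ν₁, ‖x‖ ≤ r) (h₂ : ∀ᵐ x ∂ν₂, ‖x‖ ≤ r)
    {k : 𝔼 × 𝔼 → ℝ} (hk : Continuous k) : Integrable k (ν₁.prod ν₂) := by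
  obtain ⟨C, hC⟩ := ((isCompact_closedBall (0 : 𝔼) r).prod
    (isCompact_closedBall (0 : 𝔼) r)).exists_bound_of_continuousOn hk.continuousOn
  refine Integrable.of_bound hk.aestronglyMeasurable C ?_
  filter_upwards [Measure.quasiMeasurePreserving_fst.ae h₁,
    Measure.quasiMeasurePreserving_snd.ae h₂] with z hz1 hz2
  exact hC z ⟨by simpa using hz1, by simpa using hz2⟩

theorem ae_norm_le_ball (r : ℝ) : ∀ᵐ x ∂(volume : Measure 𝔼).restrict (Metric.ball 0 r), ‖x‖ ≤ r :=
  ae_restrict_of_forall_mem measurableSet_ball fun _ hx => (mem_ball_zero_iff.1 hx).le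

instance isFiniteMeasure_restrict_ball_zero (r : ℝ) :
    IsFiniteMeasure ((volume : Measure 𝔼).restrict (Metric.ball 0 r)) :=
  ⟨by rw [Measure.restrict_apply_univ]; exact measure_ball_lt_top⟩

theorem ae_norm_le_sphere {r : ℝ} (hr : 0 ≤ r) : ∀ᵐ x ∂sphereSurfaceMeasure n r, ‖x‖ ≤ r :=
  (ae_norm_eq_sphereSurfaceMeasure hr).mono fun _ h => h.le

/-- By symmetry of `k` both factors contribute equally, whence the `2`. For one of them, the
divergence theorem in `x` at fixed `y` followed by Fubini gives the sphere integral. -/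
theorem setIntegral_ball_prod_transportDeriv [NeZero n] {X : 𝔼 → 𝔼} (hX : ContDiff ℝ ∞ X)
    {k : 𝔼 × 𝔼 → ℝ} (hk : ContDiff ℝ ∞ k) (hsymm : ∀ x y, k (x, y) = k (y, x)) {r : ℝ}
    (hr : 0 < r) :
    ∫ p in Metric.ball 0 r ×ˢ Metric.ball 0 r, transportDeriv (doubleField X) k p
        ∂((volume : Measure 𝔼).prod volume) =
      2 * ∫ x, normalComponent r X x * (∫ y in Metric.ball 0 r, k (x, y))
        ∂sphereSurfaceMeasure n r := by
  have hX' : Differentiable ℝ X := hX.differentiable (by simp)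
  have hk' : Differentiable ℝ k := hk.differentiable (by simp)
  have hXc := hX.continuous
  have hf := continuous_normalComponent hXc r
  have hkx : ∀ y, ContDiff ℝ ∞ fun x => k (x, y) := fun y =>
    hk.comp (contDiff_id.prodMk contDiff_const)
  set K₁ : 𝔼 × 𝔼 → ℝ := fun p => transportDeriv X (fun x => k (x, p.2)) p.1 with hK₁
  have hK₁c : Continuous K₁ := by
    have h1 : K₁ = fun p => fderiv ℝ k p (X p.1, 0) + k p * vdiv X p.1 := by
      funext p
      have h1 : HasFDerivAt (fun x => k (x, p.2))
          ((fderiv ℝ k (p.1, p.2)).comp (ContinuousLinearMap.inl ℝ 𝔼 𝔼)) p.1 :=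
        HasFDerivAt.comp (f := fun x : 𝔼 => (x, p.2)) p.1 (hk' (p.1, p.2)).hasFDerivAt
          (hasFDerivAt_prodMk_left p.1 p.2)
      simp only [hK₁, transportDeriv]
      rw [h1.fderiv]
      simp
    rw [h1]
    refine ((hk.continuous_fderiv (by simp)).clm_apply ?_).add
      (hk.continuous.mul ((contDiff_vdiv hX).continuous.comp continuous_fst))
    exact (hXc.comp continuous_fst).prodMk continuous_const
  have hint : ∀ {g : 𝔼 × 𝔼 → ℝ}, Continuous g →
      Integrable g (((volume : Measure 𝔼).restrict (Metric.ball 0 r)).prod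
        ((volume : Measure 𝔼).restrict (Metric.ball 0 r))) := fun hg =>
    integrable_prod_of_continuous (ae_norm_le_ball r) (ae_norm_le_ball r) hg
  have h1 : ∀ p : 𝔼 × 𝔼, transportDeriv (doubleField X) k p = K₁ p + K₁ p.swap := by
    rintro ⟨x, y⟩
    rw [transportDeriv_doubleField hX' hk']
    simp only [hK₁, Prod.swap, hsymm x]
  simp only [h1]
  rw [← Measure.prod_restrict, integral_add (hint hK₁c) (hint (by fun_prop)),
    integral_prod_swap, ← two_mul, integral_prod_symm _ (hint hK₁c)]
  congr 1
  have h2 : ∀ y : 𝔼, ∫ x in Metric.ball 0 r, K₁ (x, y) =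
      ∫ x, k (x, y) * normalComponent r X x ∂sphereSurfaceMeasure n r := fun y =>
    integral_ball_transportDeriv hX (hkx y) hr
  simp only [h2]
  rw [integral_integral_swap]
  · simp only [mul_comm (k _), integral_const_mul]
  · refine integrable_prod_of_continuous (ae_norm_le_ball r) (ae_norm_le_sphere hr.le) ?_
    have := hk.continuous
    simp only [Function.uncurry_def]
    fun_prop

end BallVariation

/-! ### Consequences of rotation invariance -/

section RotationInvariance

variable {n : ℕ}

local notation "𝔼" => EuclideanSpace ℝ (Fin n)

theorem exists_linearIsometryEquiv_apply_eq {x z : 𝔼} (h : ‖x‖ = ‖z‖) :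
    ∃ U : 𝔼 ≃ₗᵢ[ℝ] 𝔼, U x = z :=
  ⟨_, Submodule.reflection_sub h⟩

theorem integral_sphere_inner_congr [NeZero n] {Φ : ℝ → ℝ} (hΦ : Continuous Φ) {x z : 𝔼}
    (h : ‖x‖ = ‖z‖) {r : ℝ} (hr : 0 < r) :
    ∫ y, Φ (inner ℝ x y) ∂sphereSurfaceMeasure n r =
      ∫ y, Φ (inner ℝ z y) ∂sphereSurfaceMeasure n r := by
  obtain ⟨U, rfl⟩ := exists_linearIsometryEquiv_apply_eq h
  rw [← integral_sphere_comp_isometry U (g := fun y => Φ (inner ℝ (U x) y)) (by fun_prop) hr]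
  simp only [LinearIsometryEquiv.inner_map_map]

/-- The reflection in the hyperplane orthogonal to `u` fixes `x` and negates `u`, so the integral
equals its own negative. -/
theorem integral_sphere_inner_mul_of_orthogonal [NeZero n] {Φ : ℝ → ℝ} (hΦ : Continuous Φ)
    {u x : 𝔼} (h : inner ℝ u x = 0) {r : ℝ} (hr : 0 < r) :
    ∫ y, inner ℝ u y * Φ (inner ℝ x y) ∂sphereSurfaceMeasure n r = 0 := by
  set U : 𝔼 ≃ₗᵢ[ℝ] 𝔼 := (ℝ ∙ u)ᗮ.reflection with hU
  have hUu : U u = -u := Submodule.reflection_orthogonalComplement_singleton_eq_neg u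
  have hUx : U x = x := by
    rw [hU, Submodule.reflection_eq_self_iff, Submodule.mem_orthogonal_singleton_iff_inner_right]
    exact h
  have h1 := integral_sphere_comp_isometry U
    (g := fun y => inner ℝ u y * Φ (inner ℝ x y)) (by fun_prop) hr
  have h2 : ∀ y, inner ℝ u (U y) * Φ (inner ℝ x (U y)) = -(inner ℝ u y * Φ (inner ℝ x y)) := by
    intro y
    have e1 : inner ℝ x (U y) = inner ℝ x y := by
      conv_lhs => rw [← hUx]
      exact U.inner_map_map x y
    have e2 : inner ℝ u (U y) = -inner ℝ u y := by
      have : u = -(U u) := by rw [hUu, neg_neg]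
      conv_lhs => rw [this]
      rw [inner_neg_left, U.inner_map_map]
    rw [e1, e2, neg_mul]
  simp only [h2] at h1
  rw [integral_neg] at h1
  linarith

/-- Only the component of `v` along `x` contributes; the orthogonal component integrates to zero. -/
theorem integral_sphere_inner_mul [NeZero n] {Φ : ℝ → ℝ} (hΦ : Continuous Φ)
    (v : 𝔼) {x : 𝔼} {r : ℝ} (hr : 0 < r) (hx : ‖x‖ = r) :
    ∫ y, inner ℝ v y * Φ (inner ℝ x y) ∂sphereSurfaceMeasure n r =
      (inner ℝ v x / r ^ 2) *
        ∫ y, inner ℝ x y * Φ (inner ℝ x y) ∂sphereSurfaceMeasure n r := by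
  set a : ℝ := inner ℝ v x / r ^ 2 with ha
  have hu : inner ℝ (v - a • x) x = 0 := by
    rw [inner_sub_left, real_inner_smul_left, real_inner_self_eq_norm_sq, hx, ha]
    field_simp
    ring
  have h1 := integral_sphere_inner_mul_of_orthogonal hΦ hu hr
  have h2 : ∀ y : 𝔼, inner ℝ (v - a • x) y * Φ (inner ℝ x y) =
      inner ℝ v y * Φ (inner ℝ x y) - a * (inner ℝ x y * Φ (inner ℝ x y)) := by
    intro y
    rw [inner_sub_left, real_inner_smul_left]
    ring
  simp only [h2] at h1
  rw [integral_sub (integrable_sphereSurfaceMeasure hr.le (by fun_prop))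
    (integrable_sphereSurfaceMeasure hr.le (by fun_prop)), integral_const_mul] at h1
  linarith

theorem setIntegral_ball_mehlerKernel_congr (ρ : ℝ) {x z : 𝔼} (h : ‖x‖ = ‖z‖) (r : ℝ) :
    ∫ y in Metric.ball 0 r, mehlerKernel n ρ (x, y) =
      ∫ y in Metric.ball 0 r, mehlerKernel n ρ (z, y) := by
  obtain ⟨U, rfl⟩ := exists_linearIsometryEquiv_apply_eq h
  rw [← setIntegral_ball_comp_isometry U (fun y => mehlerKernel n ρ (U x, y))]
  simp only [mehlerKernel, LinearIsometryEquiv.inner_map_map, LinearIsometryEquiv.norm_map]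

end RotationInvariance

/-! ### The first and second variation of noise stability at the ball -/

section BallSecondVariation

variable {n : ℕ}

local notation "𝔼" => EuclideanSpace ℝ (Fin n)

theorem hasFDerivAt_mehlerKernel_left (ρ : ℝ) (x y : 𝔼) :
    HasFDerivAt (fun x => mehlerKernel n ρ (x, y))
      ((mehlerKernel n ρ (x, y) * (-(1 - ρ ^ 2)⁻¹)) • (innerSL ℝ x - ρ • innerSL ℝ y)) x := by
  have h1 : HasFDerivAt (fun x : 𝔼 => ‖x‖ ^ 2) ((2 : ℝ) • innerSL ℝ x) x := by
    simpa [ofNat_smul_eq_nsmul] using (hasStrictFDerivAt_norm_sq x).hasFDerivAt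
  have h2 : HasFDerivAt (fun x : 𝔼 => (inner ℝ x y : ℝ)) (innerSL ℝ y) x := by
    have := (innerSL ℝ y).hasFDerivAt (x := x)
    refine this.congr_of_eventuallyEq (Eventually.of_forall fun z => ?_)
    simp [real_inner_comm]
  have h3 := ((((h1.add_const (‖y‖ ^ 2)).sub (h2.const_mul (2 * ρ))).neg.mul_const
    (2 * (1 - ρ ^ 2))⁻¹).exp).const_mul
      (((2 * Real.pi) ^ (-(n : ℝ) / 2)) ^ 2 * (Real.sqrt (1 - ρ ^ 2) ^ n)⁻¹)
  convert! h3 using 1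
  ext v
  simp only [mehlerKernel, div_eq_mul_inv, mul_inv]
  simp
  ring

/-- Trading the `x`-derivative for a `y`-derivative lets the divergence theorem in `y` treat the
term where the field acts on `x`. -/
theorem fderiv_mehlerKernel_left (ρ : ℝ) (hρ : |ρ| < 1) (x y v : 𝔼) :
    fderiv ℝ (fun x => mehlerKernel n ρ (x, y)) x v =
      -ρ * fderiv ℝ (fun y => mehlerKernel n ρ (x, y)) y v -
        inner ℝ v x * mehlerKernel n ρ (x, y) := by
  have hσ2 : 1 - ρ ^ 2 ≠ 0 := by
    have := (sq_lt_one_iff_abs_lt_one ρ).2 hρ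
    linarith
  have e : (fun y => mehlerKernel n ρ (x, y)) = fun y => mehlerKernel n ρ (y, x) :=
    funext fun y => mehlerKernel_swap ρ x y
  rw [e, (hasFDerivAt_mehlerKernel_left ρ x y).fderiv,
    (hasFDerivAt_mehlerKernel_left ρ y x).fderiv, mehlerKernel_swap ρ y x]
  simp [real_inner_comm]
  field_simp
  ring

theorem integrableOn_ball_of_continuous {g : 𝔼 → ℝ} (hg : Continuous g) (r : ℝ) :
    IntegrableOn g (Metric.ball 0 r) :=
  (hg.continuousOn.integrableOn_compact (isCompact_closedBall (0 : 𝔼) r)).mono_set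
    Metric.ball_subset_closedBall

theorem setIntegral_ball_transportDeriv_left [NeZero n] {X : 𝔼 → 𝔼} {ρ : ℝ} (hρ : |ρ| < 1) {r : ℝ}
    (hr : 0 < r) (x : 𝔼) :
    ∫ y in Metric.ball 0 r, transportDeriv X (fun x => mehlerKernel n ρ (x, y)) x =
      (vdiv X x - inner ℝ (X x) x) * (∫ y in Metric.ball 0 r, mehlerKernel n ρ (x, y)) -
        ρ / r * ∫ y, inner ℝ (X x) y * mehlerKernel n ρ (x, y) ∂sphereSurfaceMeasure n r := by
  have hk := contDiff_mehlerKernel (n := n) ρ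
  have hky : ContDiff ℝ ∞ fun y => mehlerKernel n ρ (x, y) :=
    hk.comp (contDiff_const.prodMk contDiff_id)
  have hky1 : ContDiff ℝ 1 fun y => mehlerKernel n ρ (x, y) :=
    hky.of_le (WithTop.coe_le_coe.2 (le_top : (1 : ℕ∞) ≤ ⊤))
  have h1 : ∀ y, transportDeriv X (fun x => mehlerKernel n ρ (x, y)) x =
      (vdiv X x - inner ℝ (X x) x) * mehlerKernel n ρ (x, y) -
        ρ * fderiv ℝ (fun y => mehlerKernel n ρ (x, y)) y (X x) := by
    intro y
    rw [transportDeriv, fderiv_mehlerKernel_left ρ hρ]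
    ring
  have hc : Continuous fun y => fderiv ℝ (fun y => mehlerKernel n ρ (x, y)) y (X x) :=
    (hky.continuous_fderiv (by simp)).clm_apply continuous_const
  simp only [h1]
  rw [integral_sub ((integrableOn_ball_of_continuous hky.continuous r).const_mul _)
    ((integrableOn_ball_of_continuous hc r).const_mul _), integral_const_mul, integral_const_mul,
    ← integral_ball_fderiv hky1 (X x) hr, ← mul_assoc, div_mul_cancel₀ _ hr.ne']

theorem setIntegral_ball_transportDeriv_gaussianDensity [NeZero n] {X : 𝔼 → 𝔼}
    (hX : ContDiff ℝ ∞ X) {r : ℝ} (hr : 0 < r) :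
    ∫ x in Metric.ball 0 r, transportDeriv X (gaussianDensity n) x =
      ((2 * Real.pi) ^ (-(n : ℝ) / 2) * Real.exp (-r ^ 2 / 2)) *
        ∫ x, normalComponent r X x ∂sphereSurfaceMeasure n r := by
  rw [integral_ball_transportDeriv hX contDiff_gaussianDensity hr, ← integral_const_mul]
  refine integral_congr_ae ?_
  filter_upwards [ae_norm_eq_sphereSurfaceMeasure hr.le] with x hx
  rw [gaussianDensity, hx]

theorem transportDeriv_gaussianDensity (X : 𝔼 → 𝔼) (x : 𝔼) :
    transportDeriv X (gaussianDensity n) x =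
      gaussianDensity n x * (vdiv X x - inner ℝ (X x) x) := by
  have h1 : HasFDerivAt (fun x : 𝔼 => ‖x‖ ^ 2) ((2 : ℝ) • innerSL ℝ x) x := by
    simpa [ofNat_smul_eq_nsmul] using (hasStrictFDerivAt_norm_sq x).hasFDerivAt
  have h2 := ((h1.neg.mul_const (2 : ℝ)⁻¹).exp).const_mul ((2 * Real.pi) ^ (-(n : ℝ) / 2))
  have h3 : HasFDerivAt (gaussianDensity n) (-gaussianDensity n x • innerSL ℝ x) x := by
    convert! h2 using 1
    ext v
    simp only [gaussianDensity, div_eq_mul_inv]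
    simp
    ring
  rw [transportDeriv, h3.fderiv]
  simp [real_inner_comm]
  ring

theorem setIntegral_ball_transportDeriv_transportDeriv_gaussianDensity [NeZero n] {X : 𝔼 → 𝔼}
    (hX : ContDiff ℝ ∞ X) {r : ℝ} (hr : 0 < r) :
    ∫ x in Metric.ball 0 r, transportDeriv X (transportDeriv X (gaussianDensity n)) x =
      ((2 * Real.pi) ^ (-(n : ℝ) / 2) * Real.exp (-r ^ 2 / 2)) *
        ∫ x, normalComponent r X x * (vdiv X x - inner ℝ (X x) x) ∂sphereSurfaceMeasure n r := by
  rw [integral_ball_transportDeriv hX (contDiff_transportDeriv hX contDiff_gaussianDensity) hr,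
    ← integral_const_mul]
  refine integral_congr_ae ?_
  filter_upwards [ae_norm_eq_sphereSurfaceMeasure hr.le] with x hx
  rw [transportDeriv_gaussianDensity, gaussianDensity, hx]
  ring

/-- The inner integral of the kernel over the ball is constant on the sphere, so the first variation
is a multiple of `∫ f`. -/
theorem first_variation_ball [NeZero n] {X : 𝔼 → 𝔼} (hX : ContDiff ℝ ∞ X) (ρ : ℝ) {r : ℝ}
    (hr : 0 < r) (h0 : ∫ x, normalComponent r X x ∂sphereSurfaceMeasure n r = 0) :
    ∫ p in Metric.ball 0 r ×ˢ Metric.ball 0 r, transportDeriv (doubleField X) (mehlerKernel n ρ) p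
        ∂((volume : Measure 𝔼).prod volume) = 0 := by
  rw [setIntegral_ball_prod_transportDeriv hX (contDiff_mehlerKernel ρ) (mehlerKernel_swap ρ) hr]
  obtain ⟨x₀, hx₀⟩ : ∃ x₀ : 𝔼, ‖x₀‖ = r := ⟨EuclideanSpace.single 0 r, by simp [abs_of_pos hr]⟩
  have h1 : ∫ x, normalComponent r X x * (∫ y in Metric.ball 0 r, mehlerKernel n ρ (x, y))
        ∂sphereSurfaceMeasure n r =
      ∫ x, normalComponent r X x * (∫ y in Metric.ball 0 r, mehlerKernel n ρ (x₀, y))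
        ∂sphereSurfaceMeasure n r := by
    refine integral_congr_ae ?_
    filter_upwards [ae_norm_eq_sphereSurfaceMeasure hr.le] with x hx
    rw [setIntegral_ball_mehlerKernel_congr ρ (hx.trans hx₀.symm)]
  rw [h1, integral_mul_const, h0]
  simp

/-- The restriction of the Mehler kernel to the sphere. -/
noncomputable def mehlerSphereConst (n : ℕ) (ρ r : ℝ) : ℝ :=
  ((2 * Real.pi) ^ (-(n : ℝ) / 2)) ^ 2 * (Real.sqrt (1 - ρ ^ 2) ^ n)⁻¹ *
    Real.exp (-(r ^ 2 / (1 - ρ ^ 2)))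

theorem mehlerSphereConst_pos (n : ℕ) {ρ : ℝ} (hρ : |ρ| < 1) (r : ℝ) :
    0 < mehlerSphereConst n ρ r := by
  have hσ2 : 0 < 1 - ρ ^ 2 := by
    have := (sq_lt_one_iff_abs_lt_one ρ).2 hρ
    linarith
  have := Real.sqrt_pos.2 hσ2
  unfold mehlerSphereConst
  positivity

theorem mehlerKernel_sphere {ρ : ℝ} (hρ : |ρ| < 1) {r : ℝ} {x y : 𝔼} (hx : ‖x‖ = r)
    (hy : ‖y‖ = r) :
    mehlerKernel n ρ (x, y) =
      mehlerSphereConst n ρ r * Real.exp (ρ / (1 - ρ ^ 2) * inner ℝ x y) := by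
  have hσ2 : 1 - ρ ^ 2 ≠ 0 := by
    have := (sq_lt_one_iff_abs_lt_one ρ).2 hρ
    linarith
  rw [mehlerKernel, mehlerSphereConst, mul_assoc _ (Real.exp _), ← Real.exp_add, hx, hy]
  congr 2
  field_simp
  ring

/-- The quadratic form given by the second variation of noise stability on the sphere. -/
noncomputable def sphereForm (n : ℕ) (r ρ τ : ℝ) (x₀ : EuclideanSpace ℝ (Fin n))
    (f : EuclideanSpace ℝ (Fin n) → ℝ) : ℝ :=
  (∫ x, f x * (∫ y, Real.exp (τ * inner ℝ x y) * f y ∂sphereSurfaceMeasure n r)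
    ∂sphereSurfaceMeasure n r) -
  ρ / r ^ 2 * ∫ y, inner ℝ x₀ y * Real.exp (τ * inner ℝ x₀ y) ∂sphereSurfaceMeasure n r

/-- Where the field acts on `y`, the divergence theorem gives the bilinear form in the normal
component. Where it acts on `x`, exchanging derivatives gives a multiple of `div X - ⟨X, x⟩`,
constant on the sphere and removed by `h2`, and a boundary term in which only the normal part of `X`
survives and `h1` evaluates the remaining square. -/
theorem second_variation_ball [NeZero n] {X : 𝔼 → 𝔼} (hX : ContDiff ℝ ∞ X) {ρ : ℝ} (hρ : |ρ| < 1)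
    {r : ℝ} (hr : 0 < r) {x₀ : 𝔼} (hx₀ : ‖x₀‖ = r)
    (h1 : ∫ x, normalComponent r X x ^ 2 ∂sphereSurfaceMeasure n r = 1)
    (h2 : ∫ x, normalComponent r X x * (vdiv X x - inner ℝ (X x) x)
      ∂sphereSurfaceMeasure n r = 0) :
    ∫ p in Metric.ball 0 r ×ˢ Metric.ball 0 r,
        transportDeriv (doubleField X) (transportDeriv (doubleField X) (mehlerKernel n ρ)) p
        ∂((volume : Measure 𝔼).prod volume) =
      2 * mehlerSphereConst n ρ r * sphereForm n r ρ (ρ / (1 - ρ ^ 2)) x₀ (normalComponent r X) := by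
  have hk := contDiff_mehlerKernel (n := n) ρ
  have hX' : Differentiable ℝ X := hX.differentiable (by simp)
  have hk' : Differentiable ℝ (mehlerKernel n ρ) := hk.differentiable (by simp)
  have hXc := hX.continuous
  have hf := continuous_normalComponent hXc r
  have hdc := (contDiff_vdiv hX).continuous
  have hX2 : ContDiff ℝ ∞ (doubleField X) :=
    (hX.comp contDiff_fst).prodMk (hX.comp contDiff_snd)
  have hky : ∀ x : 𝔼, ContDiff ℝ ∞ fun y => mehlerKernel n ρ (x, y) := fun x =>
    hk.comp (contDiff_const.prodMk contDiff_id)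
  rw [setIntegral_ball_prod_transportDeriv hX (contDiff_transportDeriv hX2 hk)
    (transportDeriv_doubleField_swap hX' hk' (mehlerKernel_swap ρ)) hr, mul_assoc]
  congr 1
  set τ := ρ / (1 - ρ ^ 2) with hτ
  set c := mehlerSphereConst n ρ r with hc
  set H := ∫ y in Metric.ball 0 r, mehlerKernel n ρ (x₀, y) with hH
  set Λ := ∫ y, inner ℝ x₀ y * Real.exp (τ * inner ℝ x₀ y) ∂sphereSurfaceMeasure n r with hΛ
  have hexp : Continuous fun s : ℝ => Real.exp (τ * s) := by fun_prop
  have key : ∀ x : 𝔼, ‖x‖ = r → normalComponent r X x *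
      (∫ y in Metric.ball 0 r, transportDeriv (doubleField X) (mehlerKernel n ρ) (x, y)) =
      H * (normalComponent r X x * (vdiv X x - inner ℝ (X x) x)) -
        c * (ρ / r ^ 2 * Λ) * normalComponent r X x ^ 2 +
        c * (normalComponent r X x *
          (∫ y, Real.exp (τ * inner ℝ x y) * normalComponent r X y ∂sphereSurfaceMeasure n r)) := by
    intro x hx
    have e1 : ∫ y in Metric.ball 0 r, transportDeriv (doubleField X) (mehlerKernel n ρ) (x, y) =
        (∫ y in Metric.ball 0 r, transportDeriv X (fun x => mehlerKernel n ρ (x, y)) x) +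
        ∫ y in Metric.ball 0 r, transportDeriv X (fun y => mehlerKernel n ρ (x, y)) y := by
      have hc1 : Continuous fun y => transportDeriv X (fun y => mehlerKernel n ρ (x, y)) y :=
        (contDiff_transportDeriv hX (hky x)).continuous
      have hc2 : Continuous fun y => transportDeriv (doubleField X) (mehlerKernel n ρ) (x, y) :=
        (contDiff_transportDeriv hX2 hk).continuous.comp (by fun_prop)
      have hc3 : Continuous fun y => transportDeriv X (fun x => mehlerKernel n ρ (x, y)) x := by
        have : (fun y => transportDeriv X (fun x => mehlerKernel n ρ (x, y)) x) = fun y =>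
            transportDeriv (doubleField X) (mehlerKernel n ρ) (x, y) -
              transportDeriv X (fun y => mehlerKernel n ρ (x, y)) y := by
          funext y
          rw [transportDeriv_doubleField hX' hk']
          ring
        rw [this]
        exact hc2.sub hc1
      rw [← integral_add (integrableOn_ball_of_continuous hc3 r)
        (integrableOn_ball_of_continuous hc1 r)]
      simp only [transportDeriv_doubleField hX' hk']
    have e2 : ∫ y, mehlerKernel n ρ (x, y) * normalComponent r X y ∂sphereSurfaceMeasure n r =
        c * ∫ y, Real.exp (τ * inner ℝ x y) * normalComponent r X y
          ∂sphereSurfaceMeasure n r := by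
      rw [← integral_const_mul]
      refine integral_congr_ae ?_
      filter_upwards [ae_norm_eq_sphereSurfaceMeasure hr.le] with y hy
      rw [mehlerKernel_sphere hρ hx hy, mul_assoc]
    have e3 : ∫ y, inner ℝ (X x) y * mehlerKernel n ρ (x, y) ∂sphereSurfaceMeasure n r =
        c * (normalComponent r X x / r * Λ) := by
      have e4 : ∫ y, inner ℝ (X x) y * mehlerKernel n ρ (x, y) ∂sphereSurfaceMeasure n r =
          c * ∫ y, inner ℝ (X x) y * Real.exp (τ * inner ℝ x y) ∂sphereSurfaceMeasure n r := by
        rw [← integral_const_mul]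
        refine integral_congr_ae ?_
        filter_upwards [ae_norm_eq_sphereSurfaceMeasure hr.le] with y hy
        rw [mehlerKernel_sphere hρ hx hy]
        ring
      rw [e4, integral_sphere_inner_mul hexp _ hr hx,
        integral_sphere_inner_congr (Φ := fun s => s * Real.exp (τ * s)) (by fun_prop)
          (hx.trans hx₀.symm) hr, normalComponent]
      congr 2
      field_simp
    rw [e1, integral_ball_transportDeriv hX (hky x) hr, setIntegral_ball_transportDeriv_left hρ hr,
      setIntegral_ball_mehlerKernel_congr ρ (hx.trans hx₀.symm), e2, e3]
    field_simp
    ring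
  rw [integral_congr_ae ((ae_norm_eq_sphereSurfaceMeasure hr.le).mono key)]
  have hi1 : Integrable (fun x => normalComponent r X x * (vdiv X x - inner ℝ (X x) x))
      (sphereSurfaceMeasure n r) := integrable_sphereSurfaceMeasure hr.le (by fun_prop)
  have hi2 : Integrable (fun x => normalComponent r X x ^ 2)
      (sphereSurfaceMeasure n r) := integrable_sphereSurfaceMeasure hr.le (by fun_prop)
  have hi3 : Integrable (fun x => normalComponent r X x *
      (∫ y, Real.exp (τ * inner ℝ x y) * normalComponent r X y ∂sphereSurfaceMeasure n r))
      (sphereSurfaceMeasure n r) := by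
    have h3 : Integrable (fun p : 𝔼 × 𝔼 => normalComponent r X p.1 *
        (Real.exp (τ * inner ℝ p.1 p.2) * normalComponent r X p.2))
        ((sphereSurfaceMeasure n r).prod (sphereSurfaceMeasure n r)) :=
      integrable_prod_of_continuous (ae_norm_le_sphere hr.le) (ae_norm_le_sphere hr.le)
        (by fun_prop)
    have h4 := h3.integral_prod_left
    simpa only [integral_const_mul] using h4
  have hi12 : Integrable (fun x => H * (normalComponent r X x * (vdiv X x - inner ℝ (X x) x)) -
      c * (ρ / r ^ 2 * Λ) * normalComponent r X x ^ 2) (sphereSurfaceMeasure n r) :=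
    (hi1.const_mul _).sub (hi2.const_mul _)
  rw [integral_add hi12 (hi3.const_mul _),
    integral_sub (hi1.const_mul _) (hi2.const_mul _), integral_const_mul, integral_const_mul,
    integral_const_mul, h1, h2, sphereForm]
  ring

end BallSecondVariation

/-! ### Expansion of the second variation for small correlation -/

section SmallCorrelation

variable {n : ℕ}

local notation "𝔼" => EuclideanSpace ℝ (Fin n)

theorem abs_exp_sub_quadratic_le {u : ℝ} (hu : |u| ≤ 1) :
    |Real.exp u - (1 + u + u ^ 2 / 2)| ≤ |u| ^ 3 := by
  have h := Real.exp_bound hu (n := 3) (by norm_num)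
  simp only [Finset.sum_range_succ, Finset.sum_range_zero] at h
  norm_num [Nat.factorial] at h
  calc |Real.exp u - (1 + u + u ^ 2 / 2)| ≤ |u| ^ 3 * (2 / 9) := h
    _ ≤ |u| ^ 3 := by nlinarith [pow_nonneg (abs_nonneg u) 3]

theorem abs_inner_le_of_norm_eq {r : ℝ} {x y : 𝔼} (hx : ‖x‖ = r) (hy : ‖y‖ = r) :
    |inner ℝ x y| ≤ r ^ 2 := by
  have := abs_real_inner_le_norm x y
  rwa [hx, hy, ← sq] at this

theorem integral_sphere_inner [NeZero n] (v : 𝔼) {r : ℝ} (hr : 0 < r) :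
    ∫ y, inner ℝ v y ∂sphereSurfaceMeasure n r = 0 := by
  have := integral_ball_fderiv (w := fun _ : 𝔼 => (1 : ℝ)) contDiff_const v hr
  simpa using this.symm

/-- In the Taylor expansion of the exponential, the constant and linear terms vanish against `f` by
`h0` and `h1`; the quadratic term is the form of the moment operator. -/
theorem abs_integral_mul_exp_sub_le {r τ : ℝ} (hr : 0 < r) (hτ : |τ| * r ^ 2 ≤ 1) {f : 𝔼 → ℝ}
    (hf : Continuous f) (h0 : ∫ x, f x ∂sphereSurfaceMeasure n r = 0)
    (h1 : ∀ v, ∫ x, inner ℝ v x * f x ∂sphereSurfaceMeasure n r = 0) {x : 𝔼} (hx : ‖x‖ = r) :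
    |(∫ y, Real.exp (τ * inner ℝ x y) * f y ∂sphereSurfaceMeasure n r) -
      τ ^ 2 / 2 * inner ℝ (momentOperator r f x) x| ≤
      (|τ| * r ^ 2) ^ 3 * ∫ y, |f y| ∂sphereSurfaceMeasure n r := by
  have hint : ∀ {g : 𝔼 → ℝ}, Continuous g → Integrable g (sphereSurfaceMeasure n r) := fun hg =>
    integrable_sphereSurfaceMeasure hr.le hg
  have e1 : τ ^ 2 / 2 * inner ℝ (momentOperator r f x) x =
      ∫ y, (1 + τ * inner ℝ x y + (τ * inner ℝ x y) ^ 2 / 2) * f y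
        ∂sphereSurfaceMeasure n r := by
    have e2 : ∀ y : 𝔼, (1 + τ * inner ℝ x y + (τ * inner ℝ x y) ^ 2 / 2) * f y =
        f y + τ * (inner ℝ x y * f y) + τ ^ 2 / 2 * (inner ℝ x y * inner ℝ x y * f y) := fun y => by
      ring
    simp only [e2]
    rw [integral_add (hint (by fun_prop)) (hint (by fun_prop)),
      integral_add (hint (by fun_prop)) (hint (by fun_prop)), integral_const_mul,
      integral_const_mul, h0, h1, inner_momentOperator hr.le hf]
    ring
  rw [e1, ← integral_sub (hint (by fun_prop)) (hint (by fun_prop)), ← integral_const_mul]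
  rw [← Real.norm_eq_abs]
  refine norm_integral_le_of_norm_le ((hint (by fun_prop)).const_mul _) ?_
  filter_upwards [ae_norm_eq_sphereSurfaceMeasure hr.le] with y hy
  rw [← sub_mul, norm_mul, Real.norm_eq_abs, Real.norm_eq_abs]
  have h3 : |τ * inner ℝ x y| ≤ |τ| * r ^ 2 := by
    rw [abs_mul]
    exact mul_le_mul_of_nonneg_left (abs_inner_le_of_norm_eq hx hy) (abs_nonneg _)
  refine mul_le_mul_of_nonneg_right ?_ (abs_nonneg _)
  exact (abs_exp_sub_quadratic_le (h3.trans hτ)).trans (pow_le_pow_left₀ (abs_nonneg _) h3 3)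

theorem abs_bilinear_exp_sub_le {r τ : ℝ} (hr : 0 < r) (hτ : |τ| * r ^ 2 ≤ 1) {f : 𝔼 → ℝ}
    (hf : Continuous f) (h0 : ∫ x, f x ∂sphereSurfaceMeasure n r = 0)
    (h1 : ∀ v, ∫ x, inner ℝ v x * f x ∂sphereSurfaceMeasure n r = 0)
    (h2 : ∫ x, f x ^ 2 ∂sphereSurfaceMeasure n r = 1) :
    |(∫ x, f x * (∫ y, Real.exp (τ * inner ℝ x y) * f y ∂sphereSurfaceMeasure n r)
      ∂sphereSurfaceMeasure n r) - τ ^ 2 / 2 * hilbertSchmidtSq (momentOperator r f)| ≤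
      (|τ| * r ^ 2) ^ 3 * (sphereSurfaceMeasure n r).real univ := by
  have hint : ∀ {g : 𝔼 → ℝ}, Continuous g → Integrable g (sphereSurfaceMeasure n r) := fun hg =>
    integrable_sphereSurfaceMeasure hr.le hg
  have hi : Integrable (fun x => f x *
      (∫ y, Real.exp (τ * inner ℝ x y) * f y ∂sphereSurfaceMeasure n r))
      (sphereSurfaceMeasure n r) := by
    have h3 : Integrable (fun p : 𝔼 × 𝔼 => f p.1 * (Real.exp (τ * inner ℝ p.1 p.2) * f p.2))
        ((sphereSurfaceMeasure n r).prod (sphereSurfaceMeasure n r)) :=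
      integrable_prod_of_continuous (ae_norm_le_sphere hr.le) (ae_norm_le_sphere hr.le)
        (by fun_prop)
    have h4 := h3.integral_prod_left
    simpa only [integral_const_mul] using h4
  have hi2 : Integrable (fun x => τ ^ 2 / 2 * (inner ℝ (momentOperator r f x) x * f x))
      (sphereSurfaceMeasure n r) := hint (by fun_prop)
  set m := ∫ y, |f y| ∂sphereSurfaceMeasure n r with hm
  -- Cauchy-Schwarz with `∫ f² = 1` bounds the error independently of `f`, so the threshold for `ρ`
  -- can depend on `n` and `r` alone.
  have hm2 : m ^ 2 ≤ (sphereSurfaceMeasure n r).real univ := by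
    have h3 := sq_integral_mul_le hr.le (f := fun x : 𝔼 => |f x|) (g := fun _ => (1 : ℝ))
      (by fun_prop) (by fun_prop)
    simpa [sq_abs, h2] using h3
  have h5 : |(∫ x, f x * (∫ y, Real.exp (τ * inner ℝ x y) * f y ∂sphereSurfaceMeasure n r)
      ∂sphereSurfaceMeasure n r) - τ ^ 2 / 2 * hilbertSchmidtSq (momentOperator r f)| ≤
      ∫ x, ((|τ| * r ^ 2) ^ 3 * m) * |f x| ∂sphereSurfaceMeasure n r := by
    rw [hilbertSchmidtSq_momentOperator hr.le hf, ← integral_const_mul, ← integral_sub hi hi2,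
      ← Real.norm_eq_abs]
    refine norm_integral_le_of_norm_le ((hint (by fun_prop)).const_mul _) ?_
    filter_upwards [ae_norm_eq_sphereSurfaceMeasure hr.le] with x hx
    have h6 := abs_integral_mul_exp_sub_le hr hτ hf h0 h1 hx
    rw [mul_comm (inner ℝ _ _) (f x), mul_left_comm, ← mul_sub, norm_mul, mul_comm,
      Real.norm_eq_abs, Real.norm_eq_abs]
    exact mul_le_mul_of_nonneg_right h6 (abs_nonneg _)
  refine h5.trans ?_
  rw [integral_const_mul, ← hm, mul_assoc, ← sq]
  exact mul_le_mul_of_nonneg_left hm2 (by positivity)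

/-- The constant term of the exponential contributes the vanishing first moment, and the linear term
the second moment `r³ V`. -/
theorem abs_integral_inner_mul_exp_sub_le [NeZero n] {r τ : ℝ} (hr : 0 < r)
    (hτ : |τ| * r ^ 2 ≤ 1) {x : 𝔼} (hx : ‖x‖ = r) :
    |(∫ y, inner ℝ x y * Real.exp (τ * inner ℝ x y) ∂sphereSurfaceMeasure n r) -
      τ * (r ^ 3 * volume.real (Metric.ball (0 : 𝔼) r))| ≤
      r ^ 2 * (|τ| * r ^ 2) ^ 2 * (sphereSurfaceMeasure n r).real univ := by
  have hint : ∀ {g : 𝔼 → ℝ}, Continuous g → Integrable g (sphereSurfaceMeasure n r) := fun hg =>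
    integrable_sphereSurfaceMeasure hr.le hg
  have e1 : τ * (r ^ 3 * volume.real (Metric.ball (0 : 𝔼) r)) =
      ∫ y, inner ℝ x y * (1 + τ * inner ℝ x y) ∂sphereSurfaceMeasure n r := by
    have e2 : ∀ y : 𝔼, inner ℝ x y * (1 + τ * inner ℝ x y) =
        inner ℝ x y + τ * (inner ℝ x y * inner ℝ x y) := fun y => by ring
    simp only [e2]
    rw [integral_add (hint (by fun_prop)) (hint (by fun_prop)), integral_const_mul,
      integral_sphere_inner _ hr, integral_sphere_inner_mul_inner _ _ hr,
      real_inner_self_eq_norm_sq, hx]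
    ring
  rw [e1, ← integral_sub (hint (by fun_prop)) (hint (by fun_prop)), ← Real.norm_eq_abs]
  have h4 : ∫ _y : 𝔼, r ^ 2 * (|τ| * r ^ 2) ^ 2 ∂sphereSurfaceMeasure n r =
      r ^ 2 * (|τ| * r ^ 2) ^ 2 * (sphereSurfaceMeasure n r).real univ := by
    rw [integral_const, smul_eq_mul, mul_comm]
  rw [← h4]
  refine norm_integral_le_of_norm_le (integrable_const _) ?_
  filter_upwards [ae_norm_eq_sphereSurfaceMeasure hr.le] with y hy
  rw [← mul_sub, norm_mul, Real.norm_eq_abs, Real.norm_eq_abs]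
  have h2 := abs_inner_le_of_norm_eq hx hy
  have h3 : |τ * inner ℝ x y| ≤ |τ| * r ^ 2 := by
    rw [abs_mul]
    exact mul_le_mul_of_nonneg_left h2 (abs_nonneg _)
  refine mul_le_mul h2 ?_ (abs_nonneg _) (by positivity)
  have h5 := Real.abs_exp_sub_one_sub_id_le (h3.trans hτ)
  rw [sub_sub] at h5
  refine h5.trans ?_
  rw [← sq_abs]
  exact pow_le_pow_left₀ (abs_nonneg _) h3 2

/-- The size of the error in the expansion of the second variation at zero correlation. -/
noncomputable def expansionConst (n : ℕ) (r : ℝ) : ℝ :=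
  r * volume.real (Metric.ball (0 : EuclideanSpace ℝ (Fin n)) r) +
    2 * ((r ^ 6 + r ^ 4) * (sphereSurfaceMeasure n r).real univ)

theorem expansionConst_nonneg {r : ℝ} (hr : 0 < r) : 0 ≤ expansionConst n r := by
  unfold expansionConst; positivity

theorem abs_sphereForm_sub_le [NeZero n] {r ρ : ℝ} (hr : 0 < r) (hρ : |ρ| ≤ 1 / 2)
    (hρr : 2 * |ρ| * r ^ 2 ≤ 1) {f : 𝔼 → ℝ}
    (hf : Continuous f) (h0 : ∫ x, f x ∂sphereSurfaceMeasure n r = 0)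
    (h1 : ∀ v, ∫ x, inner ℝ v x * f x ∂sphereSurfaceMeasure n r = 0)
    (h2 : ∫ x, f x ^ 2 ∂sphereSurfaceMeasure n r = 1) {x₀ : 𝔼} (hx₀ : ‖x₀‖ = r) :
    |sphereForm n r ρ (ρ / (1 - ρ ^ 2)) x₀ f - (ρ / (1 - ρ ^ 2)) ^ 2 *
      (hilbertSchmidtSq (momentOperator r f) / 2 - r * volume.real (Metric.ball (0 : 𝔼) r))| ≤
      (ρ / (1 - ρ ^ 2)) ^ 2 * (|ρ| * expansionConst n r) := by
  have hρ2 : ρ ^ 2 ≤ |ρ| / 2 := by rw [← sq_abs]; nlinarith [abs_nonneg ρ]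
  have hσ : 0 < 1 - ρ ^ 2 := by linarith
  set τ := ρ / (1 - ρ ^ 2) with hτ
  have hρτ : ρ = τ * (1 - ρ ^ 2) := by rw [hτ]; field_simp
  have habs : |ρ| = |τ| * (1 - ρ ^ 2) := by
    conv_lhs => rw [hρτ]
    rw [abs_mul, abs_of_pos hσ]
  have hτ2 : |τ| ≤ 2 * |ρ| := by rw [habs]; nlinarith [abs_nonneg τ]
  have hτr : |τ| * r ^ 2 ≤ 1 := (mul_le_mul_of_nonneg_right hτ2 (by positivity)).trans hρr
  have hρle : |ρ| ≤ |τ| := by rw [habs]; nlinarith [abs_nonneg τ, sq_nonneg ρ]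
  set V := volume.real (Metric.ball (0 : 𝔼) r) with hV
  set S := (sphereSurfaceMeasure n r).real univ with hS
  have hV0 : 0 ≤ V := measureReal_nonneg
  have hS0 : 0 ≤ S := measureReal_nonneg
  have a1 := abs_bilinear_exp_sub_le hr hτr hf h0 h1 h2
  have a2 := abs_integral_inner_mul_exp_sub_le hr hτr hx₀
  rw [sphereForm]
  set I := ∫ x, f x * (∫ y, Real.exp (τ * inner ℝ x y) * f y ∂sphereSurfaceMeasure n r)
      ∂sphereSurfaceMeasure n r
  set J := ∫ y, inner ℝ x₀ y * Real.exp (τ * inner ℝ x₀ y) ∂sphereSurfaceMeasure n r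
  set W := hilbertSchmidtSq (momentOperator r f)
  -- Since `ρ τ = τ² (1 - ρ²)`, replacing `ρ τ` by `τ²` in the leading term leaves the remainder `τ²
  -- ρ² r V`.
  have e : I - ρ / r ^ 2 * J - τ ^ 2 * (W / 2 - r * V) =
      (I - τ ^ 2 / 2 * W) + (-(ρ / r ^ 2)) * (J - τ * (r ^ 3 * V)) + τ ^ 2 * (ρ ^ 2 * (r * V)) := by
    have : ρ / r ^ 2 * (τ * (r ^ 3 * V)) = τ ^ 2 * (1 - ρ ^ 2) * (r * V) := by
      nth_rewrite 1 [hρτ]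
      field_simp
    linear_combination -this
  have b2 : |(-(ρ / r ^ 2)) * (J - τ * (r ^ 3 * V))| ≤ τ ^ 2 * (|ρ| * (r ^ 4 * S)) := by
    rw [abs_mul, abs_neg, abs_div, abs_of_pos (show 0 < r ^ 2 by positivity)]
    refine (mul_le_mul_of_nonneg_left a2 (by positivity)).trans (le_of_eq ?_)
    rw [← sq_abs τ, ← hS]
    field_simp
  have b1 : (|τ| * r ^ 2) ^ 3 * S ≤ τ ^ 2 * (2 * |ρ| * (r ^ 6 * S)) := by
    have : (|τ| * r ^ 2) ^ 3 * S = τ ^ 2 * (|τ| * (r ^ 6 * S)) := by rw [← sq_abs τ]; ring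
    rw [this]
    exact mul_le_mul_of_nonneg_left (mul_le_mul_of_nonneg_right hτ2 (by positivity))
      (sq_nonneg _)
  have b3 : |τ ^ 2 * (ρ ^ 2 * (r * V))| ≤ τ ^ 2 * (|ρ| * (r * V)) := by
    rw [abs_of_nonneg (by positivity)]
    refine mul_le_mul_of_nonneg_left (mul_le_mul_of_nonneg_right ?_ (by positivity)) (sq_nonneg _)
    linarith [abs_nonneg ρ]
  rw [e]
  refine (abs_add_three _ _ _).trans ?_
  -- The three errors use only one of the two copies of `r⁴ S` in the constant; the other is spare.
  have : τ ^ 2 * (|ρ| * expansionConst n r) = τ ^ 2 * (2 * |ρ| * (r ^ 6 * S)) +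
      τ ^ 2 * (|ρ| * (r ^ 4 * S)) + τ ^ 2 * (|ρ| * (r * V)) + τ ^ 2 * (|ρ| * (r ^ 4 * S)) := by
    rw [expansionConst]; ring
  rw [this]
  have : 0 ≤ τ ^ 2 * (|ρ| * (r ^ 4 * S)) := by positivity
  linarith [a1.trans b1]

/-- The left side is the coefficient of `τ²` at the extremal Hilbert-Schmidt norm; for positive `r`
and `V` its sign is that of `r² - (n + 2)`. -/
theorem half_moment_sub_eq (n : ℕ) (r V : ℝ) :
    r ^ 3 * V / (n + 2) - r * V = -((n + 2 - r ^ 2) * (r * V / (n + 2))) := by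
  have : (n : ℝ) + 2 ≠ 0 := by positivity
  field_simp
  ring

/-- For correlations below a threshold the expansion error is dominated by a given gap. -/
theorem exists_correlation_threshold (n : ℕ) {r d : ℝ} (hr : 0 < r) (hd : 0 < d) :
    ∃ ρ₀ : ℝ, 0 < ρ₀ ∧ ∀ ρ : ℝ, |ρ| < ρ₀ →
      |ρ| ≤ 1 / 2 ∧ 2 * |ρ| * r ^ 2 ≤ 1 ∧ |ρ| * expansionConst n r < d := by
  have hK := expansionConst_nonneg (n := n) hr
  -- The `+ 1` keeps the denominator positive when the constant is known only to be nonnegative.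
  refine ⟨min (1 / 2) (min (1 / (2 * r ^ 2)) (d / (expansionConst n r + 1))), by positivity,
    fun ρ hρ => ?_⟩
  obtain ⟨h1, h2, h3⟩ := by simpa only [lt_min_iff] using hρ
  refine ⟨h1.le, ?_, ?_⟩
  · rw [lt_div_iff₀ (by positivity)] at h2
    linarith
  · rw [lt_div_iff₀ (by positivity)] at h3
    nlinarith [abs_nonneg ρ]

theorem sphereForm_neg [NeZero n] {r : ℝ} (hr : 0 < r) (hrn : r ^ 2 < (n : ℝ) + 2) :
    ∃ ρ₀ : ℝ, 0 < ρ₀ ∧ ∀ ρ : ℝ, 0 < |ρ| → |ρ| < ρ₀ → |ρ| < 1 ∧ ∀ f : 𝔼 → ℝ, Continuous f →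
      ∫ x, f x ∂sphereSurfaceMeasure n r = 0 →
      (∀ v, ∫ x, inner ℝ v x * f x ∂sphereSurfaceMeasure n r = 0) →
      ∫ x, f x ^ 2 ∂sphereSurfaceMeasure n r = 1 → ∀ x₀ : 𝔼, ‖x₀‖ = r →
      sphereForm n r ρ (ρ / (1 - ρ ^ 2)) x₀ f < 0 := by
  set V := volume.real (Metric.ball (0 : 𝔼) r) with hV
  have hV0 : 0 < V :=
    ENNReal.toReal_pos (Metric.measure_ball_pos _ _ hr).ne' measure_ball_lt_top.ne
  obtain ⟨ρ₀, hρ₀, h⟩ := exists_correlation_threshold n hr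
    (show 0 < (n + 2 - r ^ 2) * (r * V / (n + 2)) from mul_pos (by linarith) (by positivity))
  refine ⟨ρ₀, hρ₀, fun ρ hρ hρlt => ?_⟩
  obtain ⟨k1, k2, k3⟩ := h ρ hρlt
  refine ⟨by linarith, fun f hf h0 h1 h2 x₀ hx₀ => ?_⟩
  have a1 := (abs_le.1 (abs_sphereForm_sub_le hr k1 k2 hf h0 h1 h2 hx₀)).2
  have a2 := hilbertSchmidtSq_momentOperator_le hr hf h0 h2
  have a3 := half_moment_sub_eq n r V
  have hτ : 0 < (ρ / (1 - ρ ^ 2)) ^ 2 := by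
    have h4 : ρ ≠ 0 := abs_pos.1 hρ
    have h5 : 0 < 1 - ρ ^ 2 := by rw [← sq_abs]; nlinarith [abs_nonneg ρ]
    positivity
  have a4 : hilbertSchmidtSq (momentOperator r f) / 2 - r * V + |ρ| * expansionConst n r < 0 := by
    linarith
  nlinarith [mul_neg_of_pos_of_neg hτ a4]

theorem sphereForm_pos [NeZero n] {r : ℝ} (hr : 0 < r) (hrn : (n : ℝ) + 2 < r ^ 2) :
    ∃ ρ₀ : ℝ, 0 < ρ₀ ∧ ∀ ρ : ℝ, 0 < |ρ| → |ρ| < ρ₀ → |ρ| < 1 ∧ ∀ f : 𝔼 → ℝ, Continuous f →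
      ∫ x, f x ∂sphereSurfaceMeasure n r = 0 →
      (∀ v, ∫ x, inner ℝ v x * f x ∂sphereSurfaceMeasure n r = 0) →
      ∫ x, f x ^ 2 ∂sphereSurfaceMeasure n r = 1 → ∀ T : 𝔼 →L[ℝ] 𝔼,
      (T : 𝔼 →ₗ[ℝ] 𝔼).IsSymmetric → LinearMap.trace ℝ 𝔼 (T : 𝔼 →ₗ[ℝ] 𝔼) = 0 →
      (∀ x : 𝔼, ‖x‖ = r → f x = inner ℝ (T x) x) → ∀ x₀ : 𝔼, ‖x₀‖ = r →
      0 < sphereForm n r ρ (ρ / (1 - ρ ^ 2)) x₀ f := by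
  set V := volume.real (Metric.ball (0 : 𝔼) r) with hV
  have hV0 : 0 < V :=
    ENNReal.toReal_pos (Metric.measure_ball_pos _ _ hr).ne' measure_ball_lt_top.ne
  obtain ⟨ρ₀, hρ₀, h⟩ := exists_correlation_threshold n hr
    (show 0 < (r ^ 2 - (n + 2)) * (r * V / (n + 2)) from mul_pos (by linarith) (by positivity))
  refine ⟨ρ₀, hρ₀, fun ρ hρ hρlt => ?_⟩
  obtain ⟨k1, k2, k3⟩ := h ρ hρlt
  refine ⟨by linarith, fun f hf h0 h1 h2 T hT htr hfT x₀ hx₀ => ?_⟩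
  have a1 := (abs_le.1 (abs_sphereForm_sub_le hr k1 k2 hf h0 h1 h2 hx₀)).1
  have a2 := hilbertSchmidtSq_momentOperator_ge hr hf hT htr hfT h2
  have a3 := half_moment_sub_eq n r V
  have hτ : 0 < (ρ / (1 - ρ ^ 2)) ^ 2 := by
    have h4 : ρ ≠ 0 := abs_pos.1 hρ
    have h5 : 0 < 1 - ρ ^ 2 := by rw [← sq_abs]; nlinarith [abs_nonneg ρ]
    positivity
  have a4 : 0 < hilbertSchmidtSq (momentOperator r f) / 2 - r * V - |ρ| * expansionConst n r := by
    linarith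
  nlinarith [mul_pos hτ a4]

end SmallCorrelation

/-! ### Calculus of second derivatives at a point -/

section SecondDerivative

theorem HasSecondDerivAt.congr_of_eventuallyEq {f g : ℝ → ℝ} {d t : ℝ} (h : HasSecondDerivAt f d t)
    (hfg : g =ᶠ[𝓝 t] f) : HasSecondDerivAt g d t := by
  obtain ⟨f', h1, h2⟩ := h
  refine ⟨f', ?_, h2⟩
  filter_upwards [h1, hfg.eventuallyEq_nhds] with s hs hs' using hs.congr_of_eventuallyEq hs'

theorem HasSecondDerivAt.add {f g : ℝ → ℝ} {c d t : ℝ} (hf : HasSecondDerivAt f c t)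
    (hg : HasSecondDerivAt g d t) : HasSecondDerivAt (fun s => f s + g s) (c + d) t := by
  obtain ⟨f', h1, h2⟩ := hf
  obtain ⟨g', h3, h4⟩ := hg
  refine ⟨fun s => f' s + g' s, ?_, h2.add h4⟩
  filter_upwards [h1, h3] with s hs hs' using hs.add hs'

theorem HasSecondDerivAt.const_sub_const_mul {f : ℝ → ℝ} {d t : ℝ} (hf : HasSecondDerivAt f d t)
    (a b : ℝ) : HasSecondDerivAt (fun s => a - b * f s) (-(b * d)) t := by
  obtain ⟨f', h1, h2⟩ := hf
  refine ⟨fun s => -(b * f' s), ?_, (h2.const_mul b).neg⟩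
  filter_upwards [h1] with s hs using (hs.const_mul b).const_sub a

theorem HasSecondDerivAt.unique {f : ℝ → ℝ} {c d t : ℝ} (hc : HasSecondDerivAt f c t)
    (hd : HasSecondDerivAt f d t) : c = d := by
  obtain ⟨f', h1, h2⟩ := hc
  obtain ⟨g', h3, h4⟩ := hd
  refine h2.unique (h4.congr_of_eventuallyEq ?_)
  filter_upwards [h1, h3] with s hs hs' using hs.unique hs'

/-- The strict second derivative test. -/
theorem HasSecondDerivAt.eventually_lt {f : ℝ → ℝ} {d t : ℝ} (h0 : HasDerivAt f 0 t)
    (h : HasSecondDerivAt f d t) (hd : d < 0) : ∀ᶠ s in 𝓝[≠] t, f s < f t := by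
  obtain ⟨f', h1, h2⟩ := h
  have hf't : f' t = 0 := h1.self_of_nhds.unique h0
  -- As `f'` vanishes at `t` with negative slopes, it is positive just before `t` and negative just
  -- after; the mean value theorem then compares `f s` with `f t` on either side.
  have h3 : ∀ᶠ s in 𝓝[≠] t, slope f' t s < 0 :=
    (hasDerivAt_iff_tendsto_slope.1 h2).eventually (gt_mem_nhds hd)
  have h4 : ∀ᶠ s in 𝓝 t, HasDerivAt f (f' s) s ∧ (s ≠ t → slope f' t s < 0) :=
    h1.and (eventually_nhdsWithin_iff.1 h3)
  obtain ⟨ε, hε, hball⟩ := Metric.eventually_nhds_iff_ball.1 h4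
  refine eventually_nhdsWithin_iff.2 ?_
  filter_upwards [Metric.ball_mem_nhds t hε] with s hs hst
  rw [Real.ball_eq_Ioo] at hs hball
  have ht : t ∈ Ioo (t - ε) (t + ε) := ⟨by linarith, by linarith⟩
  rcases lt_or_gt_of_ne hst with hlt | hgt
  · have hsub : Icc s t ⊆ Ioo (t - ε) (t + ε) := Icc_subset_Ioo hs.1 ht.2
    obtain ⟨u, hu, hu'⟩ := exists_hasDerivAt_eq_slope f f' hlt
      (fun v hv => (hball v (hsub hv)).1.continuousAt.continuousWithinAt)
      (fun v hv => (hball v (hsub (Ioo_subset_Icc_self hv))).1)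
    have h5 := (hball u (hsub (Ioo_subset_Icc_self hu))).2 hu.2.ne
    rw [slope_def_field, hf't, sub_zero, div_neg_iff] at h5
    have h6 : 0 < f' u := by rcases h5 with h5 | h5 <;> linarith [hu.2, h5.1, h5.2]
    rw [hu', div_pos_iff] at h6
    rcases h6 with h6 | h6 <;> linarith [h6.1, h6.2]
  · have hsub : Icc t s ⊆ Ioo (t - ε) (t + ε) := Icc_subset_Ioo ht.1 hs.2
    obtain ⟨u, hu, hu'⟩ := exists_hasDerivAt_eq_slope f f' hgt
      (fun v hv => (hball v (hsub hv)).1.continuousAt.continuousWithinAt)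
      (fun v hv => (hball v (hsub (Ioo_subset_Icc_self hv))).1)
    have h5 := (hball u (hsub (Ioo_subset_Icc_self hu))).2 hu.1.ne'
    rw [slope_def_field, hf't, sub_zero, div_neg_iff] at h5
    have h6 : f' u < 0 := by rcases h5 with h5 | h5 <;> linarith [hu.1, h5.1, h5.2]
    rw [hu', div_neg_iff] at h6
    rcases h6 with h6 | h6 <;> linarith [h6.1, h6.2]

theorem HasSecondDerivAt.eventually_gt {f : ℝ → ℝ} {d t : ℝ} (h0 : HasDerivAt f 0 t)
    (h : HasSecondDerivAt f d t) (hd : 0 < d) : ∀ᶠ s in 𝓝[≠] t, f t < f s := by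
  have h1 : HasSecondDerivAt (fun s => 0 - 1 * f s) (-(1 * d)) t := h.const_sub_const_mul 0 1
  have h2 : HasDerivAt (fun s => 0 - 1 * f s) 0 t := by
    simpa using (h0.const_mul 1).const_sub 0
  filter_upwards [h1.eventually_lt h2 (by linarith)] with s hs
  linarith

end SecondDerivative

/-! ### Symmetric variations and their complements -/

section SymmetricVariation

variable {n : ℕ}

local notation "𝔼" => EuclideanSpace ℝ (Fin n)

variable {X : EuclideanSpace ℝ (Fin n) → EuclideanSpace ℝ (Fin n)}
  {Ψ : EuclideanSpace ℝ (Fin n) → ℝ → EuclideanSpace ℝ (Fin n)}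

theorem IsSmoothFlow.isSmoothLocalFlow (h : IsSmoothFlow X Ψ) : IsSmoothLocalFlow X Ψ :=
  ⟨h.smooth_field, h.smooth_flow, h.initial, h.ode⟩

theorem IsSmoothFlow.flowSet_zero (h : IsSmoothFlow X Ψ) (A : Set 𝔼) : flowSet Ψ A 0 = A := by
  simp [flowSet, h.initial]

theorem IsSmoothFlow.flowSet_compl (h : IsSmoothFlow X Ψ) (A : Set 𝔼) {t : ℝ}
    (ht : t ∈ Ioo (-1 : ℝ) 1) : flowSet Ψ Aᶜ t = (flowSet Ψ A t)ᶜ :=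
  image_compl_eq (h.isSmoothLocalFlow.bijective ht)

theorem IsSmoothFlow.measurableSet_flowSet (h : IsSmoothFlow X Ψ) {A : Set 𝔼}
    (hA : MeasurableSet A) {t : ℝ} (ht : t ∈ Ioo (-1 : ℝ) 1) : MeasurableSet (flowSet Ψ A t) :=
  h.isSmoothLocalFlow.measurableSet_image ht hA

theorem eventually_mem_Ioo_one : ∀ᶠ t in 𝓝 (0 : ℝ), t ∈ Ioo (-1 : ℝ) 1 :=
  Ioo_mem_nhds (by norm_num) (by norm_num)

theorem IsSmoothFlow.gaussianMeasure_flowSet_compl (h : IsSmoothFlow X Ψ) {A : Set 𝔼}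
    (hA : MeasurableSet A) {t : ℝ} (ht : t ∈ Ioo (-1 : ℝ) 1) :
    (gaussianMeasure n).real (flowSet Ψ Aᶜ t) = 1 - 1 * (gaussianMeasure n).real (flowSet Ψ A t) := by
  rw [h.flowSet_compl A ht, probReal_compl_eq_one_sub (h.measurableSet_flowSet hA ht), one_mul]

theorem IsSymmetricVariation.compl {r : ℝ} {A : Set 𝔼} (hA : MeasurableSet A)
    (h : IsSymmetricVariation r A X Ψ) : IsSymmetricVariation r Aᶜ X Ψ where
  flow := h.flow
  symmetric t ht x := by
    rw [h.flow.flowSet_compl A ht, mem_compl_iff, mem_compl_iff, not_iff_not]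
    exact h.symmetric t ht x
  normalized := h.normalized
  first_order := by
    have h1 := (h.first_order.const_mul 1).const_sub 1
    rw [mul_zero, neg_zero] at h1
    refine h1.congr_of_eventuallyEq ?_
    filter_upwards [eventually_mem_Ioo_one] with t ht
    exact h.flow.gaussianMeasure_flowSet_compl hA ht
  second_order := by
    have h1 := h.second_order.const_sub_const_mul 1 1
    rw [mul_zero, neg_zero] at h1
    refine h1.congr_of_eventuallyEq ?_
    filter_upwards [eventually_mem_Ioo_one] with t ht
    exact h.flow.gaussianMeasure_flowSet_compl hA ht

theorem hasDerivAt_gaussianMeasure_flowSet (h : IsSmoothFlow X Ψ) {r : ℝ} {t : ℝ}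
    (ht : t ∈ Ioo (-1 : ℝ) 1) :
    HasDerivAt (fun t => (gaussianMeasure n).real (flowSet Ψ (Metric.ball 0 r) t))
      (∫ x in flowSet Ψ (Metric.ball 0 r) t, transportDeriv X (gaussianDensity n) x) t := by
  refine (h.isSmoothLocalFlow.hasDerivAt_integral_image volume contDiff_gaussianDensity
    Metric.isBounded_ball measurableSet_ball ht).congr_of_eventuallyEq ?_
  filter_upwards [Ioo_mem_nhds ht.1 ht.2] with s hs
  exact gaussianMeasure_real_eq (h.measurableSet_flowSet measurableSet_ball hs)

theorem hasSecondDerivAt_gaussianMeasure_flowSet (h : IsSmoothFlow X Ψ) {r : ℝ} :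
    HasSecondDerivAt (fun t => (gaussianMeasure n).real (flowSet Ψ (Metric.ball 0 r) t))
      (∫ x in Metric.ball 0 r, transportDeriv X (transportDeriv X (gaussianDensity n)) x) 0 := by
  refine (h.isSmoothLocalFlow.hasSecondDerivAt_integral_image volume contDiff_gaussianDensity
    Metric.isBounded_ball measurableSet_ball).congr_of_eventuallyEq ?_
  filter_upwards [eventually_mem_Ioo_one] with s hs
  exact gaussianMeasure_real_eq (h.measurableSet_flowSet measurableSet_ball hs)

/-! ### Constraints on the normal component and local maximality -/

section BallFacts

variable [NeZero n] {r : ℝ}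

omit [NeZero n] in
theorem integral_normalComponent_sq (X : 𝔼 → 𝔼) (hr : 0 < r) :
    ∫ x, normalComponent r X x ^ 2 ∂sphereSurfaceMeasure n r =
      ∫ x, (inner ℝ (X x) (‖x‖⁻¹ • x)) ^ 2 ∂sphereSurfaceMeasure n r := by
  refine integral_congr_ae ?_
  filter_upwards [ae_norm_eq_sphereSurfaceMeasure hr.le] with x hx
  rw [normalComponent, hx, real_inner_smul_right]

theorem IsSymmetricVariation.integral_normalComponent
    (h : IsSymmetricVariation r (Metric.ball 0 r) X Ψ) (hr : 0 < r) :
    ∫ x, normalComponent r X x ∂sphereSurfaceMeasure n r = 0 := by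
  have h1 := hasDerivAt_gaussianMeasure_flowSet h.flow (r := r) (t := 0) (by simp)
  have h2 := h1.unique h.first_order
  rw [h.flow.flowSet_zero,
    setIntegral_ball_transportDeriv_gaussianDensity h.flow.smooth_field hr] at h2
  exact (mul_eq_zero.1 h2).resolve_left (by positivity)

theorem IsSymmetricVariation.integral_normalComponent_mul
    (h : IsSymmetricVariation r (Metric.ball 0 r) X Ψ) (hr : 0 < r) :
    ∫ x, normalComponent r X x * (vdiv X x - inner ℝ (X x) x) ∂sphereSurfaceMeasure n r = 0 := by
  have h2 := (hasSecondDerivAt_gaussianMeasure_flowSet h.flow (r := r)).unique h.second_order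
  rw [setIntegral_ball_transportDeriv_transportDeriv_gaussianDensity h.flow.smooth_field hr] at h2
  exact (mul_eq_zero.1 h2).resolve_left (by positivity)

omit [NeZero n] in
theorem setIntegral_inner_eq_zero_of_symmetric {A : Set 𝔼} (hA : ∀ x, x ∈ A ↔ -x ∈ A) (v : 𝔼) :
    ∫ x in A, inner ℝ v x = 0 := by
  have h1 := (LinearIsometryEquiv.neg ℝ (E := 𝔼)).measurePreserving.setIntegral_preimage_emb
    (LinearIsometryEquiv.neg ℝ (E := 𝔼)).toHomeomorph.measurableEmbedding
    (fun x : 𝔼 => (inner ℝ v x : ℝ)) A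
  have h2 : (LinearIsometryEquiv.neg ℝ (E := 𝔼)) ⁻¹' A = A := by
    ext x
    simpa using (hA x).symm
  rw [h2] at h1
  simp only [LinearIsometryEquiv.coe_neg, inner_neg_right, integral_neg] at h1
  linarith

/-- The first moments of the symmetric sets vanish at all times; differentiating at time zero gives
a sphere integral by the divergence theorem. -/
theorem IsSymmetricVariation.integral_inner_mul_normalComponent
    (h : IsSymmetricVariation r (Metric.ball 0 r) X Ψ) (hr : 0 < r) (v : 𝔼) :
    ∫ x, inner ℝ v x * normalComponent r X x ∂sphereSurfaceMeasure n r = 0 := by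
  have hv : ContDiff ℝ ∞ fun x : 𝔼 => (inner ℝ v x : ℝ) := (innerSL ℝ v).contDiff
  have h1 := h.flow.isSmoothLocalFlow.hasDerivAt_integral_image_zero volume hv
    (Metric.isBounded_ball (x := 0) (r := r)) measurableSet_ball
  rw [integral_ball_transportDeriv h.flow.smooth_field hv hr] at h1
  refine h1.unique ((hasDerivAt_const (0 : ℝ) (0 : ℝ)).congr_of_eventuallyEq ?_)
  filter_upwards [eventually_mem_Ioo_one] with t ht
  exact setIntegral_inner_eq_zero_of_symmetric (h.symmetric t ht) v

theorem noiseStability_variation_ball (h : IsSymmetricVariation r (Metric.ball 0 r) X Ψ)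
    (hr : 0 < r) {ρ : ℝ} (hρ : |ρ| < 1) {x₀ : 𝔼} (hx₀ : ‖x₀‖ = r) :
    HasDerivAt (fun t => noiseStability n ρ (flowSet Ψ (Metric.ball 0 r) t)) 0 0 ∧
      HasSecondDerivAt (fun t => noiseStability n ρ (flowSet Ψ (Metric.ball 0 r) t))
        (2 * mehlerSphereConst n ρ r *
          sphereForm n r ρ (ρ / (1 - ρ ^ 2)) x₀ (normalComponent r X)) 0 := by
  have hflow := h.flow.isSmoothLocalFlow.double
  have hk := contDiff_mehlerKernel (n := n) ρ
  have hb : Bornology.IsBounded (Metric.ball (0 : 𝔼) r ×ˢ Metric.ball (0 : 𝔼) r) :=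
    Metric.isBounded_ball.prod Metric.isBounded_ball
  have hm : MeasurableSet (Metric.ball (0 : 𝔼) r ×ˢ Metric.ball (0 : 𝔼) r) :=
    measurableSet_ball.prod measurableSet_ball
  have hX := h.flow.smooth_field
  have heq : (fun t => noiseStability n ρ (flowSet Ψ (Metric.ball 0 r) t)) =ᶠ[𝓝 0] fun t =>
      ∫ p in (fun p => doubleFlow Ψ p t) '' (Metric.ball 0 r ×ˢ Metric.ball 0 r),
        mehlerKernel n ρ p ∂((volume : Measure 𝔼).prod volume) := by
    filter_upwards [eventually_mem_Ioo_one] with t ht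
    rw [noiseStability_eq_setIntegral hρ (h.flow.measurableSet_flowSet measurableSet_ball ht),
      image_doubleFlow]
    rfl
  constructor
  · have h1 := hflow.hasDerivAt_integral_image_zero ((volume : Measure 𝔼).prod volume) hk hb hm
    rw [first_variation_ball hX ρ hr (h.integral_normalComponent hr)] at h1
    exact h1.congr_of_eventuallyEq heq
  · have h1 := hflow.hasSecondDerivAt_integral_image ((volume : Measure 𝔼).prod volume) hk hb hm
    rw [second_variation_ball hX hρ hr hx₀
      ((integral_normalComponent_sq X hr).trans h.normalized)
      (h.integral_normalComponent_mul hr)] at h1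
    exact h1.congr_of_eventuallyEq heq

omit [NeZero n] in
theorem noiseStability_variation_compl {A : Set 𝔼} (hA : MeasurableSet A)
    (h : IsSymmetricVariation r A X Ψ) {ρ : ℝ} (hρ : |ρ| < 1) {d : ℝ}
    (h1 : HasDerivAt (fun t => noiseStability n ρ (flowSet Ψ A t)) 0 0)
    (h2 : HasSecondDerivAt (fun t => noiseStability n ρ (flowSet Ψ A t)) d 0) :
    HasDerivAt (fun t => noiseStability n ρ (flowSet Ψ Aᶜ t)) 0 0 ∧
      HasSecondDerivAt (fun t => noiseStability n ρ (flowSet Ψ Aᶜ t)) d 0 := by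
  have heq : (fun t => noiseStability n ρ (flowSet Ψ Aᶜ t)) =ᶠ[𝓝 0] fun t =>
      noiseStability n ρ (flowSet Ψ A t) +
        (1 - 2 * (gaussianMeasure n).real (flowSet Ψ A t)) := by
    filter_upwards [eventually_mem_Ioo_one] with t ht
    rw [h.flow.flowSet_compl A ht, noiseStability_compl hρ (h.flow.measurableSet_flowSet hA ht)]
  constructor
  · have h3 := h1.add ((h.first_order.const_mul 2).const_sub 1)
    rw [mul_zero, neg_zero, add_zero] at h3
    exact h3.congr_of_eventuallyEq heq
  · have h3 := h2.add (h.second_order.const_sub_const_mul 1 2)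
    rw [mul_zero, neg_zero, add_zero] at h3
    exact h3.congr_of_eventuallyEq heq

omit [NeZero n] in
theorem IsSymmetricVariation.ball_of_ball_or_compl {A : Set 𝔼}
    (hA : A = Metric.ball 0 r ∨ A = (Metric.ball 0 r)ᶜ) (h : IsSymmetricVariation r A X Ψ) :
    IsSymmetricVariation r (Metric.ball 0 r) X Ψ := by
  rcases hA with rfl | rfl
  · exact h
  · simpa using h.compl measurableSet_ball.compl

/-- The first two derivatives of noise stability along a symmetric variation of the ball or of its
complement. -/
theorem noiseStability_variation {A : Set 𝔼}
    (hA : A = Metric.ball 0 r ∨ A = (Metric.ball 0 r)ᶜ) (h : IsSymmetricVariation r A X Ψ)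
    (hr : 0 < r) {ρ : ℝ} (hρ : |ρ| < 1) {x₀ : 𝔼} (hx₀ : ‖x₀‖ = r) :
    HasDerivAt (fun t => noiseStability n ρ (flowSet Ψ A t)) 0 0 ∧
      HasSecondDerivAt (fun t => noiseStability n ρ (flowSet Ψ A t))
        (2 * mehlerSphereConst n ρ r *
          sphereForm n r ρ (ρ / (1 - ρ ^ 2)) x₀ (normalComponent r X)) 0 := by
  have hball := h.ball_of_ball_or_compl hA
  have h1 := noiseStability_variation_ball hball hr hρ hx₀
  rcases hA with rfl | rfl
  · exact h1
  · exact noiseStability_variation_compl measurableSet_ball hball hρ h1.1 h1.2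

theorem exists_norm_eq_of_nonneg (hr : 0 ≤ r) : ∃ x₀ : 𝔼, ‖x₀‖ = r :=
  ⟨EuclideanSpace.single 0 r, by simp [abs_of_nonneg hr]⟩

theorem exists_forall_symmetricVariation_noiseStability_lt (hr : 0 < r)
    (hrn : r ^ 2 < (n : ℝ) + 2) :
    ∃ ρ₀ : ℝ, 0 < ρ₀ ∧ ∀ ρ : ℝ, 0 < |ρ| → |ρ| < ρ₀ →
      ∀ A : Set 𝔼, (A = Metric.ball 0 r ∨ A = (Metric.ball 0 r)ᶜ) →
        ∀ (X : 𝔼 → 𝔼) (Ψ : 𝔼 → ℝ → 𝔼), IsSymmetricVariation r A X Ψ →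
          HasDerivAt (fun t => noiseStability n ρ (flowSet Ψ A t)) 0 0 ∧
          (∃ d : ℝ, d < 0 ∧
            HasSecondDerivAt (fun t => noiseStability n ρ (flowSet Ψ A t)) d 0) ∧
          (∀ᶠ t in 𝓝[≠] (0 : ℝ), noiseStability n ρ (flowSet Ψ A t) < noiseStability n ρ A) := by
  obtain ⟨ρ₀, hρ₀, H⟩ := sphereForm_neg hr hrn
  refine ⟨ρ₀, hρ₀, fun ρ hρ hρlt A hA X Ψ h => ?_⟩
  obtain ⟨hρ1, H⟩ := H ρ hρ hρlt
  obtain ⟨x₀, hx₀⟩ := exists_norm_eq_of_nonneg (n := n) hr.le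
  obtain ⟨h1, h2⟩ := noiseStability_variation hA h hr hρ1 hx₀
  have hball := h.ball_of_ball_or_compl hA
  have hneg := H (normalComponent r X) (continuous_normalComponent h.flow.smooth_field.continuous r)
    (hball.integral_normalComponent hr) (hball.integral_inner_mul_normalComponent hr)
    ((integral_normalComponent_sq X hr).trans h.normalized) x₀ hx₀
  have hd := mul_neg_of_pos_of_neg (mul_pos two_pos (mehlerSphereConst_pos n hρ1 r)) hneg
  refine ⟨h1, ⟨_, hd, h2⟩, ?_⟩
  have h3 := h2.eventually_lt h1 hd
  simpa only [h.flow.flowSet_zero] using h3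

end BallFacts

end SymmetricVariation

/-! ### Time changes of complete flows -/

section TimeChange

/-- Integrating a smooth function over the unit interval gives a smooth function of the
parameters. -/
theorem contDiff_intervalIntegral_unit {P : Type*} [NormedAddCommGroup P] [NormedSpace ℝ P]
    {g : P × ℝ → ℝ} (hg : ContDiff ℝ ∞ g) :
    ContDiff ℝ ∞ fun p => ∫ u in (0 : ℝ)..1, g (p, u) := by
  -- The integral is the value at zero of the convolution of the indicator of `(0, 1]` with `z ↦
  -- b(z) g(p, -z)`. The bump gives compact support and equals one on `[-1, 1]`, so it does not
  -- change the integral.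
  let b : ContDiffBump (0 : ℝ) := ⟨1, 2, by norm_num, by norm_num⟩
  have hf : LocallyIntegrable ((Ioc (0 : ℝ) 1).indicator fun _ => (1 : ℝ)) volume :=
    ((integrableOn_const (by simp)).integrable_indicator measurableSet_Ioc).locallyIntegrable
  have h1 := contDiffOn_convolution_right_with_param_comp (𝕜 := ℝ) (n := ⊤)
    (ContinuousLinearMap.mul ℝ ℝ)
    (s := (univ : Set P)) (v := fun _ => (0 : ℝ)) contDiffOn_const
    (g := fun p z => b z * g (p, -z)) (k := Metric.closedBall 0 2) isOpen_univ
    (isCompact_closedBall 0 2) (fun p z _ hz => by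
      rw [b.zero_of_le_dist (by simpa using (not_le.1 (mt Metric.mem_closedBall.2 hz)).le),
        zero_mul]) hf
    (ContDiff.contDiffOn (by
      have h2 : ContDiff ℝ ∞ fun q : P × ℝ => b q.2 * g (q.1, -q.2) :=
        (b.contDiff.comp contDiff_snd).mul (hg.comp (contDiff_fst.prodMk contDiff_snd.neg))
      exact h2))
  rw [contDiffOn_univ] at h1
  convert! h1 using 2 with p
  rw [intervalIntegral.integral_of_le zero_le_one, ← integral_indicator measurableSet_Ioc,
    convolution_def]
  refine integral_congr_ae (Eventually.of_forall fun t => ?_)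
  by_cases ht : t ∈ Ioc (0 : ℝ) 1
  · have h3 : b (0 - t) = 1 := b.one_of_mem_closedBall (by
      simp [abs_of_pos ht.1, ht.2, b])
    rw [zero_sub] at h3
    simp [ht, h3]
  · simp [ht]

/-- A smooth family of functions with derivative bounded below by a positive constant has a smooth
family of inverses. -/
theorem exists_contDiff_rightInverse {E : Type*} [NormedAddCommGroup E] [NormedSpace ℝ E]
    [CompleteSpace E] {Θ w : E × ℝ → ℝ} (hΘ : ContDiff ℝ ∞ Θ) {δ : ℝ} (hδ : 0 < δ)
    (hw : ∀ p, δ ≤ w p) (hd : ∀ x s, HasDerivAt (fun s => Θ (x, s)) (w (x, s)) s) :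
    ∃ τ : E × ℝ → ℝ, ContDiff ℝ ∞ τ ∧ (∀ x t, Θ (x, τ (x, t)) = t) ∧
      (∀ x s, τ (x, Θ (x, s)) = s) ∧
      ∀ x t, HasDerivAt (fun t => τ (x, t)) (w (x, τ (x, t)))⁻¹ t := by
  have hmono : ∀ x, StrictMono fun s => Θ (x, s) := fun x =>
    strictMono_of_hasDerivAt_pos (fun s => hd x s) fun s => hδ.trans_le (hw _)
  have hsurj : ∀ x t, ∃ s, Θ (x, s) = t := by
    intro x
    have hcont : Continuous fun s => Θ (x, s) :=
      continuous_iff_continuousAt.2 fun s => (hd x s).continuousAt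
    -- Monotonicity of `Θ(x, s) - δ s` forces `Θ(x, ·)` to be unbounded in both directions, hence
    -- onto.
    have hm : Monotone fun s => Θ (x, s) - δ * s := by
      refine monotone_of_deriv_nonneg (fun s => ?_) fun s => ?_
      · exact ((hd x s).sub ((hasDerivAt_id s).const_mul δ)).differentiableAt
      · have h1 := (hd x s).sub ((hasDerivAt_id s).const_mul δ)
        have h2 := h1.deriv
        simp only [id, mul_one, Pi.sub_def] at h2
        rw [h2]
        linarith [hw (x, s)]
    have htop : Tendsto (fun s => Θ (x, s)) atTop atTop := by
      have h1 : Tendsto (fun s : ℝ => δ * s + Θ (x, 0)) atTop atTop :=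
        tendsto_atTop_add_const_right _ _ (tendsto_id.const_mul_atTop hδ)
      refine tendsto_atTop_mono' _ ?_ h1
      filter_upwards [eventually_ge_atTop 0] with s hs
      have := hm hs
      simp only at this
      linarith
    have hbot : Tendsto (fun s => Θ (x, s)) atBot atBot := by
      have h1 : Tendsto (fun s : ℝ => δ * s + Θ (x, 0)) atBot atBot :=
        tendsto_atBot_add_const_right _ _ (tendsto_id.const_mul_atBot hδ)
      refine tendsto_atBot_mono' _ ?_ h1
      filter_upwards [eventually_le_atBot 0] with s hs
      have := hm hs
      simp only at this
      linarith
    exact hcont.surjective htop hbot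
  choose σ hσ using hsurj
  have hinv : ∀ x s, σ x (Θ (x, s)) = s := fun x s => (hmono x).injective (hσ x _)
  have hsm : ContDiff ℝ ∞ fun p : E × ℝ => σ p.1 p.2 := by
    rw [contDiff_iff_contDiffAt]
    rintro ⟨x₀, t₀⟩
    set s₀ := σ x₀ t₀ with hs₀
    -- Smoothness jointly in `x` and `t` comes from the inverse function theorem for `(x, s) ↦ (x,
    -- Θ(x, s))`. Its derivative is block triangular with diagonal entries the identity and `w`, and
    -- its local inverse agrees with `σ` by injectivity.
    set G : E × ℝ → E × ℝ := fun p => (p.1, Θ p) with hG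
    have hGs : ContDiff ℝ ∞ G := contDiff_fst.prodMk hΘ
    have hΘd : HasFDerivAt Θ (fderiv ℝ Θ (x₀, s₀)) (x₀, s₀) :=
      (hΘ.differentiable (by simp) _).hasFDerivAt
    have hsnd : fderiv ℝ Θ (x₀, s₀) (0, 1) = w (x₀, s₀) := by
      have h1 : HasDerivAt (fun s : ℝ => (x₀, s)) ((0 : E), (1 : ℝ)) s₀ :=
        (hasDerivAt_const s₀ x₀).prodMk (hasDerivAt_id s₀)
      exact (hΘd.comp_hasDerivAt s₀ h1).unique (hd x₀ s₀)
    have hw0 : w (x₀, s₀) ≠ 0 := (hδ.trans_le (hw _)).ne'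
    set D := fderiv ℝ Θ (x₀, s₀) with hD
    have hDeq : ∀ v : E × ℝ, D v = D (v.1, 0) + v.2 * w (x₀, s₀) := by
      intro v
      rw [← hsnd, ← smul_eq_mul, ← map_smul, ← map_add]
      simp
    let e : (E × ℝ) ≃L[ℝ] (E × ℝ) := ContinuousLinearEquiv.equivOfInverse
      ((ContinuousLinearMap.fst ℝ E ℝ).prod D)
      ((ContinuousLinearMap.fst ℝ E ℝ).prod ((w (x₀, s₀))⁻¹ •
        (ContinuousLinearMap.snd ℝ E ℝ -
          D.comp ((ContinuousLinearMap.inl ℝ E ℝ).comp (ContinuousLinearMap.fst ℝ E ℝ)))))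
      (fun v => by
        ext
        · simp
        · change (w (x₀, s₀))⁻¹ * (D v - D (v.1, 0)) = v.2
          rw [hDeq v, add_sub_cancel_left]
          field_simp)
      (fun v => by
        ext
        · simp
        · change D (v.1, (w (x₀, s₀))⁻¹ * (v.2 - D (v.1, 0))) = v.2
          rw [hDeq]
          field_simp
          ring)
    have hGd : HasFDerivAt G (e : (E × ℝ) →L[ℝ] (E × ℝ)) (x₀, s₀) := hasFDerivAt_fst.prodMk hΘd
    have hGt : G (x₀, s₀) = (x₀, t₀) := by simp [hG, hs₀, hσ]
    have hstrict := hGs.contDiffAt.hasStrictFDerivAt' hGd (by simp)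
    have h1 := hGs.contDiffAt.to_localInverse hGd (by simp)
    have h2 := hstrict.eventually_right_inverse
    rw [hGt] at h1 h2
    refine (contDiffAt_snd.comp _ h1).congr_of_eventuallyEq ?_
    filter_upwards [h2] with q hq
    set z := hstrict.localInverse G e (x₀, s₀) q with hz
    have h3 : z.1 = q.1 := by
      have h5 := congrArg Prod.fst hq
      exact h5
    have h4 : Θ z = q.2 := by
      have h5 := congrArg Prod.snd hq
      exact h5
    refine (hmono q.1).injective ?_
    simp only [hσ, Function.comp]
    change q.2 = Θ (q.1, z.2)
    rw [← h4, ← h3]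
  refine ⟨fun p => σ p.1 p.2, hsm, hσ, hinv, fun x t => ?_⟩
  exact HasDerivAt.of_local_left_inverse
    (hsm.continuous.comp (Continuous.prodMk_right x)).continuousAt (hd x (σ x t))
    (hδ.trans_le (hw _)).ne' (Eventually.of_forall (hσ x))

/-- Dividing a complete smooth vector field by a smooth function bounded below by a positive
constant gives a complete smooth vector field. -/
theorem exists_flow_inv_smul {E : Type*} [NormedAddCommGroup E] [NormedSpace ℝ E]
    [CompleteSpace E] {Y : E → E} {Φ : E × ℝ → E} (hΦ : ContDiff ℝ ∞ Φ)
    (h0 : ∀ x, Φ (x, 0) = x)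
    (hode : ∀ x s, HasDerivAt (fun s => Φ (x, s)) (Y (Φ (x, s))) s)
    {w : E → ℝ} (hw : ContDiff ℝ ∞ w) {δ : ℝ} (hδ : 0 < δ) (hwδ : ∀ x, δ ≤ w x) :
    ∃ Ψ : E → ℝ → E, ContDiff ℝ ∞ (fun p : E × ℝ => Ψ p.1 p.2) ∧ (∀ x, Ψ x 0 = x) ∧
      ∀ x t, HasDerivAt (Ψ x) ((w (Ψ x t))⁻¹ • Y (Ψ x t)) t := by
  -- The new time after running the old flow for time `s` is `∫₀ˢ w(Φ(x, u)) du`, rescaled to the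
  -- unit interval to make it smooth in `x` and `s` jointly. Running `Φ` for the inverse of this
  -- time divides its field by `w`.
  set Θ : E × ℝ → ℝ := fun p => p.2 * ∫ u in (0 : ℝ)..1, w (Φ (p.1, u * p.2)) with hΘ
  have hΘs : ContDiff ℝ ∞ Θ := by
    refine contDiff_snd.mul (contDiff_intervalIntegral_unit
      (g := fun q : (E × ℝ) × ℝ => w (Φ (q.1.1, q.2 * q.1.2))) ?_)
    exact hw.comp (hΦ.comp (contDiff_fst.fst.prodMk (contDiff_snd.mul contDiff_fst.snd)))
  have hΘe : ∀ x s, Θ (x, s) = ∫ u in (0 : ℝ)..s, w (Φ (x, u)) := by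
    intro x s
    have h1 := intervalIntegral.smul_integral_comp_mul_right (a := 0) (b := 1)
      (fun u => w (Φ (x, u))) s
    rw [zero_mul, one_mul, smul_eq_mul] at h1
    exact h1
  have hcont : ∀ x, Continuous fun u : ℝ => w (Φ (x, u)) := fun x =>
    hw.continuous.comp (hΦ.continuous.comp (Continuous.prodMk_right x))
  have hd : ∀ x s, HasDerivAt (fun s => Θ (x, s)) (w (Φ (x, s))) s := by
    intro x s
    simp only [hΘe]
    exact (hcont x).integral_hasStrictDerivAt 0 s |>.hasDerivAt
  obtain ⟨τ, hτ, -, hτΘ, hτd⟩ := exists_contDiff_rightInverse (w := fun p => w (Φ p)) hΘs hδ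
    (fun p => hwδ _) hd
  refine ⟨fun x t => Φ (x, τ (x, t)), ?_, fun x => ?_, fun x t => ?_⟩
  · exact hΦ.comp (contDiff_fst.prodMk (hτ.comp (contDiff_fst.prodMk contDiff_snd)))
  · have h1 : Θ (x, 0) = 0 := by simp [hΘ]
    have h2 := hτΘ x 0
    rw [h1] at h2
    change Φ (x, τ (x, 0)) = x
    rw [h2, h0]
  · exact (hode x (τ (x, t))).scomp t (hτd x t)

end TimeChange

/-! ### A traceless linear field and its flow -/

section Saddle

variable {n : ℕ}

local notation "𝔼" => EuclideanSpace ℝ (Fin n)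

/-- The traceless symmetric operator `x ↦ xᵢ eᵢ - xⱼ eⱼ`. -/
noncomputable def saddle (i j : Fin n) : 𝔼 →L[ℝ] 𝔼 :=
  (EuclideanSpace.proj i : 𝔼 →L[ℝ] ℝ).smulRight (EuclideanSpace.single i (1 : ℝ)) -
    (EuclideanSpace.proj j : 𝔼 →L[ℝ] ℝ).smulRight (EuclideanSpace.single j (1 : ℝ))

theorem saddle_apply (i j : Fin n) (x : 𝔼) : saddle i j x =
    x i • EuclideanSpace.single i (1 : ℝ) - x j • EuclideanSpace.single j (1 : ℝ) := by
  simp [saddle]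

theorem isSymmetric_saddle (i j : Fin n) : (saddle i j : 𝔼 →ₗ[ℝ] 𝔼).IsSymmetric := by
  intro x y
  simp [saddle_apply, inner_sub_left, inner_sub_right, inner_smul_left, inner_smul_right,
    EuclideanSpace.inner_single_left, EuclideanSpace.inner_single_right]
  ring

theorem trace_saddle (i j : Fin n) :
    LinearMap.trace ℝ 𝔼 (saddle i j : 𝔼 →ₗ[ℝ] 𝔼) = 0 := by
  have : (saddle i j : 𝔼 →ₗ[ℝ] 𝔼) =
      ((EuclideanSpace.proj i : 𝔼 →L[ℝ] ℝ) : 𝔼 →ₗ[ℝ] ℝ).smulRight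
        (EuclideanSpace.single i (1 : ℝ)) -
      ((EuclideanSpace.proj j : 𝔼 →L[ℝ] ℝ) : 𝔼 →ₗ[ℝ] ℝ).smulRight
        (EuclideanSpace.single j (1 : ℝ)) := rfl
  rw [this, map_sub, LinearMap.trace_smulRight, LinearMap.trace_smulRight]
  simp

theorem hilbertSchmidtSq_saddle_pos {i j : Fin n} (hij : i ≠ j) :
    0 < hilbertSchmidtSq (saddle i j) := by
  refine Finset.sum_pos' (fun k _ => sq_nonneg _) ⟨i, Finset.mem_univ _, ?_⟩
  simp [saddle_apply, hij.symm]

theorem exists_flow_saddle {i j : Fin n} (hij : i ≠ j) :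
    ∃ Φ : 𝔼 × ℝ → 𝔼, ContDiff ℝ ∞ Φ ∧ (∀ x, Φ (x, 0) = x) ∧
      ∀ x s, HasDerivAt (fun s => Φ (x, s)) (saddle i j (Φ (x, s))) s := by
  -- The linear flow multiplies the coordinate `i` by `exp s` and the coordinate `j` by `exp (-s)`,
  -- fixing the others.
  refine ⟨fun p => p.1 + ((Real.exp p.2 - 1) * p.1 i) • EuclideanSpace.single i (1 : ℝ) +
    ((Real.exp (-p.2) - 1) * p.1 j) • EuclideanSpace.single j (1 : ℝ), ?_, ?_, ?_⟩
  · have h1 : ∀ k : Fin n, ContDiff ℝ ∞ fun p : 𝔼 × ℝ => p.1 k := fun k =>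
      (EuclideanSpace.proj k : 𝔼 →L[ℝ] ℝ).contDiff.comp contDiff_fst
    exact (contDiff_fst.add ((((Real.contDiff_exp.comp contDiff_snd).sub contDiff_const).mul
      (h1 i)).smul contDiff_const)).add ((((Real.contDiff_exp.comp contDiff_snd.neg).sub
        contDiff_const).mul (h1 j)).smul contDiff_const)
  · intro x; simp
  · intro x s
    have h1 := (((Real.hasDerivAt_exp s).sub_const 1).mul_const (x i)).smul_const
      (EuclideanSpace.single i (1 : ℝ))
    have h2 := ((((hasDerivAt_neg s).exp).sub_const 1).mul_const (x j)).smul_const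
      (EuclideanSpace.single j (1 : ℝ))
    have h3 := (h1.const_add x).add h2
    convert! h3 using 1
    simp only [saddle_apply, PiLp.add_apply, PiLp.smul_apply, PiLp.single_apply, hij,
      hij.symm, if_true, if_false, smul_eq_mul, mul_one, mul_zero, add_zero]
    rw [sub_eq_add_neg, ← neg_smul]
    congr 2 <;> ring

end Saddle

/-! ### Measure-preserving variations that increase noise stability -/

section SaddleVariation

variable {n : ℕ}

local notation "𝔼" => EuclideanSpace ℝ (Fin n)

/-- A function equal to `exp (-‖x‖² / 2)` for `‖x‖² ≤ r² + 1` and bounded below by a positive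
constant. -/
noncomputable def truncatedGaussian (r : ℝ) (x : 𝔼) : ℝ :=
  Real.exp (-‖x‖ ^ 2 / 2) + Real.smoothTransition (‖x‖ ^ 2 - r ^ 2 - 1)

theorem contDiff_truncatedGaussian (r : ℝ) :
    ContDiff ℝ ∞ (truncatedGaussian r : 𝔼 → ℝ) := by
  have h : ContDiff ℝ ∞ fun x : 𝔼 => ‖x‖ ^ 2 := contDiff_norm_sq ℝ
  exact (Real.contDiff_exp.comp (h.neg.div_const 2)).add
    (Real.smoothTransition.contDiff.comp ((h.sub contDiff_const).sub contDiff_const))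

theorem truncatedGaussian_of_le {r : ℝ} {x : 𝔼} (hx : ‖x‖ ^ 2 ≤ r ^ 2 + 1) :
    truncatedGaussian r x = Real.exp (-‖x‖ ^ 2 / 2) := by
  rw [truncatedGaussian, Real.smoothTransition.zero_of_nonpos (by linarith), add_zero]

theorem le_truncatedGaussian (r : ℝ) (x : 𝔼) :
    Real.exp (-(r ^ 2 + 2) / 2) ≤ truncatedGaussian r x := by
  rcases le_total (‖x‖ ^ 2) (r ^ 2 + 2) with hx | hx
  · exact (Real.exp_le_exp.2 (by linarith)).trans
      (le_add_of_nonneg_right (Real.smoothTransition.nonneg _))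
  · rw [truncatedGaussian, Real.smoothTransition.one_of_one_le (by linarith)]
    refine (Real.exp_le_one_iff.2 ?_).trans (le_add_of_nonneg_left (Real.exp_pos _).le)
    have := sq_nonneg r
    linarith

/-- The traceless quadratic fields, rescaled so as to preserve the Gaussian measure near the ball,
generate flows. -/
theorem exists_isSmoothFlow_saddle {i j : Fin n} (hij : i ≠ j) (r : ℝ) {a : ℝ} (ha : 0 < a) :
    ∃ (X : 𝔼 → 𝔼) (Ψ : 𝔼 → ℝ → 𝔼), IsSmoothFlow X Ψ ∧
      ∀ x, X x = (a * truncatedGaussian r x)⁻¹ • saddle i j x := by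
  obtain ⟨Φ, hΦ, h0, hode⟩ := exists_flow_saddle hij
  have hw : ContDiff ℝ ∞ fun x : 𝔼 => a * truncatedGaussian r x :=
    contDiff_const.mul (contDiff_truncatedGaussian r)
  have hδ : 0 < a * Real.exp (-(r ^ 2 + 2) / 2) := by positivity
  have hwδ : ∀ x : 𝔼, a * Real.exp (-(r ^ 2 + 2) / 2) ≤ a * truncatedGaussian r x := fun x =>
    mul_le_mul_of_nonneg_left (le_truncatedGaussian r x) ha.le
  obtain ⟨Ψ, hΨ, hΨ0, hΨode⟩ := exists_flow_inv_smul hΦ h0 hode hw hδ hwδ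
  refine ⟨fun x => (a * truncatedGaussian r x)⁻¹ • saddle i j x, Ψ, ⟨?_, hΨ.contDiffOn, hΨ0,
    fun x t _ => hΨode x t⟩, fun x => rfl⟩
  exact (hw.inv fun x => (hδ.trans_le (hwδ x)).ne').smul (saddle i j).contDiff

theorem IsSmoothFlow.odd {X : 𝔼 → 𝔼} {Ψ : 𝔼 → ℝ → 𝔼} (h : IsSmoothFlow X Ψ)
    (hX : ∀ x, X (-x) = -X x) (x : 𝔼) {t : ℝ} (ht : t ∈ Ioo (-1 : ℝ) 1) :
    Ψ (-x) t = -Ψ x t := by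
  have h1 : EqOn (Ψ (-x)) (fun t => -Ψ x t) (Ioo (-1) 1) :=
    IsIntegralCurve.eqOn_Ioo_of_contDiff h.smooth_field (t₀ := 0) (by simp) (h.ode (-x))
      (fun t ht => by rw [hX]; exact (h.ode x t ht).neg) (by simp [h.initial])
  exact h1 ht

theorem IsSmoothFlow.flowSet_ball_symmetric {X : 𝔼 → 𝔼} {Ψ : 𝔼 → ℝ → 𝔼}
    (h : IsSmoothFlow X Ψ) (hX : ∀ x, X (-x) = -X x) (r : ℝ) {t : ℝ}
    (ht : t ∈ Ioo (-1 : ℝ) 1) (x : 𝔼) :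
    x ∈ flowSet Ψ (Metric.ball 0 r) t ↔ -x ∈ flowSet Ψ (Metric.ball 0 r) t := by
  have key : ∀ x, x ∈ flowSet Ψ (Metric.ball 0 r) t → -x ∈ flowSet Ψ (Metric.ball 0 r) t := by
    rintro _ ⟨y, hy, rfl⟩
    exact ⟨-y, by simpa using hy, h.odd hX y ht⟩
  exact ⟨key x, fun hx => by simpa using key _ hx⟩

theorem IsSmoothFlow.eventually_flowSet_ball_subset {X : 𝔼 → 𝔼} {Ψ : 𝔼 → ℝ → 𝔼}
    (h : IsSmoothFlow X Ψ) {r : ℝ} {U : Set 𝔼} (hU : IsOpen U)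
    (hrU : Metric.closedBall 0 r ⊆ U) :
    ∀ᶠ t in 𝓝 (0 : ℝ), flowSet Ψ (Metric.ball 0 r) t ⊆ U := by
  have h1 : ∀ᶠ t in 𝓝 (0 : ℝ), ∀ x ∈ Metric.closedBall (0 : 𝔼) r, Ψ x t ∈ U := by
    refine (isCompact_closedBall (0 : 𝔼) r).eventually_forall_of_forall_eventually fun x hx => ?_
    have h2 : ContinuousAt (fun p : 𝔼 × ℝ => Ψ p.1 p.2) (x, 0) :=
      h.smooth_flow.continuousOn.continuousAt
        (IsSmoothLocalFlow.isOpen_domain.mem_nhds ⟨mem_univ _, by simp⟩)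
    have h3 := h2.eventually (hU.mem_nhds (show Ψ x 0 ∈ U by rw [h.initial]; exact hrU hx))
    exact (continuous_swap.tendsto ((0 : ℝ), x)).eventually h3
  filter_upwards [h1] with t ht
  rintro _ ⟨x, hx, rfl⟩
  exact ht x (Metric.ball_subset_closedBall hx)

/-- For small times the moving ball stays in `U`, where the divergence of density times field
vanishes, so the measure has zero derivative on a whole interval of times. -/
theorem IsSmoothFlow.eventually_gaussianMeasure_flowSet_ball {X : 𝔼 → 𝔼} {Ψ : 𝔼 → ℝ → 𝔼}
    (h : IsSmoothFlow X Ψ) {r : ℝ} {U : Set 𝔼} (hU : IsOpen U)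
    (hrU : Metric.closedBall 0 r ⊆ U)
    (hX : ∀ x ∈ U, transportDeriv X (gaussianDensity n) x = 0) :
    ∀ᶠ t in 𝓝 (0 : ℝ), (gaussianMeasure n).real (flowSet Ψ (Metric.ball 0 r) t) =
      (gaussianMeasure n).real (Metric.ball 0 r) := by
  obtain ⟨ε, hε, hball⟩ := Metric.eventually_nhds_iff_ball.1
    ((h.eventually_flowSet_ball_subset hU hrU).and eventually_mem_Ioo_one)
  have hd : ∀ t ∈ Metric.ball (0 : ℝ) ε, HasDerivAt
      (fun t => (gaussianMeasure n).real (flowSet Ψ (Metric.ball 0 r) t)) 0 t := by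
    intro t ht
    have h1 := hasDerivAt_gaussianMeasure_flowSet h (r := r) (hball t ht).2
    rwa [setIntegral_eq_zero_of_forall_eq_zero fun x hx => hX x ((hball t ht).1 hx)] at h1
  filter_upwards [Metric.ball_mem_nhds 0 hε] with t ht
  have h1 := (convex_ball (0 : ℝ) ε).is_const_of_fderivWithin_eq_zero (𝕜 := ℝ)
    (fun s hs => (hd s hs).differentiableAt.differentiableWithinAt)
    (fun s hs => by
      rw [fderivWithin_of_isOpen Metric.isOpen_ball hs]
      ext
      simpa using (hd s hs).deriv) ht (Metric.mem_ball_self hε)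
  rw [h1, h.flowSet_zero]

/-- Where the truncation is inactive, the Gaussian factors cancel and density times field is a
constant multiple of `M`, whose divergence is its trace. -/
theorem transportDeriv_inv_truncatedGaussian_smul {X : 𝔼 → 𝔼} {M : 𝔼 →L[ℝ] 𝔼}
    (hM : LinearMap.trace ℝ 𝔼 (M : 𝔼 →ₗ[ℝ] 𝔼) = 0) (hXs : ContDiff ℝ ∞ X) {a r : ℝ}
    (hX : ∀ x, X x = (a * truncatedGaussian r x)⁻¹ • M x) {x : 𝔼}
    (hx : ‖x‖ ^ 2 < r ^ 2 + 1) : transportDeriv X (gaussianDensity n) x = 0 := by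
  rw [← vdiv_smul (contDiff_gaussianDensity.differentiable (by simp) x)
    (hXs.differentiable (by simp) x)]
  have h1 : (fun y => gaussianDensity n y • X y) =ᶠ[𝓝 x]
      (((2 * Real.pi) ^ (-(n : ℝ) / 2) * a⁻¹) • M : 𝔼 →L[ℝ] 𝔼) := by
    have h2 : ∀ᶠ y : 𝔼 in 𝓝 x, ‖y‖ ^ 2 < r ^ 2 + 1 :=
      (continuous_norm.pow 2).continuousAt.eventually (gt_mem_nhds hx)
    filter_upwards [h2] with y hy
    rw [hX, truncatedGaussian_of_le hy.le, gaussianDensity, smul_smul,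
      smul_apply]
    congr 1
    have := (Real.exp_pos (-‖y‖ ^ 2 / 2)).ne'
    rw [mul_inv]
    field_simp
  rw [vdiv, h1.fderiv_eq, ContinuousLinearMap.fderiv]
  have h3 : ((((2 * Real.pi) ^ (-(n : ℝ) / 2) * a⁻¹) • M : 𝔼 →L[ℝ] 𝔼) : 𝔼 →ₗ[ℝ] 𝔼) =
      ((2 * Real.pi) ^ (-(n : ℝ) / 2) * a⁻¹) • (M : 𝔼 →ₗ[ℝ] 𝔼) := rfl
  rw [h3, map_smul, hM, smul_zero]

/-- Symmetric variations of the ball which preserve the Gaussian measure and whose normal component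
on the sphere is a traceless quadratic form. -/
theorem exists_symmetricVariation_saddle [NeZero n] {i j : Fin n} (hij : i ≠ j) {r : ℝ}
    (hr : 0 < r) :
    ∃ (X : 𝔼 → 𝔼) (Ψ : 𝔼 → ℝ → 𝔼) (c : ℝ), IsSymmetricVariation r (Metric.ball 0 r) X Ψ ∧
      (∀ᶠ t in 𝓝 (0 : ℝ), (gaussianMeasure n).real (flowSet Ψ (Metric.ball 0 r) t) =
        (gaussianMeasure n).real (Metric.ball 0 r)) ∧
      ∀ x, ‖x‖ = r → normalComponent r X x = inner ℝ ((c • saddle i j) x) x := by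
  set Q := ∫ x, inner ℝ (saddle i j x) x ^ 2 ∂sphereSurfaceMeasure n r with hQ
  have hQ0 : 0 < Q := by
    rw [hQ, integral_sphere_quadratic_sq (isSymmetric_saddle i j) (trace_saddle i j) hr]
    have h1 : 0 < volume.real (Metric.ball (0 : 𝔼) r) :=
      ENNReal.toReal_pos (Metric.measure_ball_pos _ _ hr).ne' measure_ball_lt_top.ne
    have h2 := hilbertSchmidtSq_saddle_pos hij
    positivity
  -- This scaling gives the normal component `L²` norm one on the sphere.
  set c := (Real.sqrt Q)⁻¹ with hc
  have hc0 : 0 < c := inv_pos.2 (Real.sqrt_pos.2 hQ0)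
  have hcQ : c ^ 2 * Q = 1 := by
    rw [hc, inv_pow, Real.sq_sqrt hQ0.le, inv_mul_cancel₀ hQ0.ne']
  -- With this constant the divisor equals `(c r)⁻¹` on the sphere, so there the field is `c r`
  -- times the saddle, and the normal component, with its factor `r⁻¹`, is exactly `c` times the
  -- quadratic form.
  obtain ⟨X, Ψ, hflow, hX⟩ := exists_isSmoothFlow_saddle hij r
    (show 0 < (c * r)⁻¹ * Real.exp (r ^ 2 / 2) by positivity)
  have hnormal : ∀ x, ‖x‖ = r → normalComponent r X x = inner ℝ ((c • saddle i j) x) x := by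
    intro x hx
    rw [normalComponent, hX, truncatedGaussian_of_le (by rw [hx]; linarith), hx, mul_assoc,
      ← Real.exp_add, show r ^ 2 / 2 + -r ^ 2 / 2 = 0 by ring, Real.exp_zero, mul_one, inv_inv,
      smul_apply, real_inner_smul_left, real_inner_smul_left]
    field_simp
  have hodd : ∀ x, X (-x) = -X x := by
    intro x
    rw [hX, hX, truncatedGaussian, truncatedGaussian, norm_neg, map_neg, smul_neg]
  have hU : IsOpen {x : 𝔼 | ‖x‖ ^ 2 < r ^ 2 + 1} :=
    isOpen_lt (continuous_norm.pow 2) continuous_const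
  have hrU : Metric.closedBall 0 r ⊆ {x : 𝔼 | ‖x‖ ^ 2 < r ^ 2 + 1} := by
    intro x hx
    have h1 : ‖x‖ ≤ r := by simpa using hx
    have h2 := pow_le_pow_left₀ (norm_nonneg x) h1 2
    exact h2.trans_lt (by linarith)
  have hmeas := hflow.eventually_gaussianMeasure_flowSet_ball hU hrU fun x hx =>
    transportDeriv_inv_truncatedGaussian_smul (trace_saddle i j) hflow.smooth_field hX hx
  have hconst : HasDerivAt (fun _ : ℝ => (gaussianMeasure n).real (Metric.ball 0 r)) 0 0 :=
    hasDerivAt_const _ _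
  refine ⟨X, Ψ, c, ⟨hflow, fun t ht => hflow.flowSet_ball_symmetric hodd r ht, ?_,
    hconst.congr_of_eventuallyEq hmeas, ?_⟩, hmeas, hnormal⟩
  · rw [← integral_normalComponent_sq X hr, ← hcQ, hQ, ← integral_const_mul]
    refine integral_congr_ae ?_
    filter_upwards [ae_norm_eq_sphereSurfaceMeasure hr.le] with x hx
    rw [hnormal x hx, smul_apply, real_inner_smul_left, mul_pow]
  · exact HasSecondDerivAt.congr_of_eventuallyEq
      ⟨fun _ => 0, Eventually.of_forall fun s => hasDerivAt_const _ _, hasDerivAt_const _ _⟩ hmeas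

theorem exists_symmetricVariation_noiseStability_gt [NeZero n] {i j : Fin n} (hij : i ≠ j) {r : ℝ}
    (hr : 0 < r) (hrn : (n : ℝ) + 2 < r ^ 2) :
    ∃ ρ₀ : ℝ, 0 < ρ₀ ∧ ∀ ρ : ℝ, 0 < |ρ| → |ρ| < ρ₀ →
      ∀ A : Set 𝔼, (A = Metric.ball 0 r ∨ A = (Metric.ball 0 r)ᶜ) →
        ∃ (X : 𝔼 → 𝔼) (Ψ : 𝔼 → ℝ → 𝔼), IsSymmetricVariation r A X Ψ ∧
          (∀ᶠ t in 𝓝 (0 : ℝ),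
            (gaussianMeasure n).real (flowSet Ψ A t) = (gaussianMeasure n).real A) ∧
          HasDerivAt (fun t => noiseStability n ρ (flowSet Ψ A t)) 0 0 ∧
          (∃ d : ℝ, 0 < d ∧
            HasSecondDerivAt (fun t => noiseStability n ρ (flowSet Ψ A t)) d 0) ∧
          (∀ᶠ t in 𝓝[≠] (0 : ℝ), noiseStability n ρ A < noiseStability n ρ (flowSet Ψ A t)) := by
  obtain ⟨ρ₀, hρ₀, H⟩ := sphereForm_pos hr hrn
  refine ⟨ρ₀, hρ₀, fun ρ hρ hρlt A hA => ?_⟩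
  obtain ⟨hρ1, H⟩ := H ρ hρ hρlt
  obtain ⟨x₀, hx₀⟩ := exists_norm_eq_of_nonneg (n := n) hr.le
  obtain ⟨X, Ψ, c, hball, hmeas, hnormal⟩ := exists_symmetricVariation_saddle hij hr
  have h : IsSymmetricVariation r A X Ψ := by
    rcases hA with rfl | rfl
    · exact hball
    · exact hball.compl measurableSet_ball
  obtain ⟨h1, h2⟩ := noiseStability_variation hA h hr hρ1 hx₀
  have hpos := H (normalComponent r X) (continuous_normalComponent h.flow.smooth_field.continuous r)
    (hball.integral_normalComponent hr) (hball.integral_inner_mul_normalComponent hr)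
    ((integral_normalComponent_sq X hr).trans h.normalized) (c • saddle i j)
    ((isSymmetric_saddle i j).smul (by simp))
    (by
      have h3 : ((c • saddle i j : 𝔼 →L[ℝ] 𝔼) : 𝔼 →ₗ[ℝ] 𝔼) =
        c • (saddle i j : 𝔼 →ₗ[ℝ] 𝔼) := rfl
      rw [h3, map_smul, trace_saddle, smul_zero]) hnormal x₀ hx₀
  have hd := mul_pos (mul_pos two_pos (mehlerSphereConst_pos n hρ1 r)) hpos
  refine ⟨X, Ψ, h, ?_, h1, ⟨_, hd, h2⟩, ?_⟩
  · rcases hA with rfl | rfl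
    · exact hmeas
    · filter_upwards [hmeas, eventually_mem_Ioo_one] with t ht ht1
      rw [h.flow.gaussianMeasure_flowSet_compl measurableSet_ball ht1, ht,
        probReal_compl_eq_one_sub measurableSet_ball, one_mul]
  · simpa only [h.flow.flowSet_zero] using h2.eventually_gt h1 hd

end SaddleVariation

theorem theorem1p8 (n : ℕ) (hn : 2 ≤ n) (r : ℝ) (hr : 0 < r) :
    (r ^ 2 < (n : ℝ) + 2 →
      ∃ ρ₀ : ℝ, 0 < ρ₀ ∧ ∀ ρ : ℝ, 0 < |ρ| → |ρ| < ρ₀ →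
        ∀ A : Set (EuclideanSpace ℝ (Fin n)),
          (A = Metric.ball 0 r ∨ A = (Metric.ball 0 r)ᶜ) →
          ∀ (X : EuclideanSpace ℝ (Fin n) → EuclideanSpace ℝ (Fin n))
            (Ψ : EuclideanSpace ℝ (Fin n) → ℝ → EuclideanSpace ℝ (Fin n)),
            IsSymmetricVariation r A X Ψ →
            HasDerivAt (fun t => noiseStability n ρ (flowSet Ψ A t)) 0 0 ∧
            (∃ d : ℝ, d < 0 ∧
              HasSecondDerivAt (fun t => noiseStability n ρ (flowSet Ψ A t)) d 0) ∧
            (∀ᶠ t in 𝓝[≠] (0 : ℝ), noiseStability n ρ (flowSet Ψ A t) < noiseStability n ρ A)) ∧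
    ((n : ℝ) + 2 < r ^ 2 →
      ∃ ρ₀ : ℝ, 0 < ρ₀ ∧ ∀ ρ : ℝ, 0 < |ρ| → |ρ| < ρ₀ →
        ∀ A : Set (EuclideanSpace ℝ (Fin n)),
          (A = Metric.ball 0 r ∨ A = (Metric.ball 0 r)ᶜ) →
          ∃ (X : EuclideanSpace ℝ (Fin n) → EuclideanSpace ℝ (Fin n))
            (Ψ : EuclideanSpace ℝ (Fin n) → ℝ → EuclideanSpace ℝ (Fin n)),
            IsSymmetricVariation r A X Ψ ∧
            (∀ᶠ t in 𝓝 (0 : ℝ),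
              (gaussianMeasure n).real (flowSet Ψ A t) = (gaussianMeasure n).real A) ∧
            HasDerivAt (fun t => noiseStability n ρ (flowSet Ψ A t)) 0 0 ∧
            (∃ d : ℝ, 0 < d ∧
              HasSecondDerivAt (fun t => noiseStability n ρ (flowSet Ψ A t)) d 0) ∧
            (∀ᶠ t in 𝓝[≠] (0 : ℝ),
              noiseStability n ρ A < noiseStability n ρ (flowSet Ψ A t))) := by
  have : NeZero n := ⟨by omega⟩
  -- The condition `n ≥ 2` supplies two distinct coordinates, hence a nonzero saddle.
  have hij : (⟨0, by omega⟩ : Fin n) ≠ ⟨1, by omega⟩ := by simp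
  exact ⟨exists_forall_symmetricVariation_noiseStability_lt hr,
    exists_symmetricVariation_noiseStability_gt hij hr⟩
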